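/- All vector spaces are real and $\mathbb Z$-graded, and the Koszul sign rule is used throughout; $V[m]_n=V_{n+m}$. $S(\cdot)$ is the graded symmetric coalgebra (product $\vee$, coproduct $\Delta$) and $\wedge^k(\cdot)$ the graded exterior power, $v\wedge w=-(-1)^{|v||w|}w\wedge v$. An $L_\infty$-algebra is a non-positively graded space $\mathfrak g$ with a degree one map $\lambda:S(\mathfrak g[1])\to\mathfrak g[1]$, $\lambda(1)=0$, whose coderivation $d_\lambda$ squares to zero. An $L_\infty$-morphism is a graded counital coaugmented coalgebra morphism $S(\mathfrak g[1])\to S(\mathfrak h[1])$ commuting with the coderivations; it is strict if it is $S(\varphi)$ for a linear map $\varphi:\mathfrak g[1]\to\mathfrak h[1]$, and a quasi-isomorphism if its linear part induces an isomorphism in the cohomology of the underlying complexes. A representation up to homotopy (ruth) of $\mathfrak g$ on $V$ is a degree one map $\rho:S(\mathfrak g[1])\otimes V\to V$ with $\rho(d_\lambda\otimes\mathrm{id})+\rho(\mathrm{id}\otimes\rho)(\Delta\otimes\mathrm{id})=0$; $H^\bullet(\mathfrak g,V)$ is the cohomology of the degree $q$ maps $\alpha:S(\mathfrak g[1])\to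 V$ under $D\alpha=\rho(\mathrm{id}\otimes\alpha)\Delta-(-1)^{q}\alpha d_\lambda$. A ruth morphism $(T,t):(W,\tau)\to(V,\rho)$, from a ruth of $\mathfrak h$ to one of $\mathfrak g$, is an $L_\infty$-morphism $T:\mathfrak h\to\mathfrak g$ with a degree zero map $t:V\to W$ such that $t\rho(T\otimes\mathrm{id})=\tau(\mathrm{id}\otimes t)$; it induces $T^*:H^\bullet(\mathfrak g,V)\to H^\bullet(\mathfrak h,W)$, $[\alpha]\mapsto[t\alpha T]$. Let $0\to\mathfrak n\xrightarrow{\iota}\hat{\mathfrak g}\xrightarrow{\pi}\mathfrak g\to0$ be an extension (a short exact sequence of strict $L_\infty$-morphisms), and let $\mathrm{ad}(x\otimes v)=\hat\lambda(x\vee v)$ be the restriction to $\mathfrak n[1]$ of the adjoint representation of $\hat{\mathfrak g}$, extended to $\wedge^k\mathfrak n[1]$ as a derivation. For $k\ge 0$ and $p\in\mathbb Z$ let $\underline{\mathrm{Hom}}^p(\wedge^k\mathfrak n[1],V)^{\hat{\mathfrak g}}$ be the space of degree $p$ linear maps $f$ that are ruth maps to $V[p]$, i.e. $f(\wedge^k\mathrm{ad}(x\otimes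 y))=(-1)^{p(|x|+1)}\rho(\pi(x)\otimes f(y))$ for homogeneous $x\in S(\hat{\mathfrak g}[1])$ and $y\in\wedge^k\mathfrak n[1]$. For a degree zero linear section $s:\mathfrak g[1]\to\hat{\mathfrak g}[1]$ of $\pi$ let $K_s=\hat\lambda\circ S(s)-s\circ\lambda:S(\mathfrak g[1])\to\mathfrak n[1]$ be its curvature, $K_s^{\wedge k}$ its $k$-fold cochain product and $cw(f)=[f\circ K_s^{\wedge k}]\in H^{k+p}(\mathfrak g,V)$. Let $(T,t):(W,\tau)\to(V,\rho)$ be a ruth morphism as above. A pullback extension of $\hat{\mathfrak g}$ along $T$ is an extension $0\to\mathfrak n\xrightarrow{\iota_\bullet}\hat{\mathfrak h}\xrightarrow{\pi_\bullet}\mathfrak h\to0$ with an $L_\infty$-morphism $T_\bullet:\hat{\mathfrak h}\to\hat{\mathfrak g}$ such that $\pi T_\bullet=T\pi_\bullet$, $T_\bullet\iota_\bullet=\iota$ and $T_\bullet(y\vee\iota_\bullet v)=T_\bullet(y)\vee\iota v$ for $y\in S(\hat{\mathfrak h}[1])$, $v\in\mathfrak n[1]$. **Theorem.** (a) A pullback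 extension $\hat{\mathfrak h}=\mathfrak h\times_{\mathfrak g}\hat{\mathfrak g}$ exists. (b) For every pullback extension $\hat{\mathfrak h}$ and all $k\ge0$, $p\in\mathbb Z$: the maps $cw$ of $\hat{\mathfrak g}$ (with values in $H^{k+p}(\mathfrak g,V)$) and of $\hat{\mathfrak h}$ (with values in $H^{k+p}(\mathfrak h,W)$) are well defined and independent of the section; $t^\sharp(f)=t\circ f$ maps $\underline{\mathrm{Hom}}^p(\wedge^k\mathfrak n[1],V)^{\hat{\mathfrak g}}$ to $\underline{\mathrm{Hom}}^p(\wedge^k\mathfrak n[1],W)^{\hat{\mathfrak h}}$; and $T^*\circ cw=cw\circ t^\sharp$. (c) If $T$ is an $L_\infty$-quasi-isomorphism, then $T^*:H^\bullet(\mathfrak g,V)\to H^\bullet(\mathfrak h,T^*V)$, induced by the ruth morphism $(T,\mathrm{id}_V)$ from $T^*V=(V,\rho\circ(T\otimes\mathrm{id}))$ to $V$, is an isomorphism; for every pullback extension $\hat{\mathfrak h}$, every $f\in\underline{\mathrm{Hom}}^p(\wedge^k\mathfrak n[1],V)^{\hat{\mathfrak g}}$ also lies in $\underline{\mathrm{Hom}}^p(\wedge^k\mathfrak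 n[1],T^*V)^{\hat{\mathfrak h}}$, and $T^*(cw(f))=cw(f)$, so that quasi-isomorphic $L_\infty$-algebras have the same Chern-Weil-Lecomte classes. -/

import Mathlib

open scoped TensorProduct

universe u v w

noncomputable section

/-! ### Graded vector spaces -/

/-- A `ℤ`-graded real vector space `V = ⨁ₙ Vₙ`. -/
structure GVect where
  carrier : Type u
  [grp : AddCommGroup carrier]
  [mod : Module ℝ carrier]
  deg : ℤ → Submodule ℝ carrier
  [dec : DirectSum.Decomposition deg]

instance : CoeSort GVect.{u} (Type u) := ⟨GVect.carrier⟩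

attribute [instance] GVect.grp GVect.mod GVect.dec

namespace GVect

/-- The linear map which is `φ n` on the summand of degree `n`. -/
def piecewise (V : GVect.{u}) {M : Type v} [AddCommGroup M] [Module ℝ M]
    (φ : ℤ → V →ₗ[ℝ] M) : V →ₗ[ℝ] M :=
  (DirectSum.toModule ℝ ℤ M fun n => φ n ∘ₗ (V.deg n).subtype) ∘ₗ
    (DirectSum.decomposeLinearEquiv V.deg).toLinearMap

theorem piecewise_of_mem (V : GVect.{u}) {M : Type v} [AddCommGroup M] [Module ℝ M]
    (φ : ℤ → V →ₗ[ℝ] M) {n : ℤ} {x : V} (hx : x ∈ V.deg n) : V.piecewise φ x = φ n x := by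
  simp only [piecewise, LinearMap.comp_apply, LinearEquiv.coe_coe,
    DirectSum.decomposeLinearEquiv_apply]
  rw [DirectSum.decompose_of_mem V.deg hx]
  erw [DirectSum.toModule_lof]
  simp

/-- Two linear maps that agree on homogeneous elements are equal. -/
theorem hom_ext (V : GVect.{u}) {M : Type v} [AddCommGroup M] [Module ℝ M]
    {f g : V →ₗ[ℝ] M} (h : ∀ n, ∀ x ∈ V.deg n, f x = g x) : f = g := by
  ext x
  induction x using DirectSum.Decomposition.inductionOn V.deg with
  | zero => simp
  | homogeneous m => exact h _ _ m.2
  | add a b ha hb => simp [ha, hb]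

/-- The shift `V[m]`, with `V[m]ₙ = Vₙ₊ₘ`. -/
def shift (V : GVect.{u}) (m : ℤ) : GVect.{u} where
  carrier := V.carrier
  deg n := V.deg (n + m)
  dec := DirectSum.IsInternal.chooseDecomposition _ <| by
    rw [DirectSum.isInternal_submodule_iff_iSupIndep_and_iSup_eq_top]
    have h := (DirectSum.isInternal_submodule_iff_iSupIndep_and_iSup_eq_top V.deg).1
      (DirectSum.Decomposition.isInternal V.deg)
    refine ⟨h.1.comp (f := fun n : ℤ => n + m) (add_left_injective m), ?_⟩
    rw [← h.2]
    exact (Equiv.addRight m).iSup_comp (g := V.deg)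

/-- The sign operator `v ↦ (-1)^(q|v|) v`. -/
def sgn (V : GVect.{u}) (q : ℤ) : V →ₗ[ℝ] V :=
  V.piecewise fun n => (-1 : ℝ) ^ (q * n) • LinearMap.id

theorem sgn_of_mem (V : GVect.{u}) (q : ℤ) {n : ℤ} {x : V} (hx : x ∈ V.deg n) :
    V.sgn q x = (-1 : ℝ) ^ (q * n) • x := by
  simp [sgn, V.piecewise_of_mem _ hx]

/-- A linear map `f` with `f(Vₙ) ⊆ Wₙ₊ₚ` for all `n`. -/
def IsHomog {V : GVect.{u}} {W : GVect.{v}} (p : ℤ) (f : V →ₗ[ℝ] W) : Prop :=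
  ∀ n, ∀ x ∈ V.deg n, f x ∈ W.deg (n + p)

end GVect

/-! ### Symmetric and exterior algebras -/

/-- The relations `v ⊗ w = c (-1)^(|v||w|) w ⊗ v` for homogeneous `v`, `w`. -/
inductive SwapRel (c : ℝ) (V : GVect.{u}) : TensorAlgebra ℝ V → TensorAlgebra ℝ V → Prop
  | swap {p q : ℤ} {v w : V} (hv : v ∈ V.deg p) (hw : w ∈ V.deg q) :
      SwapRel c V (TensorAlgebra.ι ℝ v * TensorAlgebra.ι ℝ w)
        ((c * (-1 : ℝ) ^ (p * q)) • (TensorAlgebra.ι ℝ w * TensorAlgebra.ι ℝ v))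

/-- The quotient of the tensor algebra `T(V)` by the relations `SwapRel c V`. -/
def FreeSwap (c : ℝ) (V : GVect.{u}) : Type u := RingQuot (SwapRel c V)

/-- The symmetric algebra `S(V)`; its multiplication is `∨`. -/
abbrev GSym (V : GVect.{u}) : Type u := FreeSwap 1 V

/-- The exterior algebra `∧V`, the quotient of `T(V)` by
`v ⊗ w = -(-1)^(|v||w|) w ⊗ v`. -/
abbrev GExt (V : GVect.{u}) : Type u := FreeSwap (-1) V

namespace FreeSwap

instance (c : ℝ) (V : GVect.{u}) : Ring (FreeSwap c V) :=
  inferInstanceAs (Ring (RingQuot (SwapRel c V)))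

instance (c : ℝ) (V : GVect.{u}) : Algebra ℝ (FreeSwap c V) :=
  inferInstanceAs (Algebra ℝ (RingQuot (SwapRel c V)))

/-- The projection `T(V) → T(V)/∼`. -/
def proj (c : ℝ) (V : GVect.{u}) : TensorAlgebra ℝ V →ₐ[ℝ] FreeSwap c V :=
  RingQuot.mkAlgHom ℝ (SwapRel c V)

/-- The inclusion of the generators. -/
def ι (c : ℝ) (V : GVect.{u}) : V →ₗ[ℝ] FreeSwap c V :=
  (proj c V).toLinearMap ∘ₗ TensorAlgebra.ι ℝ

theorem ι_mul_ι (c : ℝ) (V : GVect.{u}) {p q : ℤ} {v w : V}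
    (hv : v ∈ V.deg p) (hw : w ∈ V.deg q) :
    ι c V v * ι c V w = (c * (-1 : ℝ) ^ (p * q)) • (ι c V w * ι c V v) := by
  have h : proj c V _ = proj c V _ := RingQuot.mkAlgHom_rel ℝ (SwapRel.swap (c := c) hv hw)
  rw [map_mul, map_smul, map_mul] at h
  exact h

/-- The universal property. -/
def lift (c : ℝ) (V : GVect.{u}) {A : Type v} [Ring A] [Algebra ℝ A] (φ : V →ₗ[ℝ] A)
    (h : ∀ p q, ∀ v ∈ V.deg p, ∀ w ∈ V.deg q,
      φ v * φ w = (c * (-1 : ℝ) ^ (p * q)) • (φ w * φ v)) : FreeSwap c V →ₐ[ℝ] A :=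
  RingQuot.liftAlgHom ℝ ⟨TensorAlgebra.lift ℝ φ, by
    rintro _ _ ⟨hv, hw⟩
    simpa using h _ _ _ hv _ hw⟩

theorem lift_ι (c : ℝ) (V : GVect.{u}) {A : Type v} [Ring A] [Algebra ℝ A] (φ : V →ₗ[ℝ] A)
    (h : ∀ p q, ∀ v ∈ V.deg p, ∀ w ∈ V.deg q,
      φ v * φ w = (c * (-1 : ℝ) ^ (p * q)) • (φ w * φ v)) (v : V) :
    lift c V φ h (ι c V v) = φ v :=
  (RingQuot.liftAlgHom_mkAlgHom_apply ℝ _ _ _).trans (TensorAlgebra.lift_ι_apply _ _)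

theorem induction {c : ℝ} {V : GVect.{u}} {C : FreeSwap c V → Prop} (one : C 1)
    (mul : ∀ n, ∀ v ∈ V.deg n, ∀ x, C x → C (ι c V v * x))
    (add : ∀ x y, C x → C y → C (x + y)) (smul : ∀ (r : ℝ) x, C x → C (r • x))
    (x : FreeSwap c V) : C x := by
  have zero : C 0 := by simpa using smul 0 1 one
  have key : ∀ a : TensorAlgebra ℝ V, ∀ x, C x → C (proj c V a * x) := by
    intro a
    induction a using TensorAlgebra.induction with
    | algebraMap r =>
      intro x hx
      rw [AlgHom.commutes, ← Algebra.smul_def]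
      exact smul _ _ hx
    | ι v =>
      intro x hx
      induction v using DirectSum.Decomposition.inductionOn V.deg with
      | zero => simpa using zero
      | homogeneous m => exact mul _ _ m.2 _ hx
      | add a b ha hb => rw [map_add, map_add, add_mul]; exact add _ _ ha hb
    | mul a b ha hb => intro x hx; rw [map_mul, mul_assoc]; exact ha _ (hb _ hx)
    | add a b ha hb => intro x hx; rw [map_add, add_mul]; exact add _ _ (ha _ hx) (hb _ hx)
  obtain ⟨a, rfl⟩ := RingQuot.mkAlgHom_surjective ℝ (SwapRel c V) x
  have h := key a 1 one
  rw [mul_one] at h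
  exact h

theorem hom_ext {c : ℝ} {V : GVect.{u}} {M : Type v} [AddCommGroup M] [Module ℝ M]
    {f g : FreeSwap c V →ₗ[ℝ] M} (one : f 1 = g 1)
    (mul : ∀ n, ∀ v ∈ V.deg n, ∀ x, f x = g x → f (ι c V v * x) = g (ι c V v * x)) : f = g := by
  ext x
  induction x using FreeSwap.induction with
  | one => exact one
  | mul n v hv x hx => exact mul n v hv x hx
  | add x y hx hy => simp [hx, hy]
  | smul r x hx => simp [hx]

end FreeSwap

namespace GSym

open FreeSwap

/-- The monomials `v₁ ∨ ⋯ ∨ vₙ` of homogeneous elements with `|v₁| + ⋯ + |vₙ| = d`. -/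
inductive IsMonomial (V : GVect.{u}) : ℤ → GSym V → Prop
  | one : IsMonomial V 0 1
  | mul {p d : ℤ} {v : V} {x : GSym V} (hv : v ∈ V.deg p) (hx : IsMonomial V d x) :
      IsMonomial V (p + d) (ι 1 V v * x)

/-- The subspace of elements of degree `d` in `S(V)`. -/
def deg (V : GVect.{u}) (d : ℤ) : Submodule ℝ (GSym V) :=
  Submodule.span ℝ {x | IsMonomial V d x}

/-- The algebra map `S(φ) : S(V) → S(W)` induced by a degree zero map `φ : V → W`. -/
def map {V : GVect.{u}} {W : GVect.{v}} (φ : V →ₗ[ℝ] W) (h : GVect.IsHomog 0 φ) :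
    GSym V →ₐ[ℝ] GSym W :=
  lift 1 V (ι 1 W ∘ₗ φ) fun p q v hv w hw => by
    simpa using ι_mul_ι 1 W (by simpa using h p v hv) (by simpa using h q w hw)

@[simp] theorem map_ι {V : GVect.{u}} {W : GVect.{v}} (φ : V →ₗ[ℝ] W) (h : GVect.IsHomog 0 φ)
    (v : V) : map φ h (ι 1 V v) = ι 1 W (φ v) := by
  simp [map, lift_ι]

theorem isHomog_sgn (V : GVect.{u}) (q : ℤ) : GVect.IsHomog 0 (V.sgn q) := fun n x hx => by
  rw [V.sgn_of_mem q hx]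
  simpa using (V.deg n).smul_mem _ hx

/-- The sign operator `x ↦ (-1)^(q|x|) x` on `S(V)`. -/
def sgn (V : GVect.{u}) (q : ℤ) : GSym V →ₐ[ℝ] GSym V := map (V.sgn q) (isHomog_sgn V q)

theorem sgn_ι_mul (V : GVect.{u}) (q : ℤ) {p : ℤ} {v : V} (hv : v ∈ V.deg p) (x : GSym V) :
    sgn V q (ι 1 V v * x) = (-1 : ℝ) ^ (q * p) • (ι 1 V v * sgn V q x) := by
  simp [sgn, V.sgn_of_mem q hv]

theorem sgn_of_mem (V : GVect.{u}) (q : ℤ) {d : ℤ} {x : GSym V} (hx : x ∈ deg V d) :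
    sgn V q x = (-1 : ℝ) ^ (q * d) • x := by
  have h1 : ∀ d x, IsMonomial V d x → sgn V q x = (-1 : ℝ) ^ (q * d) • x := by
    intro d x hx
    induction hx with
    | one => simp
    | mul hv hx ih =>
      rw [sgn_ι_mul V q hv, ih, mul_smul_comm, smul_smul, mul_add, zpow_add₀ (by norm_num)]
  induction hx using Submodule.span_induction with
  | mem x hx => exact h1 _ _ hx
  | zero => simp
  | add x y _ _ hx hy => simp [hx, hy]
  | smul r x _ hx => rw [map_smul, hx, smul_comm]

theorem hom_ext_deg {V : GVect.{u}} {M : Type v} [AddCommGroup M] [Module ℝ M]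
    {f g : GSym V →ₗ[ℝ] M} (h : ∀ d, ∀ x ∈ deg V d, f x = g x) : f = g := by
  have key : ∀ x : GSym V, x ∈ ⨆ d, deg V d := by
    intro x
    induction x using FreeSwap.induction with
    | one => exact Submodule.mem_iSup_of_mem 0 (Submodule.subset_span .one)
    | mul n v hv x hx =>
      have : (⨆ d, deg V d) ≤ (⨆ d, deg V d).comap (LinearMap.mulLeft ℝ (ι 1 V v)) := by
        refine iSup_le fun d => Submodule.span_le.2 fun y hy => ?_
        exact Submodule.mem_iSup_of_mem (n + d) (Submodule.subset_span (.mul hv hy))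
      exact this hx
    | add x y hx hy => exact add_mem hx hy
    | smul r x hx => exact Submodule.smul_mem _ _ hx
  ext x
  have hle : (⨆ d, deg V d) ≤ LinearMap.eqLocus f g := iSup_le fun d x hx => h d x hx
  exact hle (key x)

/-- Left multiplication by `v⊗1 + 1⊗v` on the graded tensor product `S(V) ⊗ S(V)`: for
homogeneous `v`, `a ⊗ b ↦ (v ∨ a) ⊗ b + (-1)^(|v||a|) a ⊗ (v ∨ b)`. -/
def comulOp (V : GVect.{u}) : V →ₗ[ℝ] Module.End ℝ (GSym V ⊗[ℝ] GSym V) :=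
  V.piecewise fun n =>
    { toFun := fun v =>
        TensorProduct.map (LinearMap.mulLeft ℝ (ι 1 V v)) LinearMap.id +
          TensorProduct.map (sgn V n).toLinearMap (LinearMap.mulLeft ℝ (ι 1 V v))
      map_add' := fun v w => by
        ext; simp [add_mul, TensorProduct.add_tmul, TensorProduct.tmul_add]; abel
      map_smul' := fun r v => by
        ext; simp [TensorProduct.smul_tmul'] }

theorem comulOp_tmul (V : GVect.{u}) {n : ℤ} {v : V} (hv : v ∈ V.deg n) (a b : GSym V) :
    comulOp V v (a ⊗ₜ b) = (ι 1 V v * a) ⊗ₜ b + sgn V n a ⊗ₜ (ι 1 V v * b) := by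
  simp [comulOp, V.piecewise_of_mem _ hv]

/-- The algebra map `S(V) → End(S(V) ⊗ S(V))`, `x ↦ Δ(x) · -`. -/
def comulAct (V : GVect.{u}) : GSym V →ₐ[ℝ] Module.End ℝ (GSym V ⊗[ℝ] GSym V) :=
  lift 1 V (comulOp V) fun p q v hv w hw => by
    refine TensorProduct.ext' fun a b => ?_
    have h := ι_mul_ι 1 V hv hw
    have e : (-1 : ℝ) ^ (p * q) * (-1 : ℝ) ^ (p * q) = 1 := by
      rw [← mul_zpow]; simp
    have hs : sgn V p (sgn V q a) = sgn V q (sgn V p a) := by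
      have : (sgn V p).toLinearMap ∘ₗ (sgn V q).toLinearMap =
          (sgn V q).toLinearMap ∘ₗ (sgn V p).toLinearMap :=
        hom_ext_deg fun d x hx => by
          simp [sgn_of_mem V _ hx, smul_smul, mul_comm]
      exact LinearMap.congr_fun this a
    simp only [Module.End.mul_apply, LinearMap.smul_apply, comulOp_tmul V hv, comulOp_tmul V hw,
      map_add, sgn_ι_mul V p hw, sgn_ι_mul V q hv, ← mul_assoc, h, hs, one_mul, mul_comm q p,
      smul_mul_assoc, smul_add, ← TensorProduct.smul_tmul', ← TensorProduct.tmul_smul,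
      smul_smul, e, one_smul]
    abel

/-- The coproduct `Δ : S(V) → S(V) ⊗ S(V)`: the symmetric deconcatenation, i.e. the algebra map
(for the Koszul sign rule on `S(V) ⊗ S(V)`) with `Δ(v) = v ⊗ 1 + 1 ⊗ v` on generators.
Iterating `comul_ι_mul` expands `Δ(v₁ ∨ ⋯ ∨ vₙ)` into the signed sum over unshuffles. -/
def comul (V : GVect.{u}) : GSym V →ₗ[ℝ] GSym V ⊗[ℝ] GSym V :=
  (LinearMap.applyₗ (1 ⊗ₜ 1 : GSym V ⊗[ℝ] GSym V)) ∘ₗ (comulAct V).toLinearMap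

theorem comul_one (V : GVect.{u}) : comul V 1 = 1 ⊗ₜ 1 := by
  simp [comul]

theorem comul_ι_mul (V : GVect.{u}) (v : V) (x : GSym V) :
    comul V (ι 1 V v * x) = comulOp V v (comul V x) := by
  simp [comul, comulAct, lift_ι]

/-- The counit `S(V) → ℝ`, the projection onto weight `0`. -/
def counit (V : GVect.{u}) : GSym V →ₐ[ℝ] ℝ := lift 1 V 0 fun _ _ _ _ _ _ => by simp

/-- The projection `S(V) → V` onto weight `1`. -/
def pr (V : GVect.{u}) : GSym V →ₗ[ℝ] V :=
  letI : Module ℝᵐᵒᵖ V := Module.compHom _ ((RingHom.id ℝ).fromOpposite mul_comm)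
  haveI : IsCentralScalar ℝ V := ⟨fun _ _ => rfl⟩
  TrivSqZeroExt.sndHom ℝ V ∘ₗ
    (lift 1 V (TrivSqZeroExt.inrHom ℝ V) fun _ _ _ _ _ _ => by simp :
      GSym V →ₐ[ℝ] TrivSqZeroExt ℝ V).toLinearMap

/-- The coderivation `d_λ = μ ∘ (λ ⊗ id) ∘ Δ` of `S(V)` with corestriction `λ : S(V) → V`. -/
def coder {V : GVect.{u}} (lam : GSym V →ₗ[ℝ] V) : GSym V →ₗ[ℝ] GSym V :=
  LinearMap.mul' ℝ (GSym V) ∘ₗ TensorProduct.map (ι 1 V ∘ₗ lam) LinearMap.id ∘ₗ comul V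

theorem map_sgn {V : GVect.{u}} {W : GVect.{v}} (F : GSym V →ₗ[ℝ] GSym W)
    (hF : ∀ d, ∀ x ∈ deg V d, F x ∈ deg W d) (q : ℤ) :
    F ∘ₗ (sgn V q).toLinearMap = (sgn W q).toLinearMap ∘ₗ F :=
  hom_ext_deg fun d x hx => by simp [sgn_of_mem V q hx, sgn_of_mem W q (hF d x hx)]

theorem map_mem_deg {V : GVect.{u}} {W : GVect.{v}} (φ : V →ₗ[ℝ] W) (h : GVect.IsHomog 0 φ)
    {d : ℤ} {x : GSym V} (hx : x ∈ deg V d) : map φ h x ∈ deg W d := by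
  have h1 : ∀ d x, IsMonomial V d x → IsMonomial W d (map φ h x) := by
    intro d x hx
    induction hx with
    | one => simpa using IsMonomial.one
    | mul hv hx ih => rw [map_mul, map_ι]; exact .mul (by simpa using h _ _ hv) ih
  have : deg V d ≤ (deg W d).comap (map φ h).toLinearMap :=
    Submodule.span_le.2 fun y hy => Submodule.subset_span (h1 _ _ hy)
  exact this hx

theorem counit_map {V : GVect.{u}} {W : GVect.{v}} (φ : V →ₗ[ℝ] W) (h : GVect.IsHomog 0 φ)
    (x : GSym V) : counit W (map φ h x) = counit V x := by
  have : (counit W).toLinearMap ∘ₗ (map φ h).toLinearMap = (counit V).toLinearMap :=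
    FreeSwap.hom_ext (by simp) fun n v hv x _ => by simp [counit, lift_ι]
  exact LinearMap.congr_fun this x

theorem comul_map {V : GVect.{u}} {W : GVect.{v}} (φ : V →ₗ[ℝ] W) (h : GVect.IsHomog 0 φ) :
    TensorProduct.map (map φ h).toLinearMap (map φ h).toLinearMap ∘ₗ comul V =
      comul W ∘ₗ (map φ h).toLinearMap := by
  refine FreeSwap.hom_ext (by simp [comul_one]) fun n v hv x hx => ?_
  simp only [LinearMap.comp_apply, AlgHom.toLinearMap_apply, map_mul, map_ι, comul_ι_mul] at hx ⊢
  rw [← hx]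
  have hv' : φ v ∈ W.deg n := by simpa using h n v hv
  generalize comul V x = t
  induction t using TensorProduct.induction_on with
  | zero => simp
  | add a b ha hb => simp only [map_add, ha, hb]
  | tmul a b =>
    have hs := LinearMap.congr_fun
      (map_sgn (map φ h).toLinearMap (fun d x hx => map_mem_deg φ h hx) n) a
    simp only [LinearMap.comp_apply, AlgHom.toLinearMap_apply] at hs
    simp [comulOp_tmul V hv, comulOp_tmul W hv', hs]

end GSym

/-! ### `L∞`-algebras and their morphisms -/

/-- An `L∞`-algebra: a non-positively graded vector space `𝔤` with a degree one map
`λ : S(𝔤[1]) → 𝔤[1]`, `λ(1) = 0`, whose coderivation `d_λ` of `S(𝔤[1])` squares to zero. -/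
structure LInfty where
  g : GVect.{u}
  nonpos : ∀ n > 0, g.deg n = ⊥
  lam : GSym (g.shift 1) →ₗ[ℝ] (g.shift 1).carrier
  lam_deg : ∀ d, ∀ x ∈ GSym.deg (g.shift 1) d, lam x ∈ (g.shift 1).deg (d + 1)
  lam_one : lam 1 = 0
  sq_zero : GSym.coder lam ∘ₗ GSym.coder lam = 0

namespace LInfty

/-- The graded vector space `𝔤[1]`. -/
abbrev sh (L : LInfty.{u}) : GVect.{u} := L.g.shift 1

/-- The codifferential `d_λ` of `S(𝔤[1])`. -/
def d (L : LInfty.{u}) : GSym L.sh →ₗ[ℝ] GSym L.sh := GSym.coder L.lam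

/-- The differential `λ₁` of the underlying complex. -/
def lam₁ (L : LInfty.{u}) : L.sh →ₗ[ℝ] L.sh := L.lam ∘ₗ FreeSwap.ι 1 L.sh

end LInfty

/-- An `L∞`-morphism `F : 𝔤 → 𝔥`: a morphism of graded (counital, coaugmented) coalgebras
`S(𝔤[1]) → S(𝔥[1])` that commutes with the codifferentials. -/
structure LInftyHom (g h : LInfty.{u}) where
  toLin : GSym g.sh →ₗ[ℝ] GSym h.sh
  map_deg : ∀ d, ∀ x ∈ GSym.deg g.sh d, toLin x ∈ GSym.deg h.sh d
  map_one : toLin 1 = 1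
  counit : ∀ x, GSym.counit h.sh (toLin x) = GSym.counit g.sh x
  comul : TensorProduct.map toLin toLin ∘ₗ GSym.comul g.sh = GSym.comul h.sh ∘ₗ toLin
  comm : toLin ∘ₗ g.d = h.d ∘ₗ toLin

namespace LInftyHom

/-- The linear part `F¹₁ : 𝔤[1] → 𝔥[1]`. -/
def linPart {g h : LInfty.{u}} (F : LInftyHom g h) : g.sh →ₗ[ℝ] h.sh :=
  GSym.pr h.sh ∘ₗ F.toLin ∘ₗ FreeSwap.ι 1 g.sh

/-- `F` is an `L∞`-quasi-isomorphism: its linear part induces a surjection and an injection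
between the cohomologies of the underlying complexes. -/
def IsQuasiIso {g h : LInfty.{u}} (F : LInftyHom g h) : Prop :=
  (∀ y, h.lam₁ y = 0 → ∃ x z, g.lam₁ x = 0 ∧ y = F.linPart x + h.lam₁ z) ∧
  (∀ x, g.lam₁ x = 0 → ∀ z, F.linPart x = h.lam₁ z → ∃ y, x = g.lam₁ y)

end LInftyHom

/-- A strict `L∞`-morphism, given by its linear part `φ`: one has `F = S(φ)`, and compatibility
with the codifferentials reads `λ ∘ S(φ) = φ ∘ λ`. -/
structure StrictHom (g h : LInfty.{u}) where
  lin : g.sh →ₗ[ℝ] h.sh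
  homog : GVect.IsHomog 0 lin
  comm : ∀ x, h.lam (GSym.map lin homog x) = lin (g.lam x)

namespace StrictHom

/-- The algebra map `S(φ)`. -/
def symMap {g h : LInfty.{u}} (F : StrictHom g h) : GSym g.sh →ₐ[ℝ] GSym h.sh :=
  GSym.map F.lin F.homog

/-- The underlying `L∞`-morphism `S(φ)`. -/
def toHom {g h : LInfty.{u}} (F : StrictHom g h) : LInftyHom g h where
  toLin := F.symMap.toLinearMap
  map_deg _ _ hx := GSym.map_mem_deg F.lin F.homog hx
  map_one := by simp
  counit := GSym.counit_map F.lin F.homog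
  comul := GSym.comul_map F.lin F.homog
  comm := by
    ext x
    have h := LinearMap.congr_fun (GSym.comul_map F.lin F.homog) x
    simp only [LInfty.d, GSym.coder, LinearMap.comp_apply, AlgHom.toLinearMap_apply,
      symMap] at h ⊢
    rw [← h]
    generalize GSym.comul g.sh x = t
    induction t using TensorProduct.induction_on with
    | zero => simp
    | add a b ha hb => simp only [map_add, ha, hb]
    | tmul a b => simp [F.comm]

end StrictHom

/-! ### Representations up to homotopy and cohomology -/

/-- A representation up to homotopy of `𝔤` on `V`: a degree one map `ρ : S(𝔤[1]) ⊗ V → V` with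
`ρ ∘ (d ⊗ id) + ρ ∘ (id ⊗ ρ) ∘ (Δ ⊗ id) = 0`. As `ρ` has degree one, the Koszul rule turns
`id ⊗ ρ` into `x ⊗ y ⊗ v ↦ (-1)^|x| x ⊗ ρ(y ⊗ v)`. -/
structure Ruth (g : LInfty.{u}) (V : GVect.{v}) where
  act : GSym g.sh ⊗[ℝ] V →ₗ[ℝ] V
  act_deg : ∀ d e, ∀ x ∈ GSym.deg g.sh d, ∀ v ∈ V.deg e, act (x ⊗ₜ v) ∈ V.deg (d + e + 1)
  equivariance :
    act ∘ₗ TensorProduct.map g.d LinearMap.id +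
      act ∘ₗ TensorProduct.map (GSym.sgn g.sh 1).toLinearMap act ∘ₗ
        (TensorProduct.assoc ℝ (GSym g.sh) (GSym g.sh) V).toLinearMap ∘ₗ
          TensorProduct.map (GSym.comul g.sh) LinearMap.id = 0

namespace Ruth

variable {g : LInfty.{u}} {V : GVect.{v}}

/-- The space `C^q(𝔤, V)` of degree `q` linear maps `S(𝔤[1]) → V`. -/
def cochains (g : LInfty.{u}) (V : GVect.{v}) (q : ℤ) : Submodule ℝ (GSym g.sh →ₗ[ℝ] V) where
  carrier := {α | ∀ d, ∀ x ∈ GSym.deg g.sh d, α x ∈ V.deg (d + q)}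
  add_mem' ha hb d x hx := add_mem (ha d x hx) (hb d x hx)
  zero_mem' _ _ _ := zero_mem _
  smul_mem' r _ ha d x hx := Submodule.smul_mem _ r (ha d x hx)

/-- The differential on `C^q(𝔤, V)`, `D α = ρ ∘ (id ⊗ α) ∘ Δ - (-1)^q α ∘ d`, where
`(id ⊗ α)(x ⊗ y) = (-1)^(q|x|) x ⊗ α(y)`. -/
def D (ρ : Ruth g V) (q : ℤ) : (GSym g.sh →ₗ[ℝ] V) →ₗ[ℝ] (GSym g.sh →ₗ[ℝ] V) where
  toFun α := ρ.act ∘ₗ TensorProduct.map (GSym.sgn g.sh q).toLinearMap α ∘ₗ GSym.comul g.sh -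
    (-1 : ℝ) ^ q • α ∘ₗ g.d
  map_add' α β := by
    simp only [TensorProduct.map_add_right, LinearMap.add_comp, LinearMap.comp_add, smul_add]
    abel
  map_smul' r α := by
    simp only [TensorProduct.map_smul_right, LinearMap.smul_comp, LinearMap.comp_smul,
      RingHom.id_apply, smul_sub, smul_comm r]

/-- The cocycles of degree `q`. -/
def cocycles (ρ : Ruth g V) (q : ℤ) : Submodule ℝ (GSym g.sh →ₗ[ℝ] V) :=
  cochains g V q ⊓ LinearMap.ker (ρ.D q)

/-- The coboundaries of degree `q`. -/
def coboundaries (ρ : Ruth g V) (q : ℤ) : Submodule ℝ (GSym g.sh →ₗ[ℝ] V) :=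
  (cochains g V (q - 1)).map (ρ.D (q - 1))

/-- The `L∞`-algebra cohomology `H^q(𝔤, V)`. -/
abbrev H (ρ : Ruth g V) (q : ℤ) : Type _ :=
  ρ.cocycles q ⧸ (ρ.coboundaries q).comap (ρ.cocycles q).subtype

open Classical in
/-- The cohomology class of a cocycle (and `0` for a map that is not a cocycle). -/
def cls (ρ : Ruth g V) (q : ℤ) (α : GSym g.sh →ₗ[ℝ] V) : ρ.H q :=
  if h : α ∈ ρ.cocycles q then Submodule.Quotient.mk ⟨α, h⟩ else 0

/-- The pullback `F^*ρ = ρ ∘ (F ⊗ id)` along an `L∞`-morphism. -/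
def pullback {h : LInfty.{u}} (F : LInftyHom h g) (ρ : Ruth g V) : Ruth h V where
  act := ρ.act ∘ₗ TensorProduct.map F.toLin LinearMap.id
  act_deg d e x hx v hv := by
    simpa using ρ.act_deg d e _ (F.map_deg d x hx) v hv
  equivariance := by
    refine TensorProduct.ext' fun x v => ?_
    have h1 := LinearMap.congr_fun ρ.equivariance (F.toLin x ⊗ₜ v)
    have h2 := LinearMap.congr_fun F.comm x
    have h3 := LinearMap.congr_fun F.comul x
    simp only [LinearMap.add_apply, LinearMap.comp_apply, TensorProduct.map_tmul,
      LinearMap.id_apply, LinearMap.zero_apply, LinearEquiv.coe_coe] at h1 h2 h3 ⊢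
    rw [h2, ← h1, ← h3]
    congr 1
    generalize GSym.comul h.sh x = t
    induction t using TensorProduct.induction_on with
    | zero => simp
    | add a b ha hb => simp only [map_add, TensorProduct.add_tmul, ha, hb]
    | tmul a b =>
      have hs := LinearMap.congr_fun (GSym.map_sgn F.toLin F.map_deg 1) a
      simp only [LinearMap.comp_apply, AlgHom.toLinearMap_apply] at hs
      simp [hs]

end Ruth

/-- A ruth morphism `(T, t) : (W, τ) → (V, ρ)` from a representation of `𝔥` to one of `𝔤`: an
`L∞`-morphism `T : 𝔥 → 𝔤` and a degree zero map `t : V → W` with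
`t ∘ ρ ∘ (T ⊗ id) = τ ∘ (id ⊗ t)`. -/
structure RuthHom {h g : LInfty.{u}} {W : GVect.{w}} {V : GVect.{v}}
    (τ : Ruth h W) (ρ : Ruth g V) where
  T : LInftyHom h g
  t : V →ₗ[ℝ] W
  homog : GVect.IsHomog 0 t
  comm : t ∘ₗ ρ.act ∘ₗ TensorProduct.map T.toLin LinearMap.id =
    τ.act ∘ₗ TensorProduct.map LinearMap.id t

namespace RuthHom

variable {h g : LInfty.{u}} {W : GVect.{w}} {V : GVect.{v}} {τ : Ruth h W} {ρ : Ruth g V}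

/-- The pullback of cochains `T^*α = t ∘ α ∘ T`. -/
def pull (Φ : RuthHom τ ρ) : (GSym g.sh →ₗ[ℝ] V) →ₗ[ℝ] (GSym h.sh →ₗ[ℝ] W) where
  toFun α := Φ.t ∘ₗ α ∘ₗ Φ.T.toLin
  map_add' α β := by simp only [LinearMap.add_comp, LinearMap.comp_add]
  map_smul' r α := by simp only [LinearMap.smul_comp, LinearMap.comp_smul, RingHom.id_apply]

theorem pull_mem_cochains (Φ : RuthHom τ ρ) {q : ℤ} {α : GSym g.sh →ₗ[ℝ] V}
    (hα : α ∈ Ruth.cochains g V q) : Φ.pull α ∈ Ruth.cochains h W q := fun d x hx => by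
  simpa [pull] using Φ.homog _ _ (hα d _ (Φ.T.map_deg d x hx))

theorem pull_D (Φ : RuthHom τ ρ) (q : ℤ) (α : GSym g.sh →ₗ[ℝ] V) :
    Φ.pull (ρ.D q α) = τ.D q (Φ.pull α) := by
  ext x
  have h2 := LinearMap.congr_fun Φ.T.comm x
  have h3 := LinearMap.congr_fun Φ.T.comul x
  simp only [LinearMap.comp_apply] at h2 h3
  simp only [pull, Ruth.D, LinearMap.coe_mk, AddHom.coe_mk, LinearMap.comp_apply,
    LinearMap.sub_apply, LinearMap.smul_apply, map_sub, map_smul, h2, ← h3]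
  congr 1
  generalize GSym.comul h.sh x = t
  induction t using TensorProduct.induction_on with
  | zero => simp
  | add a b ha hb => simp only [map_add, ha, hb]
  | tmul a b =>
    have hs := LinearMap.congr_fun (GSym.map_sgn Φ.T.toLin Φ.T.map_deg q) a
    have hc := LinearMap.congr_fun Φ.comm ((GSym.sgn h.sh q a) ⊗ₜ (α (Φ.T.toLin b)))
    simp only [LinearMap.comp_apply, AlgHom.toLinearMap_apply, TensorProduct.map_tmul,
      LinearMap.id_apply] at hs hc ⊢
    rw [← hs, hc]

theorem pull_mem_cocycles (Φ : RuthHom τ ρ) {q : ℤ} {α : GSym g.sh →ₗ[ℝ] V}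
    (hα : α ∈ ρ.cocycles q) : Φ.pull α ∈ τ.cocycles q :=
  ⟨Φ.pull_mem_cochains hα.1, by
    have h : ρ.D q α = 0 := hα.2
    change τ.D q (Φ.pull α) = 0
    rw [← Φ.pull_D, h, map_zero]⟩

/-- The pullback map `T^* : H^q(𝔤, V) → H^q(𝔥, W)`, `[α] ↦ [t ∘ α ∘ T]`. -/
def pullH (Φ : RuthHom τ ρ) (q : ℤ) : ρ.H q →ₗ[ℝ] τ.H q :=
  Submodule.mapQ _ _ (Φ.pull.restrict fun _ hα => Φ.pull_mem_cocycles hα) <| by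
    rintro ⟨α, hα⟩ ⟨β, hβ, rfl⟩
    exact ⟨Φ.pull β, Φ.pull_mem_cochains hβ, (Φ.pull_D _ β).symm⟩

/-- The canonical ruth morphism `(T, id) : (V, T^*ρ) → (V, ρ)`. -/
def canonical (T : LInftyHom h g) (ρ : Ruth g V) : RuthHom (ρ.pullback T) ρ where
  T := T
  t := LinearMap.id
  homog n x hx := by simpa using hx
  comm := by ext; simp [Ruth.pullback]

end RuthHom

/-! ### Extensions and their curvature -/

/-- An extension `0 → 𝔫 → 𝔤̂ → 𝔤 → 0` of `L∞`-algebras, with `𝔤̂ = mid`: a short exact sequence of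
strict `L∞`-morphisms. -/
structure Extension (n g : LInfty.{u}) where
  mid : LInfty.{u}
  ι : StrictHom n mid
  π : StrictHom mid g
  inj : Function.Injective ι.lin
  exact : Function.Exact ι.lin π.lin
  surj : Function.Surjective π.lin

namespace Extension

variable {n g : LInfty.{u}} (E : Extension n g)

/-- The identification of `ker π` with `𝔫[1]`. -/
def kerEquiv : LinearMap.ker E.π.lin ≃ₗ[ℝ] n.sh :=
  (LinearEquiv.ofEq _ _ E.exact.linearMap_ker_eq).trans
    (LinearEquiv.ofInjective E.ι.lin E.inj).symm

theorem ι_kerEquiv (y : LinearMap.ker E.π.lin) : E.ι.lin (E.kerEquiv y) = y := by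
  have := LinearEquiv.apply_symm_apply (LinearEquiv.ofInjective E.ι.lin E.inj)
    (LinearEquiv.ofEq _ _ E.exact.linearMap_ker_eq y)
  exact congrArg Subtype.val this

/-- The bilinear map `x ⊗ v ↦ λ̂(x ∨ ι(v))` with values in `𝔤̂[1]`. -/
def adMid : GSym E.mid.sh ⊗[ℝ] n.sh →ₗ[ℝ] E.mid.sh :=
  E.mid.lam ∘ₗ LinearMap.mul' ℝ (GSym E.mid.sh) ∘ₗ
    TensorProduct.map LinearMap.id (FreeSwap.ι 1 E.mid.sh ∘ₗ E.ι.lin)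

theorem π_adMid (y : GSym E.mid.sh ⊗[ℝ] n.sh) : E.adMid y ∈ LinearMap.ker E.π.lin := by
  induction y using TensorProduct.induction_on with
  | zero => simp
  | add a b ha hb => rw [map_add]; exact add_mem ha hb
  | tmul a b =>
    have h := E.exact.apply_apply_eq_zero b
    simp [adMid, ← E.π.comm, h]

/-- The restriction of the adjoint representation of `𝔤̂` to the ideal `𝔫[1]`:
`ι(ad(x ⊗ v)) = λ̂(x ∨ ι(v))`. -/
def ad : GSym E.mid.sh ⊗[ℝ] n.sh →ₗ[ℝ] n.sh :=
  E.kerEquiv.toLinearMap ∘ₗ E.adMid.codRestrict _ E.π_adMid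

/-- A (degree preserving, linear) section `s : 𝔤[1] → 𝔤̂[1]` of the extension. -/
structure Splitting where
  lin : g.sh →ₗ[ℝ] E.mid.sh
  homog : GVect.IsHomog 0 lin
  sec : ∀ x, E.π.lin (lin x) = x

/-- Sections exist. -/
theorem nonempty_splitting : Nonempty E.Splitting := by
  obtain ⟨s, hs⟩ := E.π.lin.exists_rightInverse_of_surjective (LinearMap.range_eq_top.2 E.surj)
  let c : ℤ → E.mid.sh →ₗ[ℝ] E.mid.sh := fun m =>
    E.mid.sh.piecewise fun k => if k = m then LinearMap.id else 0
  let c' : ℤ → g.sh →ₗ[ℝ] g.sh := fun m =>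
    g.sh.piecewise fun k => if k = m then LinearMap.id else 0
  have hc : ∀ m, E.π.lin ∘ₗ c m = c' m ∘ₗ E.π.lin := fun m =>
    GVect.hom_ext _ fun k x hx => by
      have hx' : E.π.lin x ∈ g.sh.deg k := by simpa using E.π.homog k x hx
      simp only [LinearMap.comp_apply, c, c', GVect.piecewise_of_mem _ _ hx,
        GVect.piecewise_of_mem _ _ hx']
      split_ifs <;> simp
  have hmem : ∀ m x, c m x ∈ E.mid.sh.deg m := by
    intro m x
    induction x using DirectSum.Decomposition.inductionOn E.mid.sh.deg with
    | zero => simp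
    | @homogeneous k y =>
      simp only [c, GVect.piecewise_of_mem _ _ y.2]
      split_ifs with h
      · subst h; exact y.2
      · simp
    | add a b ha hb => rw [map_add]; exact add_mem ha hb
  refine ⟨⟨g.sh.piecewise fun m => c m ∘ₗ s, fun m x hx => ?_, fun x => ?_⟩⟩
  · rw [GVect.piecewise_of_mem _ _ hx]
    simpa using hmem m (s x)
  · refine LinearMap.congr_fun (f := E.π.lin ∘ₗ g.sh.piecewise fun m => c m ∘ₗ s)
      (g := LinearMap.id) (GVect.hom_ext _ fun m x hx => ?_) x
    have h1 := LinearMap.congr_fun (hc m) (s x)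
    have h2 : E.π.lin (s x) = x := LinearMap.congr_fun hs x
    simp only [LinearMap.comp_apply] at h1 ⊢
    rw [GVect.piecewise_of_mem _ _ hx, LinearMap.comp_apply, h1, h2]
    simp [c', GVect.piecewise_of_mem _ _ hx]

variable {E}

/-- The map `λ̂ ∘ S(s) - s ∘ λ : S(𝔤[1]) → 𝔤̂[1]`. -/
def Splitting.curvMid (s : E.Splitting) : GSym g.sh →ₗ[ℝ] E.mid.sh :=
  E.mid.lam ∘ₗ (GSym.map s.lin s.homog).toLinearMap - s.lin ∘ₗ g.lam

theorem Splitting.π_curvMid (s : E.Splitting) (x : GSym g.sh) :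
    s.curvMid x ∈ LinearMap.ker E.π.lin := by
  have h : (E.π.symMap.toLinearMap ∘ₗ (GSym.map s.lin s.homog).toLinearMap) = LinearMap.id :=
    FreeSwap.hom_ext (by simp) fun n v hv x hx => by
      simp only [LinearMap.comp_apply, AlgHom.toLinearMap_apply, LinearMap.id_apply] at hx
      simp only [StrictHom.symMap] at hx
      simp [hx, StrictHom.symMap, s.sec]
  have h' : GSym.map E.π.lin E.π.homog (GSym.map s.lin s.homog x) = x := LinearMap.congr_fun h x
  simp [curvMid, ← E.π.comm, s.sec, h']

/-- The curvature `K_s : S(𝔤[1]) → 𝔫[1]` of a section: `ι ∘ K_s = λ̂ ∘ S(s) - s ∘ λ`. -/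
def Splitting.curv (s : E.Splitting) : GSym g.sh →ₗ[ℝ] n.sh :=
  E.kerEquiv.toLinearMap ∘ₗ s.curvMid.codRestrict _ s.π_curvMid

end Extension

/-! ### Exterior powers and the Chern-Weil-Lecomte map -/

namespace GExt

/-- The exterior power `∧^k N`: the span of the `k`-fold products in `∧N`. -/
abbrev Pow (k : ℕ) (N : GVect.{u}) : Type u :=
  ((LinearMap.range (FreeSwap.ι (-1) N)) ^ k : Submodule ℝ (GExt N))

theorem prod_mem {N : GVect.{u}} {k : ℕ} (v : Fin k → N) :
    (List.ofFn fun i => FreeSwap.ι (-1) N (v i)).prod ∈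
      (LinearMap.range (FreeSwap.ι (-1) N)) ^ k := by
  induction k with
  | zero =>
    rw [List.ofFn_zero, List.prod_nil, pow_zero]
    exact Submodule.one_le.1 le_rfl
  | succ k ih =>
    rw [List.ofFn_succ, List.prod_cons, pow_succ']
    exact Submodule.mul_mem_mul ⟨_, rfl⟩ (ih fun i => v i.succ)

/-- `v₁ ∧ ⋯ ∧ v_k`. -/
def wedge {N : GVect.{u}} {k : ℕ} (v : Fin k → N) : Pow k N :=
  ⟨(List.ofFn fun i => FreeSwap.ι (-1) N (v i)).prod, prod_mem v⟩

/-- The value on `x ⊗ (v₁ ∧ ⋯ ∧ v_k)` of the action `∧^k a` induced by a degree one map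
`a : A ⊗ N → N`, for `x` of degree `d` and `vᵢ` of degree `eᵢ`:
`∑ᵢ (-1)^((d+1)(e₁+⋯+eᵢ₋₁)) v₁ ∧ ⋯ ∧ a(x ⊗ vᵢ) ∧ ⋯ ∧ v_k`. -/
def powAct {A : Type v} [AddCommGroup A] [Module ℝ A] {N : GVect.{u}}
    (a : A ⊗[ℝ] N →ₗ[ℝ] N) (d : ℤ) (x : A) {k : ℕ} (e : Fin k → ℤ) (v : Fin k → N) : Pow k N :=
  ∑ i, (-1 : ℝ) ^ ((d + 1) * ∑ j with j < i, e j) • wedge (Function.update v i (a (x ⊗ₜ v i)))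

/-- The `k`-fold cochain product `K ∧ ⋯ ∧ K` of a degree one map `K : S(U) → N`, with values
in `∧N`: `K^(k+1) = μ ∘ (K ⊗ K^k) ∘ Δ`, where `(K ⊗ K^k)(x ⊗ y) = (-1)^(k|x|) K(x) ⊗ K^k(y)`. -/
def cupPow {U : GVect.{v}} {N : GVect.{u}} (K : GSym U →ₗ[ℝ] N) : ℕ → (GSym U →ₗ[ℝ] GExt N)
  | 0 => Algebra.linearMap ℝ (GExt N) ∘ₗ (GSym.counit U).toLinearMap
  | k + 1 => LinearMap.mul' ℝ (GExt N) ∘ₗ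
      TensorProduct.map (FreeSwap.ι (-1) N ∘ₗ K ∘ₗ (GSym.sgn U k).toLinearMap) (cupPow K k) ∘ₗ
        GSym.comul U

theorem cupPow_mem {U : GVect.{v}} {N : GVect.{u}} (K : GSym U →ₗ[ℝ] N) (k : ℕ) (x : GSym U) :
    cupPow K k x ∈ (LinearMap.range (FreeSwap.ι (-1) N)) ^ k := by
  induction k generalizing x with
  | zero => simp [cupPow]
  | succ k ih =>
    simp only [cupPow, LinearMap.comp_apply]
    generalize GSym.comul U x = t
    induction t using TensorProduct.induction_on with
    | zero => simp
    | add a b ha hb => simp only [map_add]; exact add_mem ha hb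
    | tmul a b =>
      rw [TensorProduct.map_tmul, LinearMap.mul'_apply, pow_succ']
      exact Submodule.mul_mem_mul ⟨_, rfl⟩ (ih b)

end GExt

namespace Extension

variable {n g : LInfty.{u}} (E : Extension n g) {V : GVect.{v}}

/-- The space `Hom^p(∧^k 𝔫[1], V)^𝔤̂` of degree `p` ruth maps from `(∧^k 𝔫[1], ∧^k ad)` to
`(V, π^*ρ)`: degree `p` linear maps `f` with
`f((∧^k ad)(x ⊗ y)) = (-1)^(p(|x|+1)) (π^*ρ)(x ⊗ f(y))`, i.e. degree zero ruth maps to the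
shifted representation `V[p]`. -/
def Inv (ρ : Ruth g V) (k : ℕ) (p : ℤ) : Submodule ℝ (GExt.Pow k n.sh →ₗ[ℝ] V) where
  carrier := {f |
    (∀ (e : Fin k → ℤ) (v : Fin k → n.sh), (∀ i, v i ∈ n.sh.deg (e i)) →
      f (GExt.wedge v) ∈ V.deg ((∑ i, e i) + p)) ∧
    (∀ (d : ℤ) (x : GSym E.mid.sh), x ∈ GSym.deg E.mid.sh d →
      ∀ (e : Fin k → ℤ) (v : Fin k → n.sh), (∀ i, v i ∈ n.sh.deg (e i)) →
        f (GExt.powAct E.ad d x e v) =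
          (-1 : ℝ) ^ (p * (d + 1)) • (ρ.pullback E.π.toHom).act (x ⊗ₜ f (GExt.wedge v)))}
  add_mem' ha hb := ⟨fun e v hv => add_mem (ha.1 e v hv) (hb.1 e v hv), fun d x hx e v hv => by
    simp only [LinearMap.add_apply, ha.2 d x hx e v hv, hb.2 d x hx e v hv,
      TensorProduct.tmul_add, map_add, smul_add]⟩
  zero_mem' := ⟨fun e v _ => zero_mem _, fun d x _ e v _ => by simp⟩
  smul_mem' r f hf := ⟨fun e v hv => Submodule.smul_mem _ r (hf.1 e v hv), fun d x hx e v hv => by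
    simp only [LinearMap.smul_apply, hf.2 d x hx e v hv, TensorProduct.tmul_smul, map_smul]
    rw [smul_comm]⟩

variable {E}

/-- The cochain `f_{K_s} = f ∘ (K_s ∧ ⋯ ∧ K_s) : S(𝔤[1]) → V`. -/
def Splitting.cwCochain (s : E.Splitting) {k : ℕ} (f : GExt.Pow k n.sh →ₗ[ℝ] V) :
    GSym g.sh →ₗ[ℝ] V :=
  f ∘ₗ (GExt.cupPow s.curv k).codRestrict _ (GExt.cupPow_mem s.curv k)

variable (E)

/-- The Chern-Weil-Lecomte map `cw : Hom^p(∧^k 𝔫[1], V)^𝔤̂ → H^(k+p)(𝔤, V)`, `f ↦ [f_{K_s}]`,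
computed with an arbitrarily chosen section `s`. -/
def cw (ρ : Ruth g V) (k : ℕ) (p : ℤ) (f : E.Inv ρ k p) : ρ.H (k + p) :=
  ρ.cls (k + p) ((Classical.choice E.nonempty_splitting).cwCochain f.1)

/-- The Chern-Weil-Lecomte map is well defined: for every invariant `f`, the cochain `f_{K_s}` is
a cocycle of degree `k + p` for every section `s`, and its class is `cw f`, whatever `s` is. -/
def CWWellDefined (ρ : Ruth g V) (k : ℕ) (p : ℤ) : Prop :=
  ∀ (f : E.Inv ρ k p) (s : E.Splitting),
    s.cwCochain f.1 ∈ ρ.cocycles (k + p) ∧ E.cw ρ k p f = ρ.cls (k + p) (s.cwCochain f.1)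

end Extension

/-- A pullback of the extension `E : 0 → 𝔫 → 𝔤̂ → 𝔤 → 0` along an `L∞`-morphism `T : 𝔥 → 𝔤`: an
extension `0 → 𝔫 → 𝔥̂ → 𝔥 → 0` and an `L∞`-morphism `hom = T• : 𝔥̂ → 𝔤̂` which is the identity on
`𝔫` and covers `T`, so that the square over `T` and `π` is a pullback square, normalised by
`T•(y ∨ ι•(v)) = T•(y) ∨ ι(v)`: the map `T•` is not deformed in the direction of `𝔫`. This holds
for the model with `𝔥̂[1] = 𝔥[1] ⊕ 𝔫[1]` and `T• = (S(s) ∘ T ∘ S(pr)) ∨ S(ι ∘ pr)` defined by a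
section `s` of `π`. -/
structure PullbackExtension {n g h : LInfty.{u}} (E : Extension n g) (T : LInftyHom h g) where
  ext : Extension n h
  hom : LInftyHom ext.mid E.mid
  comm_π : E.π.toHom.toLin ∘ₗ hom.toLin = T.toLin ∘ₗ ext.π.toHom.toLin
  comm_ι : hom.toLin ∘ₗ ext.ι.toHom.toLin = E.ι.toHom.toLin
  hom_mul_ι : ∀ (y : GSym ext.mid.sh) (v : n.sh),
    hom.toLin (y * FreeSwap.ι 1 ext.mid.sh (ext.ι.lin v)) =
      hom.toLin y * FreeSwap.ι 1 E.mid.sh (E.ι.lin v)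

end

open scoped TensorProduct

noncomputable section

/-! ### Weights in free algebras -/

namespace FreeSwap

variable {c : ℝ} {V : GVect.{u}}

/-! The cochain attached to a section makes sense for every coalgebra morphism F : S(𝔥[1]) →
S(𝔤̂[1]) covering T, whether or not F commutes with the codifferentials (`IsLift`). Its curvature K
is defined by ιK = λ̂F - pr F d. The defect d̂F - Fd is the coderivation along F with corestriction
ιK (`IsCurv.d_apply`). Since λ̂d̂ = 0, this yields the Bianchi identity (`IsCurv.bianchi`). The
derivation property carries it over to the powers of K (`IsCurv.act_cupPow`), and invariance of f
then makes t f K^k a cocycle (`IsCurv.cwMap_mem_cocycles`).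

Both sides of the naturality formula are classes of lifts of the same T. The pullback of the cochain
of a section s belongs to the lift S(s)T. For a section s' of a pullback extension, T•S(s') is
another lift, and the normalisation of T• makes its curvature equal to K_{s'}
(`PullbackExtension.isCurv`). Hence naturality, and for T = id independence of the section, reduce
to one claim: the class depends only on the morphism that is lifted (`IsCurv.cls_eq`). To compare
two lifts, 𝔥 is multiplied by the contractible complex 𝔫 ⊕ 𝔫[1]. The first lift extends over this
cylinder in such a way that both lifts are restrictions of the extension along right inverses of the
projection to 𝔥. The projection is a quasi-isomorphism, so its right inverses agree in cohomology.
Thus the invariance in (c) is also the tool for (b), and no explicit transgression formula is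
needed.

Invariance under quasi-isomorphisms (`canonical_pullH_bijective`) is acyclicity of the mapping cone
of T^*. Cochains are filtered by the weight in which they start. Leading terms only see the linear
part of T, the unary bracket λ₁ and ρ(1 ⊗ -). Over a field the linear part has a homotopy inverse,
which extends to all symmetric powers (`map_eq_add_symHtpy`). So leading terms can be removed one
weight at a time (`exists_step`), and the corrections can be summed because each weight sees
finitely many of them.

The pullback extension lives on 𝔥[1] ⊕ 𝔫[1]. There T• is prescribed as a coalgebra morphism, and the
bracket is chosen so that T• commutes with the codifferentials (`pullHom_coder`).

Everything rests on cofreeness of S(V): coalgebra morphisms and coderivations along them exist with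
given corestriction and are determined by it. The Euler operator E, which multiplies weight n by n,
gives E F = κ * F for a morphism F with corestriction κ. As κ(1) = 0, this is a recursion in the
weight, solved by the convolution exponential `expo`. -/

/-- The subspace of elements of weight `n`. -/
abbrev wt (c : ℝ) (V : GVect.{u}) (n : ℕ) : Submodule ℝ (FreeSwap c V) :=
  LinearMap.range (ι c V) ^ n

theorem one_mem_wt : (1 : FreeSwap c V) ∈ wt c V 0 := by
  rw [wt, pow_zero]; exact Submodule.one_le.1 le_rfl

theorem mem_wt_zero {x : FreeSwap c V} (hx : x ∈ wt c V 0) : ∃ r : ℝ, x = r • 1 := by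
  rw [wt, pow_zero] at hx
  obtain ⟨r, rfl⟩ := Submodule.mem_one.1 hx
  exact ⟨r, Algebra.algebraMap_eq_smul_one r⟩

theorem ι_mul_mem_wt {n : ℕ} (v : V) {x : FreeSwap c V} (hx : x ∈ wt c V n) :
    ι c V v * x ∈ wt c V (n + 1) := by
  rw [wt, pow_succ']; exact Submodule.mul_mem_mul ⟨v, rfl⟩ hx

theorem ι_mem_wt (v : V) : ι c V v ∈ wt c V 1 := by
  rw [wt, pow_one]; exact ⟨v, rfl⟩

theorem wt_induction {C : ∀ n, ∀ x ∈ wt c V n, Prop} (one : C 0 1 one_mem_wt)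
    (mul : ∀ n p, ∀ v ∈ V.deg p, ∀ x (hx : x ∈ wt c V n), C n x hx →
      C (n + 1) (ι c V v * x) (ι_mul_mem_wt v hx))
    (add : ∀ n x y (hx : x ∈ wt c V n) (hy : y ∈ wt c V n), C n x hx → C n y hy →
      C n (x + y) (add_mem hx hy))
    (smul : ∀ n (r : ℝ) x (hx : x ∈ wt c V n), C n x hx →
      C n (r • x) (Submodule.smul_mem _ r hx))
    {n : ℕ} {x : FreeSwap c V} (hx : x ∈ wt c V n) : C n x hx := by
  induction n generalizing x with
  | zero => obtain ⟨r, rfl⟩ := mem_wt_zero hx; exact smul _ _ _ _ one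
  | succ n ih =>
    have zero : C (n + 1) 0 (zero_mem _) := by
      have := smul (n + 1) 0 _ _ (mul n 0 0 (zero_mem _) _ (zero_mem _) (ih (zero_mem _)))
      simpa using this
    have key : ∀ y, y ∈ LinearMap.range (ι c V) * wt c V n → ∃ hy, C (n + 1) y hy := by
      intro y hy
      induction hy using Submodule.mul_induction_on' with
      | mem_mul_mem a ha b hb =>
        obtain ⟨v, rfl⟩ := ha
        induction v using DirectSum.Decomposition.inductionOn V.deg with
        | zero => exact ⟨by simp, by simpa using zero⟩
        | homogeneous m => exact ⟨_, mul _ _ _ m.2 _ hb (ih hb)⟩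
        | add a b ha hb =>
          rw [map_add, add_mul]
          exact ⟨_, add _ _ _ _ _ ha.2 hb.2⟩
      | add a ha b hb h1 h2 => exact ⟨_, add _ _ _ _ _ h1.2 h2.2⟩
    rw [wt, pow_succ'] at hx
    exact (key x hx).2

theorem mem_iSup_wt (x : FreeSwap c V) : x ∈ ⨆ n, wt c V n := by
  induction x using FreeSwap.induction with
  | one => exact Submodule.mem_iSup_of_mem 0 one_mem_wt
  | mul n v hv x hx =>
    have : (⨆ n, wt c V n) ≤ (⨆ n, wt c V n).comap (LinearMap.mulLeft ℝ (ι c V v)) :=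
      iSup_le fun n _ hy => Submodule.mem_iSup_of_mem (n + 1) (ι_mul_mem_wt v hy)
    exact this hx
  | add x y hx hy => exact add_mem hx hy
  | smul r x hx => exact Submodule.smul_mem _ _ hx

/-- Two linear maps that agree on the elements of each weight are equal. -/
theorem hom_ext_wt {M : Type v} [AddCommGroup M] [Module ℝ M] {f g : FreeSwap c V →ₗ[ℝ] M}
    (h : ∀ n, ∀ x ∈ wt c V n, f x = g x) : f = g := by
  ext x
  have hle : (⨆ n, wt c V n) ≤ LinearMap.eqLocus f g := iSup_le fun n x hx => h n x hx
  exact hle (mem_iSup_wt x)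

/-- The algebra map `x ↦ xtⁿ` for `x` of weight `n`. -/
def poly (c : ℝ) (V : GVect.{u}) : FreeSwap c V →ₐ[ℝ] Polynomial (FreeSwap c V) :=
  lift c V ((Polynomial.monomial 1).restrictScalars ℝ ∘ₗ ι c V) fun p q v hv w hw => by
    simp only [LinearMap.comp_apply, LinearMap.restrictScalars_apply,
      Polynomial.monomial_mul_monomial, Polynomial.smul_monomial]
    rw [ι_mul_ι c V hv hw]

@[simp] theorem poly_ι (v : V) : poly c V (ι c V v) = Polynomial.monomial 1 (ι c V v) := by
  simp [poly, lift_ι]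

/-- The variable records the weight, so the components of an element are polynomial coefficients.
This is what makes `glue` a well-defined way to build maps weight by weight. -/
theorem poly_of_mem {n : ℕ} {x : FreeSwap c V} (hx : x ∈ wt c V n) :
    poly c V x = Polynomial.monomial n x := by
  induction hx using wt_induction with
  | one => simp
  | mul n p v hv x hx ih =>
    rw [map_mul, ih, poly_ι, Polynomial.monomial_mul_monomial, add_comm]
  | add n x y _ _ hx hy => simp [hx, hy]
  | smul n r x _ hx => rw [map_smul, hx, Polynomial.smul_monomial]

/-- The linear map that is `A n` on the elements of weight `n`. -/
def glue {M : Type v} [AddCommGroup M] [Module ℝ M] (A : ℕ → FreeSwap c V →ₗ[ℝ] M) :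
    FreeSwap c V →ₗ[ℝ] M where
  toFun x := (poly c V x).sum fun n => A n
  map_add' x y := by
    rw [map_add, Polynomial.sum_add_index] <;> simp
  map_smul' r x := by
    rw [map_smul, Polynomial.sum_smul_index'] <;> simp [Polynomial.sum, Finset.smul_sum]

theorem glue_of_mem {M : Type v} [AddCommGroup M] [Module ℝ M] (A : ℕ → FreeSwap c V →ₗ[ℝ] M)
    {n : ℕ} {x : FreeSwap c V} (hx : x ∈ wt c V n) : glue A x = A n x := by
  simp [glue, poly_of_mem hx, Polynomial.sum_monomial_index]

/-- The projection onto weight `m`. -/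
def wproj (c : ℝ) (V : GVect.{u}) (m : ℕ) : FreeSwap c V →ₗ[ℝ] FreeSwap c V :=
  glue fun n => if n = m then LinearMap.id else 0

theorem wproj_of_mem {m n : ℕ} {x : FreeSwap c V} (hx : x ∈ wt c V n) :
    wproj c V m x = if n = m then x else 0 := by
  rw [wproj, glue_of_mem _ hx]; split_ifs <;> rfl

theorem wproj_mem (m : ℕ) (x : FreeSwap c V) : wproj c V m x ∈ wt c V m := by
  have : (⨆ n, wt c V n) ≤ (wt c V m).comap (wproj c V m) := iSup_le fun n y hy => by
    rw [Submodule.mem_comap, wproj_of_mem hy]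
    split_ifs with h
    · exact h ▸ hy
    · exact zero_mem _
  exact this (mem_iSup_wt x)

/-- Stated for all cutoffs beyond some bound, so that two elements can be expanded with a common
cutoff. -/
theorem exists_sum_wproj (x : FreeSwap c V) :
    ∃ m, ∀ n ≥ m, x = ∑ i ∈ Finset.range n, wproj c V i x := by
  induction x using FreeSwap.induction with
  | one =>
    refine ⟨1, fun n hn => ?_⟩
    simp only [wproj_of_mem one_mem_wt]
    rw [Finset.sum_ite_eq, if_pos (Finset.mem_range.2 hn)]
  | mul p v hv x hx =>
    obtain ⟨m, hm⟩ := hx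
    refine ⟨m + 1, fun n hn => ?_⟩
    obtain ⟨n, rfl⟩ : ∃ k, n = k + 1 := ⟨n - 1, by omega⟩
    have h := hm n (by omega)
    have hz : ∀ i, wproj c V i (ι c V v * x) = ∑ j ∈ Finset.range n, 
        if j + 1 = i then ι c V v * wproj c V j x else 0 := fun i => by
      conv_lhs => rw [h, Finset.mul_sum, map_sum]
      exact Finset.sum_congr rfl fun j _ => wproj_of_mem (ι_mul_mem_wt v (wproj_mem j x))
    simp only [hz]
    rw [Finset.sum_comm]
    conv_lhs => rw [h, Finset.mul_sum]
    refine Finset.sum_congr rfl fun j hj => ?_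
    rw [Finset.sum_ite_eq, if_pos (by simpa using hj)]
  | add x y hx hy =>
    obtain ⟨m, hm⟩ := hx
    obtain ⟨m', hm'⟩ := hy
    refine ⟨max m m', fun n hn => ?_⟩
    simp only [map_add, Finset.sum_add_distrib]
    rw [← hm n (by omega), ← hm' n (by omega)]
  | smul r x hx =>
    obtain ⟨m, hm⟩ := hx
    refine ⟨m, fun n hn => ?_⟩
    simp only [map_smul, ← Finset.smul_sum]
    rw [← hm n hn]

end FreeSwap

/-! ### Weight and degree in S(V): counit, projection to V, coproduct. -/

namespace GSym

open FreeSwap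

variable {V : GVect.{u}} {W : GVect.{v}}

@[simp] theorem counit_ι (v : V) : counit V (ι 1 V v) = 0 := by simp [counit, lift_ι]

theorem counit_of_mem {n : ℕ} {x : GSym V} (hx : x ∈ wt 1 V n) (hn : n ≠ 0) :
    counit V x = 0 := by
  induction hx using wt_induction with
  | one => exact absurd rfl hn
  | mul n p v hv x hx ih => simp
  | add n x y _ _ hx hy => simp [hx hn, hy hn]
  | smul n r x _ hx => simp [hx hn]

theorem pr_one : pr V 1 = 0 := by
  let _ : Module ℝᵐᵒᵖ V := Module.compHom _ ((RingHom.id ℝ).fromOpposite mul_comm)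
  have _ : IsCentralScalar ℝ V := ⟨fun _ _ => rfl⟩
  rw [pr, LinearMap.comp_apply, AlgHom.toLinearMap_apply]
  erw [map_one]
  rfl

/-- `pr` is the second component of an algebra map to the square-zero extension ℝ ⊕ V whose first
component is the counit; this is the product rule there. -/
theorem pr_ι_mul (v : V) (x : GSym V) : pr V (ι 1 V v * x) = counit V x • v := by
  let _ : Module ℝᵐᵒᵖ V := Module.compHom _ ((RingHom.id ℝ).fromOpposite mul_comm)
  have _ : IsCentralScalar ℝ V := ⟨fun _ _ => rfl⟩
  have h : ∀ x : GSym V, TrivSqZeroExt.fst ((lift 1 V (TrivSqZeroExt.inrHom ℝ V)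
      fun _ _ _ _ _ _ => by simp : GSym V →ₐ[ℝ] TrivSqZeroExt ℝ V) x) = counit V x := by
    intro x
    induction x using FreeSwap.induction with
    | one => rw [map_one, map_one, TrivSqZeroExt.fst_one]
    | mul n v hv x hx => simp [lift_ι]
    | add x y hx hy => simp [hx, hy]
    | smul r x hx => simp [hx]
  simp [pr, lift_ι, h]

@[simp] theorem pr_ι (v : V) : pr V (ι 1 V v) = v := by
  simpa using pr_ι_mul v 1

theorem pr_of_mem {n : ℕ} {x : GSym V} (hx : x ∈ wt 1 V n) (hn : n ≠ 1) : pr V x = 0 := by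
  induction hx using wt_induction with
  | one => exact pr_one
  | mul n p v hv x hx ih => rw [pr_ι_mul, counit_of_mem hx (by omega), zero_smul]
  | add n x y _ _ hx hy => simp [hx hn, hy hn]
  | smul n r x _ hx => simp [hx hn]

theorem ι_pr_of_mem {x : GSym V} (hx : x ∈ wt 1 V 1) : ι 1 V (pr V x) = x := by
  rw [wt, pow_one] at hx
  obtain ⟨v, rfl⟩ := hx
  rw [pr_ι]

/-! ### Degrees -/

theorem one_mem_deg : (1 : GSym V) ∈ deg V 0 := Submodule.subset_span .one

theorem ι_mul_mem_deg {p d : ℤ} {v : V} {x : GSym V} (hv : v ∈ V.deg p) (hx : x ∈ deg V d) :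
    ι 1 V v * x ∈ deg V (p + d) := by
  have : deg V d ≤ (deg V (p + d)).comap (LinearMap.mulLeft ℝ (ι 1 V v)) :=
    Submodule.span_le.2 fun y hy => Submodule.subset_span (.mul hv hy)
  exact this hx

theorem ι_mem_deg {p : ℤ} {v : V} (hv : v ∈ V.deg p) : ι 1 V v ∈ deg V p := by
  simpa using ι_mul_mem_deg hv one_mem_deg

theorem deg_induction {C : ∀ d, ∀ x ∈ deg V d, Prop} (one : C 0 1 one_mem_deg)
    (zero : ∀ d, C d 0 (zero_mem _))
    (mul : ∀ p d, ∀ v (hv : v ∈ V.deg p), ∀ x (hx : x ∈ deg V d), C d x hx →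
      C (p + d) (ι 1 V v * x) (ι_mul_mem_deg hv hx))
    (add : ∀ d x y (hx : x ∈ deg V d) (hy : y ∈ deg V d), C d x hx → C d y hy →
      C d (x + y) (add_mem hx hy))
    (smul : ∀ d (r : ℝ) x (hx : x ∈ deg V d), C d x hx →
      C d (r • x) (Submodule.smul_mem _ r hx))
    {d : ℤ} {x : GSym V} (hx : x ∈ deg V d) : C d x hx := by
  have h1 : ∀ d x, IsMonomial V d x → ∃ h : x ∈ deg V d, C d x h := by
    intro d x hx
    induction hx with
    | one => exact ⟨_, one⟩
    | mul hv hx ih => exact ⟨_, mul _ _ _ hv _ ih.1 ih.2⟩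
  induction hx using Submodule.span_induction with
  | mem x hx => exact (h1 _ _ hx).2
  | zero => exact zero _
  | add x y _ _ hx hy => exact add _ _ _ _ _ hx hy
  | smul r x _ hx => exact smul _ _ _ _ hx

theorem mul_mem_deg {p d : ℤ} {x y : GSym V} (hx : x ∈ deg V p) (hy : y ∈ deg V d) :
    x * y ∈ deg V (p + d) := by
  induction hx using deg_induction with
  | one => simpa using hy
  | zero => simp
  | mul p q v hv x hx ih => rw [mul_assoc, add_assoc]; exact ι_mul_mem_deg hv ih
  | add q x y _ _ hx hy => rw [add_mul]; exact add_mem hx hy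
  | smul q r x _ hx => rw [smul_mul_assoc]; exact Submodule.smul_mem _ _ hx

theorem sgn_mem_deg (q : ℤ) {d : ℤ} {x : GSym V} (hx : x ∈ deg V d) : sgn V q x ∈ deg V d := by
  rw [sgn_of_mem V q hx]; exact Submodule.smul_mem _ _ hx

theorem pr_mem_deg {d : ℤ} {x : GSym V} (hx : x ∈ deg V d) : pr V x ∈ V.deg d := by
  -- The second claim is needed in the induction: pr(v ∨ x) = counit(x) v has the degree of v ∨ x
  -- only because the counit vanishes outside degree zero.
  suffices h : pr V x ∈ V.deg d ∧ (d ≠ 0 → counit V x = 0) from h.1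
  induction hx using deg_induction with
  | one => simp [pr_one]
  | zero => simp
  | mul p q v hv x hx ih =>
    rw [pr_ι_mul]
    refine ⟨?_, by simp⟩
    by_cases hq : q = 0
    · subst hq; simpa using Submodule.smul_mem _ _ hv
    · simp [ih.2 hq]
  | add q x y _ _ hx hy =>
    exact ⟨by rw [map_add]; exact add_mem hx.1 hy.1, fun h => by simp [hx.2 h, hy.2 h]⟩
  | smul q r x _ hx =>
    exact ⟨by rw [map_smul]; exact Submodule.smul_mem _ _ hx.1, fun h => by simp [hx.2 h]⟩

theorem counit_of_mem_deg {d : ℤ} {x : GSym V} (hx : x ∈ deg V d) (hd : d ≠ 0) :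
    counit V x = 0 := by
  induction hx using deg_induction with
  | one => exact absurd rfl hd
  | zero => simp
  | mul p q v hv x hx ih => simp
  | add q x y _ _ hx hy => simp [hx hd, hy hd]
  | smul q r x _ hx => simp [hx hd]

theorem wproj_mem_deg (n : ℕ) {d : ℤ} {x : GSym V} (hx : x ∈ deg V d) :
    wproj 1 V n x ∈ deg V d := by
  have h : ∀ d (x : GSym V), IsMonomial V d x → ∃ m, x ∈ wt 1 V m := by
    intro d x hx
    induction hx with
    | one => exact ⟨0, one_mem_wt⟩
    | mul hv hx ih => obtain ⟨m, hm⟩ := ih; exact ⟨_, ι_mul_mem_wt _ hm⟩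
  have : deg V d ≤ (deg V d).comap (wproj 1 V n) := Submodule.span_le.2 fun y hy => by
    obtain ⟨m, hm⟩ := h _ _ hy
    rw [SetLike.mem_coe, Submodule.mem_comap, wproj_of_mem hm]
    split_ifs
    · exact Submodule.subset_span hy
    · exact zero_mem _
  exact this hx

theorem sgn_mem_wt (q : ℤ) {n : ℕ} {x : GSym V} (hx : x ∈ wt 1 V n) : sgn V q x ∈ wt 1 V n := by
  induction hx using wt_induction with
  | one => simpa using one_mem_wt
  | mul n p v hv x hx ih =>
    rw [sgn_ι_mul V q hv]; exact Submodule.smul_mem _ _ (ι_mul_mem_wt _ ih)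
  | add n x y _ _ hx hy => rw [map_add]; exact add_mem hx hy
  | smul n r x _ hx => rw [map_smul]; exact Submodule.smul_mem _ _ hx

theorem map_mem_wt (φ : V →ₗ[ℝ] W) (h : GVect.IsHomog 0 φ) {n : ℕ} {x : GSym V}
    (hx : x ∈ wt 1 V n) : map φ h x ∈ wt 1 W n := by
  induction hx using wt_induction with
  | one => simpa using one_mem_wt
  | mul n p v hv x hx ih => rw [map_mul, map_ι]; exact ι_mul_mem_wt _ ih
  | add n x y _ _ hx hy => rw [map_add]; exact add_mem hx hy
  | smul n r x _ hx => rw [map_smul]; exact Submodule.smul_mem _ _ hx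

/-! ### Tensor products -/

theorem tensor_hom_ext {M : Type w} [AddCommGroup M] [Module ℝ M]
    {f g : GSym V ⊗[ℝ] GSym W →ₗ[ℝ] M}
    (h : ∀ p q, ∀ a ∈ deg V p, ∀ b ∈ deg W q, f (a ⊗ₜ b) = g (a ⊗ₜ b)) : f = g :=
  TensorProduct.ext <| hom_ext_deg fun p a ha => hom_ext_deg fun q b hb => h p q a ha b hb

theorem tensor_hom_ext₃ {M : Type w} [AddCommGroup M] [Module ℝ M]
    {f g : GSym V ⊗[ℝ] (GSym V ⊗[ℝ] GSym V) →ₗ[ℝ] M}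
    (h : ∀ p q r, ∀ a ∈ deg V p, ∀ b ∈ deg V q, ∀ c ∈ deg V r,
      f (a ⊗ₜ (b ⊗ₜ c)) = g (a ⊗ₜ (b ⊗ₜ c))) : f = g :=
  TensorProduct.ext <| hom_ext_deg fun p a ha => tensor_hom_ext fun q r b hb c hc =>
    h p q r a ha b hb c hc

/-- The span of the tensors of degree `d` in `S(V) ⊗ S(V)`. -/
def tdeg (V : GVect.{u}) (d : ℤ) : Submodule ℝ (GSym V ⊗[ℝ] GSym V) :=
  Submodule.span ℝ {t | ∃ p q, p + q = d ∧ ∃ a ∈ deg V p, ∃ b ∈ deg V q, t = a ⊗ₜ b}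

/-- The span of the tensors of weight `n` in `S(V) ⊗ S(V)`. -/
def twt (V : GVect.{u}) (n : ℕ) : Submodule ℝ (GSym V ⊗[ℝ] GSym V) :=
  Submodule.span ℝ {t | ∃ i j, i + j = n ∧ ∃ a ∈ wt 1 V i, ∃ b ∈ wt 1 V j, t = a ⊗ₜ b}

theorem comul_mem_tdeg {d : ℤ} {x : GSym V} (hx : x ∈ deg V d) : comul V x ∈ tdeg V d := by
  induction hx using deg_induction with
  | one => exact Submodule.subset_span ⟨0, 0, rfl, 1, one_mem_deg, 1, one_mem_deg, comul_one V⟩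
  | zero => simp
  | mul p d v hv x hx ih =>
    rw [comul_ι_mul]
    have : tdeg V d ≤ (tdeg V (p + d)).comap (comulOp V v) := Submodule.span_le.2 <| by
      rintro _ ⟨i, j, rfl, a, ha, b, hb, rfl⟩
      rw [SetLike.mem_coe, Submodule.mem_comap, comulOp_tmul V hv]
      exact add_mem (Submodule.subset_span ⟨_, _, by ring, _, ι_mul_mem_deg hv ha, _, hb, rfl⟩)
        (Submodule.subset_span
          ⟨_, _, by ring, _, sgn_mem_deg p ha, _, ι_mul_mem_deg hv hb, rfl⟩)
    exact this ih
  | add d x y _ _ hx hy => rw [map_add]; exact add_mem hx hy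
  | smul d r x _ hx => rw [map_smul]; exact Submodule.smul_mem _ _ hx

theorem comul_mem_twt {n : ℕ} {x : GSym V} (hx : x ∈ wt 1 V n) : comul V x ∈ twt V n := by
  induction hx using wt_induction with
  | one => exact Submodule.subset_span ⟨0, 0, rfl, 1, one_mem_wt, 1, one_mem_wt, comul_one V⟩
  | mul n p v hv x hx ih =>
    rw [comul_ι_mul]
    have : twt V n ≤ (twt V (n + 1)).comap (comulOp V v) := Submodule.span_le.2 <| by
      rintro _ ⟨i, j, rfl, a, ha, b, hb, rfl⟩
      rw [SetLike.mem_coe, Submodule.mem_comap, comulOp_tmul V hv]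
      exact add_mem (Submodule.subset_span ⟨_, _, by ring, _, ι_mul_mem_wt v ha, _, hb, rfl⟩)
        (Submodule.subset_span
          ⟨_, _, by ring, _, sgn_mem_wt p ha, _, ι_mul_mem_wt v hb, rfl⟩)
    exact this ih
  | add n x y _ _ hx hy => rw [map_add]; exact add_mem hx hy
  | smul n r x _ hx => rw [map_smul]; exact Submodule.smul_mem _ _ hx

/-- A linear map on `S(V) ⊗ S(V)` sends `Δ x`, for `x` of degree `d`, into a subspace as soon as
it does so for the tensors of degree `d`. -/
theorem apply_comul_mem {M : Type w} [AddCommGroup M] [Module ℝ M]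
    (f : GSym V ⊗[ℝ] GSym V →ₗ[ℝ] M) (P : Submodule ℝ M) {d : ℤ} {x : GSym V} (hx : x ∈ deg V d)
    (h : ∀ p q, p + q = d → ∀ a ∈ deg V p, ∀ b ∈ deg V q, f (a ⊗ₜ b) ∈ P) :
    f (comul V x) ∈ P := by
  have : tdeg V d ≤ P.comap f := Submodule.span_le.2 <| by
    rintro _ ⟨i, j, hij, a, ha, b, hb, rfl⟩
    exact h i j hij a ha b hb
  exact this (comul_mem_tdeg hx)

theorem apply_comul_mem_of_wt {M : Type w} [AddCommGroup M] [Module ℝ M]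
    (f : GSym V ⊗[ℝ] GSym V →ₗ[ℝ] M) (P : Submodule ℝ M) {n : ℕ} {x : GSym V}
    (hx : x ∈ wt 1 V n)
    (h : ∀ i j, i + j = n → ∀ a ∈ wt 1 V i, ∀ b ∈ wt 1 V j, f (a ⊗ₜ b) ∈ P) :
    f (comul V x) ∈ P := by
  have : twt V n ≤ P.comap f := Submodule.span_le.2 <| by
    rintro _ ⟨i, j, hij, a, ha, b, hb, rfl⟩
    exact h i j hij a ha b hb
  exact this (comul_mem_twt hx)

theorem apply_comul_congr {M : Type w} [AddCommGroup M] [Module ℝ M]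
    (f g : GSym V ⊗[ℝ] GSym V →ₗ[ℝ] M) {n : ℕ} {x : GSym V}
    (hx : x ∈ wt 1 V n)
    (h : ∀ i j, i + j = n → ∀ a ∈ wt 1 V i, ∀ b ∈ wt 1 V j, f (a ⊗ₜ b) = g (a ⊗ₜ b)) :
    f (comul V x) = g (comul V x) := by
  have := apply_comul_mem_of_wt (f - g) ⊥ hx fun i j hij a ha b hb => by
    simp [h i j hij a ha b hb]
  simpa [sub_eq_zero] using this

end GSym

namespace GSym

open FreeSwap

variable {V : GVect.{u}} {W : GVect.{v}}

/-! ### Coalgebra laws -/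

section
variable {A B C D : Type*} [AddCommGroup A] [AddCommGroup B] [AddCommGroup C] [AddCommGroup D]
  [Module ℝ A] [Module ℝ B] [Module ℝ C] [Module ℝ D]

theorem tmap_sub_left (f f' : A →ₗ[ℝ] C) (g : B →ₗ[ℝ] D) (t : A ⊗[ℝ] B) :
    TensorProduct.map (f - f') g t = TensorProduct.map f g t - TensorProduct.map f' g t := by
  induction t using TensorProduct.induction_on with
  | zero => simp
  | tmul a b => simp [TensorProduct.sub_tmul]
  | add a b ha hb => simp only [map_add, ha, hb]; abel

theorem tmap_sub_right (f : A →ₗ[ℝ] C) (g g' : B →ₗ[ℝ] D) (t : A ⊗[ℝ] B) :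
    TensorProduct.map f (g - g') t = TensorProduct.map f g t - TensorProduct.map f g' t := by
  induction t using TensorProduct.induction_on with
  | zero => simp
  | tmul a b => simp [TensorProduct.tmul_sub]
  | add a b ha hb => simp only [map_add, ha, hb]; abel

end

theorem counit_sgn (q : ℤ) (x : GSym V) : counit V (sgn V q x) = counit V x :=
  counit_map _ _ _

theorem comul_sgn (q : ℤ) (x : GSym V) :
    comul V (sgn V q x) =
      TensorProduct.map (sgn V q).toLinearMap (sgn V q).toLinearMap (comul V x) :=
  (LinearMap.congr_fun (comul_map (V.sgn q) (isHomog_sgn V q)) x).symm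

theorem lid_map_counit_comul (x : GSym V) : TensorProduct.lid ℝ (GSym V)
    (TensorProduct.map (counit V).toLinearMap LinearMap.id (comul V x)) = x := by
  refine LinearMap.congr_fun (f := (TensorProduct.lid ℝ (GSym V)).toLinearMap ∘ₗ
    TensorProduct.map (counit V).toLinearMap LinearMap.id ∘ₗ comul V) (g := LinearMap.id)
    (FreeSwap.hom_ext (by simp [comul_one]) fun n v hv x hx => ?_) x
  simp only [LinearMap.comp_apply, LinearMap.id_apply, LinearEquiv.coe_coe, comul_ι_mul] at hx ⊢
  conv_rhs => rw [← hx]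
  generalize comul V x = t
  induction t using TensorProduct.induction_on with
  | zero => simp
  | add a b ha hb => simp only [map_add, ha, hb, mul_add]
  | tmul a b => simp [comulOp_tmul V hv, counit_sgn]

theorem rid_map_counit_comul (x : GSym V) : TensorProduct.rid ℝ (GSym V)
    (TensorProduct.map LinearMap.id (counit V).toLinearMap (comul V x)) = x := by
  refine LinearMap.congr_fun (f := (TensorProduct.rid ℝ (GSym V)).toLinearMap ∘ₗ
    TensorProduct.map LinearMap.id (counit V).toLinearMap ∘ₗ comul V) (g := LinearMap.id)
    (FreeSwap.hom_ext (by simp [comul_one]) fun n v hv x hx => ?_) x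
  simp only [LinearMap.comp_apply, LinearMap.id_apply, LinearEquiv.coe_coe, comul_ι_mul] at hx ⊢
  conv_rhs => rw [← hx]
  generalize comul V x = t
  induction t using TensorProduct.induction_on with
  | zero => simp
  | add a b ha hb => simp only [map_add, ha, hb, mul_add]
  | tmul a b => simp [comulOp_tmul V hv]

theorem comul_coassoc (x : GSym V) :
    TensorProduct.assoc ℝ (GSym V) (GSym V) (GSym V)
      (TensorProduct.map (comul V) LinearMap.id (comul V x)) =
      TensorProduct.map LinearMap.id (comul V) (comul V x) := by
  refine LinearMap.congr_fun (f := (TensorProduct.assoc ℝ _ _ _).toLinearMap ∘ₗ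
    TensorProduct.map (comul V) LinearMap.id ∘ₗ comul V)
    (g := TensorProduct.map LinearMap.id (comul V) ∘ₗ comul V)
    (FreeSwap.hom_ext (by simp [comul_one]) fun n v hv x hx => ?_) x
  -- Left multiplication by v⊗1⊗1 + 1⊗v⊗1 + 1⊗1⊗v. Both iterated coproducts intertwine
  -- multiplication by v with it.
  let op : GSym V ⊗[ℝ] (GSym V ⊗[ℝ] GSym V) →ₗ[ℝ] GSym V ⊗[ℝ] (GSym V ⊗[ℝ] GSym V) :=
    TensorProduct.map (LinearMap.mulLeft ℝ (ι 1 V v)) LinearMap.id +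
      TensorProduct.map (sgn V n).toLinearMap (comulOp V v)
  simp only [LinearMap.comp_apply, LinearEquiv.coe_coe, comul_ι_mul] at hx ⊢
  have h1 : ∀ t, TensorProduct.assoc ℝ (GSym V) (GSym V) (GSym V)
      (TensorProduct.map (comul V) LinearMap.id (comulOp V v t)) =
      op (TensorProduct.assoc ℝ (GSym V) (GSym V) (GSym V)
        (TensorProduct.map (comul V) LinearMap.id t)) := by
    intro t
    induction t using TensorProduct.induction_on with
    | zero => simp
    | add a b ha hb => simp only [map_add, ha, hb]
    | tmul a c =>
      simp only [comulOp_tmul V hv, map_add, TensorProduct.map_tmul, comul_ι_mul, comul_sgn,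
        LinearMap.id_apply]
      generalize comul V a = s
      induction s using TensorProduct.induction_on with
      | zero => simp
      | add a b ha hb => simp only [map_add, TensorProduct.add_tmul, ← ha, ← hb]; abel
      | tmul a b =>
        simp [op, comulOp_tmul V hv, TensorProduct.add_tmul, TensorProduct.tmul_add, add_assoc]
  have h2 : ∀ t, TensorProduct.map LinearMap.id (comul V) (comulOp V v t) =
      op (TensorProduct.map LinearMap.id (comul V) t) := by
    intro t
    induction t using TensorProduct.induction_on with
    | zero => simp
    | add a b ha hb => simp only [map_add, ha, hb]
    | tmul a b => simp [op, comulOp_tmul V hv, comul_ι_mul]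
  rw [h1, h2, hx]

/-! ### Graded cocommutativity. -/

/-- The braiding `a ⊗ b ↦ (-1)^(|a||b|) b ⊗ a`. -/
def braid (V : GVect.{u}) : GSym V ⊗[ℝ] GSym V →ₗ[ℝ] GSym V ⊗[ℝ] GSym V :=
  (TensorProduct.comm ℝ (GSym V) (GSym V)).toLinearMap ∘ₗ ((1 / 2 : ℝ) •
    (LinearMap.id + TensorProduct.map (sgn V 1).toLinearMap LinearMap.id +
      TensorProduct.map LinearMap.id (sgn V 1).toLinearMap -
        TensorProduct.map (sgn V 1).toLinearMap (sgn V 1).toLinearMap))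

/-- The identity 2(-1)^(pq) = 1 + (-1)^p + (-1)^q - (-1)^(p+q) expresses the Koszul sign through the
parity operator alone, so `braid` can be defined without decomposing S(V) by degree. -/
theorem braid_tmul {p q : ℤ} {a b : GSym V} (ha : a ∈ deg V p) (hb : b ∈ deg V q) :
    braid V (a ⊗ₜ b) = (-1 : ℝ) ^ (p * q) • (b ⊗ₜ a) := by
  simp only [braid, LinearMap.comp_apply, LinearMap.smul_apply, LinearMap.sub_apply,
    LinearMap.add_apply, LinearMap.id_apply, TensorProduct.map_tmul, AlgHom.toLinearMap_apply,
    sgn_of_mem V 1 ha, sgn_of_mem V 1 hb, map_smul, map_add, map_sub, LinearEquiv.coe_coe,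
    TensorProduct.comm_tmul, ← TensorProduct.smul_tmul', TensorProduct.tmul_smul, one_mul,
    smul_smul]
  rw [← one_smul ℝ (b ⊗ₜ[ℝ] a), smul_smul, smul_smul, smul_smul, smul_smul, ← add_smul,
    ← add_smul, ← sub_smul, smul_smul]
  congr 1
  simp only [neg_one_zpow_eq_ite, Int.even_mul]
  by_cases hp : Even p <;> by_cases hq : Even q <;> norm_num [hp, hq]

theorem braid_comul (x : GSym V) : braid V (comul V x) = comul V x := by
  refine LinearMap.congr_fun (f := braid V ∘ₗ comul V) (g := comul V)
    (FreeSwap.hom_ext ?_ fun n v hv x hx => ?_) x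
  · simp [comul_one, braid_tmul one_mem_deg one_mem_deg]
  · rw [LinearMap.comp_apply, comul_ι_mul]
    rw [LinearMap.comp_apply] at hx
    conv_rhs => rw [← hx]
    generalize comul V x = t
    refine LinearMap.congr_fun (f := braid V ∘ₗ comulOp V v) (g := comulOp V v ∘ₗ braid V)
      (tensor_hom_ext fun p q a ha b hb => ?_) t
    simp only [LinearMap.comp_apply, comulOp_tmul V hv, braid_tmul ha hb, map_add, map_smul,
      braid_tmul (ι_mul_mem_deg hv ha) hb, sgn_of_mem V n ha, sgn_of_mem V n hb,
      ← TensorProduct.smul_tmul', braid_tmul ha (ι_mul_mem_deg hv hb), smul_add, smul_smul]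
    rw [add_comm]
    congr 2
    · simp only [neg_one_zpow_eq_ite, Int.even_mul, Int.even_add]
      by_cases hp : Even p <;> by_cases hq : Even q <;> by_cases hn : Even n <;> simp [*]
    · rw [← zpow_add₀ (by norm_num)]; congr 1; ring

/-- Exchange of the first two factors of `Δ²(x)`. -/
def braid₁₂ (V : GVect.{u}) :
    GSym V ⊗[ℝ] (GSym V ⊗[ℝ] GSym V) →ₗ[ℝ] GSym V ⊗[ℝ] (GSym V ⊗[ℝ] GSym V) :=
  (TensorProduct.assoc ℝ _ _ _).toLinearMap ∘ₗ TensorProduct.map (braid V) LinearMap.id ∘ₗ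
    (TensorProduct.assoc ℝ _ _ _).symm.toLinearMap

theorem braid₁₂_tmul {p q : ℤ} {a b : GSym V} (ha : a ∈ deg V p) (hb : b ∈ deg V q)
    (c : GSym V) : braid₁₂ V (a ⊗ₜ (b ⊗ₜ c)) = (-1 : ℝ) ^ (p * q) • (b ⊗ₜ (a ⊗ₜ c)) := by
  simp [braid₁₂, braid_tmul ha hb, ← TensorProduct.smul_tmul']

/-- The iterated coproduct. -/
def comul₃ (V : GVect.{u}) : GSym V →ₗ[ℝ] GSym V ⊗[ℝ] (GSym V ⊗[ℝ] GSym V) :=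
  TensorProduct.map LinearMap.id (comul V) ∘ₗ comul V

theorem comul₃_eq (x : GSym V) : comul₃ V x = TensorProduct.assoc ℝ (GSym V) (GSym V) (GSym V)
    (TensorProduct.map (comul V) LinearMap.id (comul V x)) := (comul_coassoc x).symm

/-- Coassociativity turns the first two factors into one coproduct, where cocommutativity applies.
Later arguments use this to move an operator past a factor of the coproduct. -/
theorem braid₁₂_comul₃ (x : GSym V) : braid₁₂ V (comul₃ V x) = comul₃ V x := by
  rw [comul₃_eq, braid₁₂]
  simp only [LinearMap.comp_apply, LinearEquiv.coe_coe, LinearEquiv.symm_apply_apply]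
  congr 1
  generalize comul V x = t
  induction t using TensorProduct.induction_on with
  | zero => simp
  | add a b ha hb => simp only [map_add, ha, hb]
  | tmul a b => simp [braid_comul]

theorem mul_ι {p : ℤ} {v : V} (hv : v ∈ V.deg p) (x : GSym V) :
    x * ι 1 V v = ι 1 V v * sgn V p x := by
  induction x using FreeSwap.induction with
  | one => simp
  | mul n w hw x hx =>
    rw [mul_assoc, hx, ← mul_assoc, ι_mul_ι 1 V hw hv, sgn_ι_mul V p hw, mul_smul_comm,
      ← mul_assoc, smul_mul_assoc, one_mul, mul_comm n p]
  | add x y hx hy => simp only [add_mul, hx, hy, map_add, mul_add]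
  | smul r x hx => simp only [smul_mul_assoc, hx, map_smul, mul_smul_comm]

theorem sgn_sgn (p q : ℤ) (x : GSym V) : sgn V p (sgn V q x) = sgn V (p + q) x := by
  refine LinearMap.congr_fun (f := (sgn V p).toLinearMap ∘ₗ (sgn V q).toLinearMap)
    (g := (sgn V (p + q)).toLinearMap) (hom_ext_deg fun d x hx => ?_) x
  simp only [LinearMap.comp_apply, AlgHom.toLinearMap_apply, sgn_of_mem V _ hx, map_smul,
    smul_smul]
  rw [← zpow_add₀ (by norm_num)]
  congr 2; ring

theorem sgn_zero (x : GSym V) : sgn V 0 x = x := by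
  refine LinearMap.congr_fun (f := (sgn V 0).toLinearMap)
    (g := LinearMap.id) (hom_ext_deg fun d x hx => ?_) x
  simp [sgn_of_mem V _ hx]

/-! ### The Euler operator -/

/-- The convolution `x ↦ ∑ κ(x₁) ∨ F(x₂)`. -/
def conv (κ : GSym V →ₗ[ℝ] W) (F : GSym V →ₗ[ℝ] GSym W) : GSym V →ₗ[ℝ] GSym W :=
  LinearMap.mul' ℝ (GSym W) ∘ₗ TensorProduct.map (ι 1 W ∘ₗ κ) F ∘ₗ comul V

/-- The derivation which multiplies the elements of weight `n` by `n`. -/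
abbrev euler (V : GVect.{u}) : GSym V →ₗ[ℝ] GSym V := coder (pr V)

/-- In Δ(v ∨ x) the element v is either on the left, where `pr` leaves only counit(x₁) v, or on the
right, where moving it in front of pr(x₁) cancels the Koszul sign. -/
theorem euler_ι_mul (v : V) (x : GSym V) :
    euler V (ι 1 V v * x) = ι 1 V v * x + ι 1 V v * euler V x := by
  induction v using DirectSum.Decomposition.inductionOn V.deg with
  | zero => simp
  | add a b ha hb => simp only [map_add, add_mul, ha, hb]; abel
  | @homogeneous n v =>
    obtain ⟨v, hv⟩ := v
    simp only [coder, LinearMap.comp_apply, comul_ι_mul]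
    conv_rhs => enter [1]; rw [← lid_map_counit_comul x]
    generalize comul V x = t
    refine LinearMap.congr_fun (f := LinearMap.mul' ℝ (GSym V) ∘ₗ
      TensorProduct.map (ι 1 V ∘ₗ pr V) LinearMap.id ∘ₗ comulOp V v)
      (g := LinearMap.mulLeft ℝ (ι 1 V v) ∘ₗ ((TensorProduct.lid ℝ (GSym V)).toLinearMap ∘ₗ
        TensorProduct.map (counit V).toLinearMap LinearMap.id + LinearMap.mul' ℝ (GSym V) ∘ₗ
          TensorProduct.map (ι 1 V ∘ₗ pr V) LinearMap.id))
      (tensor_hom_ext fun p q a ha b hb => ?_) t |>.trans ?_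
    · simp only [LinearMap.comp_apply, comulOp_tmul V hv, map_add, TensorProduct.map_tmul,
        LinearMap.mul'_apply, pr_ι_mul, LinearMap.id_apply, map_smul, LinearMap.add_apply,
        LinearEquiv.coe_coe, TensorProduct.lid_tmul, AlgHom.toLinearMap_apply,
        LinearMap.mulLeft_apply, sgn_of_mem V n ha, smul_mul_assoc, mul_add]
      congr 1
      rw [← mul_assoc, ← mul_assoc, ι_mul_ι 1 V hv (pr_mem_deg ha), one_mul, smul_mul_assoc]
    · simp [mul_add]

theorem euler_of_mem {n : ℕ} {x : GSym V} (hx : x ∈ wt 1 V n) : euler V x = (n : ℝ) • x := by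
  induction hx using wt_induction with
  | one => simp [coder, comul_one, pr_one]
  | mul n p v hv x hx ih => rw [euler_ι_mul, ih, mul_smul_comm]; push_cast; module
  | add n x y _ _ hx hy => rw [map_add, hx, hy, smul_add]
  | smul n r x _ hx => rw [map_smul, hx, smul_comm]

theorem wproj_euler (m : ℕ) (x : GSym V) : wproj 1 V m (euler V x) = (m : ℝ) • wproj 1 V m x := by
  refine LinearMap.congr_fun (f := wproj 1 V m ∘ₗ euler V) (g := (m : ℝ) • wproj 1 V m)
    (hom_ext_wt fun n x hx => ?_) x
  rw [LinearMap.comp_apply, euler_of_mem hx, map_smul, LinearMap.smul_apply, wproj_of_mem hx]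
  split_ifs with h
  · rw [h]
  · simp

theorem wproj_zero (x : GSym V) : wproj 1 V 0 x = counit V x • 1 := by
  refine LinearMap.congr_fun (f := wproj 1 V 0) (g := (counit V).toLinearMap.smulRight 1)
    (hom_ext_wt fun n x hx => ?_) x
  rw [wproj_of_mem hx, LinearMap.smulRight_apply, AlgHom.toLinearMap_apply]
  split_ifs with h
  · subst h
    obtain ⟨r, rfl⟩ := mem_wt_zero hx
    simp
  · simp [counit_of_mem hx h]

/-- The kernel of E is the part of weight zero, which the counit detects. Characteristic zero enters
here. -/
theorem eq_zero_of_euler_eq_zero {x : GSym V} (h : euler V x = 0) (h0 : counit V x = 0) :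
    x = 0 := by
  obtain ⟨m, hm⟩ := exists_sum_wproj x
  rw [hm m le_rfl]
  refine Finset.sum_eq_zero fun i _ => ?_
  rcases Nat.eq_zero_or_pos i with rfl | hi
  · rw [wproj_zero, h0, zero_smul]
  · have := wproj_euler i x
    rw [h, map_zero, eq_comm, smul_eq_zero] at this
    exact this.resolve_left (by positivity)

/-- E⊗1 + 1⊗E multiplies the component of weights (i, j) by i + j, so only (0, 0) remains, and the
two counits detect it. -/
theorem tensor_eq_zero_of_euler {z : GSym V ⊗[ℝ] GSym W}
    (h : TensorProduct.map (euler V) LinearMap.id z +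
      TensorProduct.map LinearMap.id (euler W) z = 0)
    (h0 : TensorProduct.map (counit V).toLinearMap (counit W).toLinearMap z = 0) : z = 0 := by
  have hs : ∃ m, ∀ n ≥ m, z = ∑ i ∈ Finset.range n, ∑ j ∈ Finset.range n,
      TensorProduct.map (wproj 1 V i) (wproj 1 W j) z := by
    clear h h0
    induction z using TensorProduct.induction_on with
    | zero => exact ⟨0, by simp⟩
    | tmul a b =>
      obtain ⟨m, hm⟩ := exists_sum_wproj a
      obtain ⟨m', hm'⟩ := exists_sum_wproj b
      refine ⟨max m m', fun n hn => ?_⟩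
      simp only [TensorProduct.map_tmul]
      conv_lhs => rw [hm n (by omega), hm' n (by omega), TensorProduct.sum_tmul]
      simp only [TensorProduct.tmul_sum]
    | add a b ha hb =>
      obtain ⟨m, hm⟩ := ha
      obtain ⟨m', hm'⟩ := hb
      refine ⟨max m m', fun n hn => ?_⟩
      simp only [map_add, Finset.sum_add_distrib]
      rw [← hm n (by omega), ← hm' n (by omega)]
  obtain ⟨m, hm⟩ := hs
  rw [hm m le_rfl]
  refine Finset.sum_eq_zero fun i _ => Finset.sum_eq_zero fun j _ => ?_
  have key : ∀ t : GSym V ⊗[ℝ] GSym W, TensorProduct.map (wproj 1 V i) (wproj 1 W j)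
      (TensorProduct.map (euler V) LinearMap.id t + TensorProduct.map LinearMap.id (euler W) t) =
      ((i : ℝ) + j) • TensorProduct.map (wproj 1 V i) (wproj 1 W j) t := by
    intro t
    induction t using TensorProduct.induction_on with
    | zero => simp
    | tmul a b =>
      simp only [TensorProduct.map_tmul, map_add, wproj_euler, LinearMap.id_apply,
        ← TensorProduct.smul_tmul', TensorProduct.tmul_smul, add_smul]
    | add a b ha hb =>
      simp only [map_add, smul_add] at ha hb ⊢
      rw [← ha, ← hb]; abel
  have h1 := key z
  rw [h, map_zero, eq_comm, smul_eq_zero] at h1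
  by_cases hij : i = 0 ∧ j = 0
  · obtain ⟨rfl, rfl⟩ := hij
    have : ∀ t : GSym V ⊗[ℝ] GSym W, TensorProduct.map (wproj 1 V 0) (wproj 1 W 0) t =
        TensorProduct.map (LinearMap.toSpanSingleton ℝ (GSym V) 1)
          (LinearMap.toSpanSingleton ℝ (GSym W) 1)
          (TensorProduct.map (counit V).toLinearMap (counit W).toLinearMap t) := by
      intro t
      induction t using TensorProduct.induction_on with
      | zero => simp
      | tmul a b => simp [wproj_zero]
      | add a b ha hb => simp only [map_add, ha, hb]
    rw [this, h0, map_zero]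
  · refine h1.resolve_left fun h2 => hij ?_
    have h3 : (0 : ℝ) ≤ i := by positivity
    have h4 : (0 : ℝ) ≤ j := by positivity
    constructor
    · exact_mod_cast (by linarith : (i : ℝ) = 0)
    · exact_mod_cast (by linarith : (j : ℝ) = 0)

/-- A solution `δ` of a linear Euler equation, whose coefficients vanish at `1`, is zero. -/
theorem eq_zero_of_euler {Z : Type w} [AddCommGroup Z] [Module ℝ Z] (N : Z →ₗ[ℝ] Z)
    (B : GSym V ⊗[ℝ] Z →ₗ[ℝ] Z) (hB : ∀ z, B (1 ⊗ₜ z) = 0) (δ : GSym V →ₗ[ℝ] Z)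
    (h : ∀ x, N (δ x) = B (TensorProduct.map LinearMap.id δ (comul V x)))
    (hker : ∀ x, N (δ x) = 0 → δ x = 0) : δ = 0 := by
  refine hom_ext_wt fun n => ?_
  induction n using Nat.strong_induction_on with
  | _ n ih =>
    intro x hx
    refine hker x ?_
    rw [h]
    refine (Submodule.mem_bot ℝ).1 (apply_comul_mem_of_wt (B ∘ₗ TensorProduct.map LinearMap.id δ) ⊥
      hx fun i j hij a ha b hb => ?_)
    rw [Submodule.mem_bot, LinearMap.comp_apply, TensorProduct.map_tmul, LinearMap.id_apply]
    -- A left factor of weight zero contributes nothing because the coefficient at 1 vanishes;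
    -- otherwise the right factor has weight below n.
    rcases Nat.eq_zero_or_pos i with rfl | hi
    · obtain ⟨r, rfl⟩ := mem_wt_zero ha
      rw [← TensorProduct.smul_tmul', map_smul, hB, smul_zero]
    · rw [ih j (by omega) b hb]; simp

/-- E F = κ * F determines the positive weights of F(x) from values of F on lower weights, and the
counit supplies the part of weight zero. -/
theorem eq_of_euler_eq_conv {κ : GSym V →ₗ[ℝ] W} (hκ : κ 1 = 0) {F G : GSym V →ₗ[ℝ] GSym W}
    (hF : ∀ x, euler W (F x) = conv κ F x) (hG : ∀ x, euler W (G x) = conv κ G x)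
    (h : ∀ x, counit W (F x) = counit W (G x)) : F = G := by
  rw [← sub_eq_zero]
  refine eq_zero_of_euler (euler W) (LinearMap.mul' ℝ (GSym W) ∘ₗ
    TensorProduct.map (ι 1 W ∘ₗ κ) LinearMap.id) (by simp [hκ]) _ (fun x => ?_)
    fun x hx => eq_zero_of_euler_eq_zero hx (by simp [h])
  rw [LinearMap.sub_apply, map_sub, hF, hG, conv, conv]
  simp only [LinearMap.comp_apply, TensorProduct.map_map, LinearMap.comp_id, LinearMap.id_comp]
  rw [tmap_sub_right, map_sub]

end GSym

namespace GSym

open FreeSwap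

variable {V : GVect.{u}} {W : GVect.{v}} {X : GVect.{w}}

/-! ### Coalgebra morphisms and coderivations -/

/-- Morphisms of graded counital coaugmented coalgebras. -/
structure IsCoalgHom (F : GSym V →ₗ[ℝ] GSym W) : Prop where
  map_deg : ∀ d, ∀ x ∈ deg V d, F x ∈ deg W d
  map_one : F 1 = 1
  counit : ∀ x, counit W (F x) = counit V x
  comul : ∀ x, comul W (F x) = TensorProduct.map F F (comul V x)

theorem isCoalgHom_map (φ : V →ₗ[ℝ] W) (h : GVect.IsHomog 0 φ) :
    IsCoalgHom (map φ h).toLinearMap where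
  map_deg _ _ hx := map_mem_deg φ h hx
  map_one := by simp
  counit := counit_map φ h
  comul x := (LinearMap.congr_fun (comul_map φ h) x).symm

theorem isCoalgHom_id : IsCoalgHom (LinearMap.id : GSym V →ₗ[ℝ] GSym V) where
  map_deg _ _ hx := hx
  map_one := rfl
  counit _ := rfl
  comul x := by simp

theorem IsCoalgHom.comp {G : GSym W →ₗ[ℝ] GSym X} {F : GSym V →ₗ[ℝ] GSym W}
    (hG : IsCoalgHom G) (hF : IsCoalgHom F) : IsCoalgHom (G ∘ₗ F) where
  map_deg d x hx := hG.map_deg d _ (hF.map_deg d x hx)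
  map_one := by simp [hF.map_one, hG.map_one]
  counit x := by simp [hF.counit, hG.counit]
  comul x := by simp [hF.comul, hG.comul, TensorProduct.map_map]

/-- Linear maps of degree `e` between symmetric algebras commute with the sign operators up to
sign. -/
theorem sgn_apply_of_deg {e : ℤ} {f : GSym V →ₗ[ℝ] GSym W}
    (hf : ∀ d, ∀ x ∈ deg V d, f x ∈ deg W (d + e)) (q : ℤ) (x : GSym V) :
    sgn W q (f x) = (-1 : ℝ) ^ (q * e) • f (sgn V q x) := by
  refine LinearMap.congr_fun (f := (sgn W q).toLinearMap ∘ₗ f)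
    (g := (-1 : ℝ) ^ (q * e) • f ∘ₗ (sgn V q).toLinearMap) (hom_ext_deg fun d x hx => ?_) x
  simp only [LinearMap.comp_apply, AlgHom.toLinearMap_apply, sgn_of_mem V _ hx, map_smul,
    LinearMap.smul_apply, smul_smul, sgn_of_mem W q (hf d x hx)]
  rw [← zpow_add₀ (by norm_num)]
  congr 2; ring

theorem IsCoalgHom.sgn_apply {F : GSym V →ₗ[ℝ] GSym W} (hF : IsCoalgHom F) (q : ℤ) (x : GSym V) :
    sgn W q (F x) = F (sgn V q x) := by
  simpa using sgn_apply_of_deg (e := 0) (f := F) (by simpa using hF.map_deg) q x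

theorem pr_map (φ : V →ₗ[ℝ] W) (h : GVect.IsHomog 0 φ) (x : GSym V) :
    pr W (map φ h x) = φ (pr V x) := by
  induction x using FreeSwap.induction with
  | one => simp [pr_one]
  | mul n v hv x hx => simp [pr_ι_mul, counit_map]
  | add x y hx hy => simp [hx, hy]
  | smul r x hx => simp [hx]

theorem pr_sgn (q : ℤ) (x : GSym V) : pr V (sgn V q x) = V.sgn q (pr V x) := pr_map _ _ x

theorem map_comp_apply (φ : V →ₗ[ℝ] W) (h : GVect.IsHomog 0 φ) (ψ : W →ₗ[ℝ] X)
    (h' : GVect.IsHomog 0 ψ) (h'' : GVect.IsHomog 0 (ψ ∘ₗ φ)) (x : GSym V) :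
    map ψ h' (map φ h x) = map (ψ ∘ₗ φ) h'' x := by
  induction x using FreeSwap.induction with
  | one => simp
  | mul n v hv x hx => simp [hx]
  | add x y hx hy => simp [hx, hy]
  | smul r x hx => simp [hx]

theorem map_eq_self {φ : V →ₗ[ℝ] V} (h : GVect.IsHomog 0 φ) (hφ : ∀ v, φ v = v) (x : GSym V) :
    map φ h x = x := by
  induction x using FreeSwap.induction with
  | one => simp
  | mul n v hv x hx => simp [hx, hφ]
  | add x y hx hy => simp [hx, hy]
  | smul r x hx => simp [hx]

theorem pr_conv (κ : GSym V →ₗ[ℝ] W) {F : GSym V →ₗ[ℝ] GSym W}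
    (hF : ∀ x, counit W (F x) = counit V x) (x : GSym V) : pr W (conv κ F x) = κ x := by
  conv_rhs => rw [← rid_map_counit_comul x]
  simp only [conv, LinearMap.comp_apply]
  generalize comul V x = t
  induction t using TensorProduct.induction_on with
  | zero => simp
  | add a b ha hb => simp only [map_add, ha, hb]
  | tmul a b => simp [pr_ι_mul, hF]

theorem counit_conv (κ : GSym V →ₗ[ℝ] W) (F : GSym V →ₗ[ℝ] GSym W) (x : GSym V) :
    counit W (conv κ F x) = 0 := by
  simp only [conv, LinearMap.comp_apply]
  generalize comul V x = t
  induction t using TensorProduct.induction_on with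
  | zero => simp
  | add a b ha hb => simp only [map_add, ha, hb, add_zero]
  | tmul a b => simp

theorem conv_mem_deg {κ : GSym V →ₗ[ℝ] W} {F : GSym V →ₗ[ℝ] GSym W} {e : ℤ}
    (hκ : ∀ d, ∀ x ∈ deg V d, κ x ∈ W.deg (d + e)) (hF : ∀ d, ∀ x ∈ deg V d, F x ∈ deg W d)
    (d : ℤ) (x : GSym V) (hx : x ∈ deg V d) : conv κ F x ∈ deg W (d + e) := by
  refine apply_comul_mem (LinearMap.mul' ℝ (GSym W) ∘ₗ TensorProduct.map (ι 1 W ∘ₗ κ) F) _ hx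
    fun p q hpq a ha b hb => ?_
  rw [LinearMap.comp_apply, TensorProduct.map_tmul, LinearMap.mul'_apply, ← hpq,
    add_right_comm]
  exact ι_mul_mem_deg (hκ p a ha) (hF q b hb)

theorem conv_one {κ : GSym V →ₗ[ℝ] W} (hκ : κ 1 = 0) (F : GSym V →ₗ[ℝ] GSym W) :
    conv κ F 1 = 0 := by
  simp [conv, comul_one, hκ]

/-- The action `x ⊗ t ↦ Δ(κ(x)) t`. -/
def convOp (κ : GSym V →ₗ[ℝ] W) :
    GSym V ⊗[ℝ] (GSym W ⊗[ℝ] GSym W) →ₗ[ℝ] GSym W ⊗[ℝ] GSym W :=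
  TensorProduct.lift (comulOp W ∘ₗ κ)

theorem comul_conv_apply (κ : GSym V →ₗ[ℝ] W) (F : GSym V →ₗ[ℝ] GSym W) (x : GSym V) :
    comul W (conv κ F x) =
      convOp κ (TensorProduct.map LinearMap.id (comul W ∘ₗ F) (comul V x)) := by
  simp only [conv, LinearMap.comp_apply]
  generalize comul V x = t
  induction t using TensorProduct.induction_on with
  | zero => simp
  | add a b ha hb => simp only [map_add, ha, hb]
  | tmul a b => simp [convOp, comul_ι_mul]

/-- As κ(x₁) is primitive, multiplying F(x₂) ⊗ F(x₃) by its coproduct gives two terms. In the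
second, x₁ has to pass x₂; cocommutativity absorbs the exchange and leaves the sign operator of
degree e. The formula serves both for coderivations and for the coproduct of `expo`. -/
theorem convOp_comul₃ {κ : GSym V →ₗ[ℝ] W} {F : GSym V →ₗ[ℝ] GSym W} {e : ℤ}
    (hκ : ∀ d, ∀ x ∈ deg V d, κ x ∈ W.deg (d + e)) (hF : ∀ d, ∀ x ∈ deg V d, F x ∈ deg W d)
    (x : GSym V) :
    convOp κ (TensorProduct.map LinearMap.id (TensorProduct.map F F) (comul₃ V x)) =
      TensorProduct.map (conv κ F) F (comul V x) +
        TensorProduct.map (F ∘ₗ (sgn V e).toLinearMap) (conv κ F) (comul V x) := by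
  let m : GSym V ⊗[ℝ] GSym V →ₗ[ℝ] GSym W :=
    LinearMap.mul' ℝ (GSym W) ∘ₗ TensorProduct.map (ι 1 W ∘ₗ κ) F
  have h1 : convOp κ ∘ₗ TensorProduct.map LinearMap.id (TensorProduct.map F F) =
      TensorProduct.map m F ∘ₗ (TensorProduct.assoc ℝ _ _ _).symm.toLinearMap +
        TensorProduct.map (F ∘ₗ (sgn V e).toLinearMap) m ∘ₗ braid₁₂ V := by
    refine tensor_hom_ext₃ fun p q r a ha b hb c hc => ?_
    simp only [LinearMap.comp_apply, LinearMap.add_apply, TensorProduct.map_tmul, convOp,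
      TensorProduct.lift.tmul, LinearMap.id_apply, comulOp_tmul W (hκ p a ha), braid₁₂_tmul ha hb,
      LinearEquiv.coe_coe, TensorProduct.assoc_symm_tmul, m, LinearMap.mul'_apply, map_smul,
      sgn_of_mem W _ (hF q b hb), sgn_of_mem V e hb, AlgHom.toLinearMap_apply,
      ← TensorProduct.smul_tmul', smul_smul]
    rw [← zpow_add₀ (by norm_num), ← add_mul]
  have h2 := LinearMap.congr_fun h1 (comul₃ V x)
  simp only [LinearMap.comp_apply, LinearMap.add_apply, braid₁₂_comul₃] at h2
  rw [h2]
  congr 1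
  · rw [comul₃_eq, LinearEquiv.coe_coe, LinearEquiv.symm_apply_apply, TensorProduct.map_map]
    rfl
  · rw [comul₃, LinearMap.comp_apply, TensorProduct.map_map]
    rfl

/-- `δ` is a coderivation of degree `e` along `F`. -/
def IsCoder (e : ℤ) (F δ : GSym V →ₗ[ℝ] GSym W) : Prop :=
  ∀ x, comul W (δ x) = TensorProduct.map δ F (comul V x) +
    TensorProduct.map (F ∘ₗ (sgn V e).toLinearMap) δ (comul V x)

/-- Together with `pr_conv`, the existence half of cofreeness for coderivations along F. -/
theorem IsCoalgHom.isCoder_conv {κ : GSym V →ₗ[ℝ] W} {F : GSym V →ₗ[ℝ] GSym W} {e : ℤ}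
    (hF : IsCoalgHom F) (hκ : ∀ d, ∀ x ∈ deg V d, κ x ∈ W.deg (d + e)) :
    IsCoder e F (conv κ F) := fun x => by
  rw [← convOp_comul₃ hκ hF.map_deg, comul_conv_apply, comul₃, LinearMap.comp_apply,
    TensorProduct.map_map]
  congr 3
  ext x
  simp [hF.comul]

theorem IsCoalgHom.euler_apply {F : GSym V →ₗ[ℝ] GSym W} (hF : IsCoalgHom F) (x : GSym V) :
    euler W (F x) = conv (pr W ∘ₗ F) F x := by
  simp only [coder, conv, LinearMap.comp_apply, hF.comul, TensorProduct.map_map]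
  rfl

/-- A coalgebra morphism is determined by its corestriction. -/
theorem IsCoalgHom.ext {F G : GSym V →ₗ[ℝ] GSym W} (hF : IsCoalgHom F) (hG : IsCoalgHom G)
    (h : ∀ x, pr W (F x) = pr W (G x)) : F = G := by
  have h' : pr W ∘ₗ F = pr W ∘ₗ G := LinearMap.ext h
  refine eq_of_euler_eq_conv (κ := pr W ∘ₗ F) (by simp [hF.map_one, pr_one]) hF.euler_apply
    (fun x => by rw [hG.euler_apply, h']) fun x => by rw [hF.counit, hG.counit]

theorem counit_counit_comul (x : GSym V) : LinearMap.mul' ℝ ℝ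
    (TensorProduct.map (counit V).toLinearMap (counit V).toLinearMap (comul V x)) =
      counit V x := by
  conv_rhs => rw [← lid_map_counit_comul x]
  generalize comul V x = t
  induction t using TensorProduct.induction_on with
  | zero => simp
  | add a b ha hb => simp only [map_add, ha, hb]
  | tmul a b => simp

/-- A coderivation is determined by its corestriction. -/
theorem IsCoder.eq_zero {e : ℤ} {F δ : GSym V →ₗ[ℝ] GSym W} (hδ : IsCoder e F δ)
    (hF : IsCoalgHom F) (h : ∀ x, pr W (δ x) = 0) : δ = 0 := by
  -- Applying both counits to the coderivation identity gives c = c + c for c = counit(δ x).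
  have hc : ∀ x, counit W (δ x) = 0 := by
    intro x
    have h1 := counit_counit_comul (δ x)
    rw [hδ, map_add, map_add, TensorProduct.map_map, TensorProduct.map_map] at h1
    have h2 : LinearMap.mul' ℝ ℝ (TensorProduct.map ((counit W).toLinearMap ∘ₗ δ)
        ((counit W).toLinearMap ∘ₗ F) (comul V x)) = counit W (δ x) := by
      conv_rhs => rw [← rid_map_counit_comul x]
      generalize comul V x = t
      induction t using TensorProduct.induction_on with
      | zero => simp
      | add a b ha hb => simp only [map_add, ha, hb]
      | tmul a b => simp [hF.counit, mul_comm]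
    have h3 : LinearMap.mul' ℝ ℝ (TensorProduct.map
        ((counit W).toLinearMap ∘ₗ (F ∘ₗ (sgn V e).toLinearMap))
        ((counit W).toLinearMap ∘ₗ δ) (comul V x)) = counit W (δ x) := by
      conv_rhs => rw [← lid_map_counit_comul x]
      generalize comul V x = t
      induction t using TensorProduct.induction_on with
      | zero => simp
      | add a b ha hb => simp only [map_add, ha, hb]
      | tmul a b => simp [hF.counit, counit_sgn]
    rw [h2, h3] at h1
    linarith
  -- Since pr δ = 0, only the second half of the coderivation identity survives in E δ; its
  -- coefficient pr F vanishes at 1.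
  refine eq_zero_of_euler (euler W) (LinearMap.mul' ℝ (GSym W) ∘ₗ TensorProduct.map
    (ι 1 W ∘ₗ pr W ∘ₗ F ∘ₗ (sgn V e).toLinearMap) LinearMap.id)
    (by simp [hF.map_one, pr_one]) δ (fun x => ?_)
    fun x hx => eq_zero_of_euler_eq_zero hx (hc x)
  have hE : ∀ y, euler W y = LinearMap.mul' ℝ (GSym W)
    (TensorProduct.map (ι 1 W ∘ₗ pr W) LinearMap.id (GSym.comul W y)) := fun _ => rfl
  rw [hE, hδ, map_add, map_add, TensorProduct.map_map, TensorProduct.map_map,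
    LinearMap.comp_apply, TensorProduct.map_map]
  have : (ι 1 W ∘ₗ pr W) ∘ₗ δ = 0 := by ext x; simp [h]
  rw [this, TensorProduct.map_zero_left]
  simp only [LinearMap.zero_apply, map_zero, zero_add, LinearMap.comp_id, LinearMap.id_comp]
  rfl

theorem IsCoder.sub {e : ℤ} {F δ δ' : GSym V →ₗ[ℝ] GSym W} (h : IsCoder e F δ)
    (h' : IsCoder e F δ') : IsCoder e F (δ - δ') := fun x => by
  rw [LinearMap.sub_apply, map_sub, h, h', tmap_sub_left, tmap_sub_right]
  abel

theorem IsCoder.eq {e : ℤ} {F δ δ' : GSym V →ₗ[ℝ] GSym W} (h : IsCoder e F δ)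
    (h' : IsCoder e F δ') (hF : IsCoalgHom F) (hp : ∀ x, pr W (δ x) = pr W (δ' x)) : δ = δ' :=
  sub_eq_zero.1 <| (h.sub h').eq_zero hF fun x => by simp [hp]

theorem IsCoder.comp_left {e : ℤ} {D : GSym V →ₗ[ℝ] GSym V} {F : GSym V →ₗ[ℝ] GSym W}
    (hF : IsCoalgHom F) (hD : IsCoder e LinearMap.id D) : IsCoder e F (F ∘ₗ D) := fun x => by
  rw [LinearMap.comp_apply, hF.comul, hD, map_add, TensorProduct.map_map, TensorProduct.map_map]
  rfl

theorem IsCoder.comp_right {e : ℤ} {D : GSym W →ₗ[ℝ] GSym W} {F : GSym V →ₗ[ℝ] GSym W}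
    (hF : IsCoalgHom F) (hD : IsCoder e LinearMap.id D) : IsCoder e F (D ∘ₗ F) := fun x => by
  rw [LinearMap.comp_apply, hD, hF.comul, TensorProduct.map_map, TensorProduct.map_map]
  have : (LinearMap.id ∘ₗ (sgn W e).toLinearMap) ∘ₗ F = F ∘ₗ (sgn V e).toLinearMap := by
    ext x; simp [hF.sgn_apply]
  rw [this]
  rfl

theorem isCoder_coder {lam : GSym V →ₗ[ℝ] V}
    (hlam : ∀ d, ∀ x ∈ deg V d, lam x ∈ V.deg (d + 1)) : IsCoder 1 LinearMap.id (coder lam) :=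
  isCoalgHom_id.isCoder_conv hlam

theorem coder_mem_deg {lam : GSym V →ₗ[ℝ] V}
    (hlam : ∀ d, ∀ x ∈ deg V d, lam x ∈ V.deg (d + 1)) (d : ℤ) (x : GSym V) (hx : x ∈ deg V d) : coder lam x ∈ deg V (d + 1) :=
  conv_mem_deg hlam (fun _ _ h => h) d x hx

theorem pr_coder (lam : GSym V →ₗ[ℝ] V) (x : GSym V) : pr V (coder lam x) = lam x :=
  pr_conv lam (fun _ => rfl) x

theorem coder_sgn {lam : GSym V →ₗ[ℝ] V}
    (hlam : ∀ d, ∀ x ∈ deg V d, lam x ∈ V.deg (d + 1)) (q : ℤ) (x : GSym V) :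
    coder lam (sgn V q x) = (-1 : ℝ) ^ q • sgn V q (coder lam x) := by
  rw [sgn_apply_of_deg (coder_mem_deg hlam), mul_one, smul_smul, ← mul_zpow]
  simp

/-- The mixed terms in the coproduct of d² cancel because d is odd, so d² is a coderivation of
degree zero up to parity and its corestriction λd decides. -/
theorem coder_comp_coder_eq_zero {lam : GSym V →ₗ[ℝ] V}
    (hlam : ∀ d, ∀ x ∈ deg V d, lam x ∈ V.deg (d + 1)) (h : ∀ x, lam (coder lam x) = 0) :
    coder lam ∘ₗ coder lam = 0 := by
  refine IsCoder.eq_zero (e := 0) (F := LinearMap.id) (fun x => ?_) isCoalgHom_id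
    fun x => by rw [LinearMap.comp_apply, pr_coder, h]
  have hD := isCoder_coder hlam
  rw [LinearMap.comp_apply, hD, hD, map_add, map_add, TensorProduct.map_map,
    TensorProduct.map_map, TensorProduct.map_map, TensorProduct.map_map]
  have h1 : coder lam ∘ₗ LinearMap.id ∘ₗ (sgn V 1).toLinearMap =
      -((LinearMap.id ∘ₗ (sgn V 1).toLinearMap) ∘ₗ coder lam) := by
    ext x; simp [coder_sgn hlam]
  have h2 : (LinearMap.id ∘ₗ (sgn V 1).toLinearMap) ∘ₗ LinearMap.id ∘ₗ (sgn V 1).toLinearMap =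
      (LinearMap.id : GSym V →ₗ[ℝ] GSym V) ∘ₗ (sgn V 0).toLinearMap := by
    refine hom_ext_deg fun d x hx => ?_
    simp [sgn_of_mem V _ hx, smul_smul, ← mul_zpow]
  rw [h1, h2, ← zero_sub, tmap_sub_left]
  simp

/-- A coalgebra morphism commutes with coderivations if it does so after corestriction. -/
theorem IsCoalgHom.comm_coder {lam : GSym V →ₗ[ℝ] V} {lam' : GSym W →ₗ[ℝ] W}
    (hlam : ∀ d, ∀ x ∈ deg V d, lam x ∈ V.deg (d + 1))
    (hlam' : ∀ d, ∀ x ∈ deg W d, lam' x ∈ W.deg (d + 1))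
    {F : GSym V →ₗ[ℝ] GSym W} (hF : IsCoalgHom F)
    (h : ∀ x, pr W (F (coder lam x)) = lam' (F x)) :
    F ∘ₗ coder lam = coder lam' ∘ₗ F :=
  IsCoder.eq ((isCoder_coder hlam).comp_left hF) ((isCoder_coder hlam').comp_right hF) hF
    fun x => by simp [h, pr_coder]

/-! ### The coalgebra morphism with a given corestriction -/

/-- The convolution power `κ^l / l!`. -/
def expTerm (κ : GSym V →ₗ[ℝ] W) : ℕ → (GSym V →ₗ[ℝ] GSym W)
  | 0 => (counit V).toLinearMap.smulRight 1
  | l + 1 => ((l : ℝ) + 1)⁻¹ • conv κ (expTerm κ l)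

/-- The convolution exponential of `κ`. -/
def expo (κ : GSym V →ₗ[ℝ] W) : GSym V →ₗ[ℝ] GSym W :=
  glue fun n => ∑ l ∈ Finset.range (n + 1), expTerm κ l

/-- Each factor κ uses up weight at least one because κ(1) = 0; hence the exponential series is
finite on every weight. -/
theorem expTerm_of_mem {κ : GSym V →ₗ[ℝ] W} (hκ : κ 1 = 0) {l n : ℕ} (hn : n < l) {x : GSym V}
    (hx : x ∈ wt 1 V n) : expTerm κ l x = 0 := by
  induction l generalizing n x with
  | zero => omega
  | succ l ih =>
    have : conv κ (expTerm κ l) x = 0 := by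
      refine (Submodule.mem_bot ℝ).1 (apply_comul_mem_of_wt (LinearMap.mul' ℝ (GSym W) ∘ₗ
        TensorProduct.map (ι 1 W ∘ₗ κ) (expTerm κ l)) ⊥ hx fun i j hij a ha b hb => ?_)
      rcases Nat.eq_zero_or_pos i with rfl | hi
      · obtain ⟨r, rfl⟩ := mem_wt_zero ha
        simp [hκ]
      · simp [ih (by omega) hb]
    rw [expTerm, LinearMap.smul_apply, this, smul_zero]

theorem euler_conv (κ : GSym V →ₗ[ℝ] W) (F : GSym V →ₗ[ℝ] GSym W) (x : GSym V) :
    euler W (conv κ F x) = conv κ F x + conv κ (euler W ∘ₗ F) x := by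
  simp only [conv, LinearMap.comp_apply (LinearMap.mul' ℝ (GSym W)), LinearMap.comp_apply _ (comul V)]
  generalize comul V x = t
  induction t using TensorProduct.induction_on with
  | zero => simp only [map_zero, add_zero]
  | add a b ha hb => simp only [map_add, ha, hb]; abel
  | tmul a b =>
    simp only [TensorProduct.map_tmul, LinearMap.mul'_apply, LinearMap.comp_apply (ι 1 W),
      euler_ι_mul, LinearMap.comp_apply (euler W)]

theorem conv_smul (κ : GSym V →ₗ[ℝ] W) (r : ℝ) (F : GSym V →ₗ[ℝ] GSym W) :
    conv κ (r • F) = r • conv κ F := by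
  simp only [conv, TensorProduct.map_smul_right, LinearMap.smul_comp, LinearMap.comp_smul]

theorem euler_expTerm (κ : GSym V →ₗ[ℝ] W) (l : ℕ) :
    euler W ∘ₗ expTerm κ l = (l : ℝ) • expTerm κ l := by
  induction l with
  | zero => ext x; simp [expTerm, coder, comul_one, pr_one]
  | succ l ih =>
    ext x
    rw [LinearMap.comp_apply, expTerm, LinearMap.smul_apply, map_smul, euler_conv, ih, conv_smul]
    simp only [LinearMap.smul_apply]
    push_cast
    module

theorem conv_sum (κ : GSym V →ₗ[ℝ] W) (s : Finset ℕ) (F : ℕ → (GSym V →ₗ[ℝ] GSym W)) :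
    conv κ (∑ l ∈ s, F l) = ∑ l ∈ s, conv κ (F l) := by
  have hz : conv κ (0 : GSym V →ₗ[ℝ] GSym W) = 0 := by simp [conv]
  have ha : ∀ F G : GSym V →ₗ[ℝ] GSym W, conv κ (F + G) = conv κ F + conv κ G := fun F G => by
    simp only [conv, TensorProduct.map_add_right, LinearMap.add_comp, LinearMap.comp_add]
  exact map_sum (⟨⟨conv κ, hz⟩, ha⟩ : (GSym V →ₗ[ℝ] GSym W) →+ (GSym V →ₗ[ℝ] GSym W)) F s

theorem expo_of_mem {κ : GSym V →ₗ[ℝ] W} (hκ : κ 1 = 0) {m n : ℕ} (hmn : n ≤ m) {x : GSym V}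
    (hx : x ∈ wt 1 V n) : expo κ x = (∑ l ∈ Finset.range (m + 1), expTerm κ l) x := by
  rw [expo, glue_of_mem _ hx, LinearMap.sum_apply, LinearMap.sum_apply]
  refine Finset.sum_subset (by simpa using hmn) fun l _ hl => ?_
  exact expTerm_of_mem hκ (by simpa using hl) hx

/-- E multiplies κ^(l+1)/(l+1)! by l + 1, which gives κ * (κ^l/l!). The left side is therefore
expanded with a cutoff one larger than the right side. -/
theorem euler_expo {κ : GSym V →ₗ[ℝ] W} (hκ : κ 1 = 0) (x : GSym V) :
    euler W (expo κ x) = conv κ (expo κ) x := by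
  refine LinearMap.congr_fun (f := euler W ∘ₗ expo κ) (hom_ext_wt fun n x hx => ?_) x
  have h1 : conv κ (expo κ) x = conv κ (∑ l ∈ Finset.range (n + 1), expTerm κ l) x := by
    refine apply_comul_congr (LinearMap.mul' ℝ (GSym W) ∘ₗ TensorProduct.map (ι 1 W ∘ₗ κ) _)
      (LinearMap.mul' ℝ (GSym W) ∘ₗ TensorProduct.map (ι 1 W ∘ₗ κ) _) hx
      fun i j hij a ha b hb => ?_
    simp only [LinearMap.comp_apply, TensorProduct.map_tmul]
    rw [expo_of_mem hκ (m := n) (by omega) hb]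
  rw [LinearMap.comp_apply, h1, expo_of_mem hκ (m := n + 1) (by omega) hx,
    Finset.sum_range_succ', LinearMap.add_apply, map_add, conv_sum, LinearMap.sum_apply,
    LinearMap.sum_apply, map_sum]
  have h0 := LinearMap.congr_fun (euler_expTerm κ 0) x
  simp only [LinearMap.comp_apply, Nat.cast_zero, zero_smul, LinearMap.zero_apply] at h0
  rw [h0, add_zero]
  refine Finset.sum_congr rfl fun l _ => ?_
  have h2 := LinearMap.congr_fun (euler_expTerm κ (l + 1)) x
  rw [LinearMap.comp_apply] at h2
  rw [h2, expTerm, smul_smul]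
  push_cast
  rw [mul_inv_cancel₀ (by positivity), one_smul]

theorem expo_one {κ : GSym V →ₗ[ℝ] W} (hκ : κ 1 = 0) : expo κ 1 = 1 := by
  rw [expo_of_mem hκ le_rfl one_mem_wt]
  simp [expTerm]

theorem counit_expo {κ : GSym V →ₗ[ℝ] W} (hκ : κ 1 = 0) (x : GSym V) :
    counit W (expo κ x) = counit V x := by
  refine LinearMap.congr_fun (f := (counit W).toLinearMap ∘ₗ expo κ)
    (g := (counit V).toLinearMap) (hom_ext_wt fun n x hx => ?_) x
  simp only [LinearMap.comp_apply, AlgHom.toLinearMap_apply]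
  rw [expo_of_mem hκ le_rfl hx, Finset.sum_range_succ', LinearMap.add_apply, LinearMap.sum_apply,
    map_add, map_sum, Finset.sum_eq_zero]
  · simp [expTerm]
  · intro l _
    rw [expTerm, LinearMap.smul_apply, map_smul, counit_conv, smul_zero]

theorem pr_expo {κ : GSym V →ₗ[ℝ] W} (hκ : κ 1 = 0) (x : GSym V) : pr W (expo κ x) = κ x := by
  have h : ∀ y : GSym W, pr W (euler W y) = pr W y := pr_coder (pr W)
  rw [← h, euler_expo hκ, pr_conv κ (counit_expo hκ)]

theorem IsMonomial.exists_mem_wt {d : ℤ} {x : GSym V} (hx : IsMonomial V d x) :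
    ∃ m, x ∈ wt 1 V m := by
  induction hx with
  | one => exact ⟨0, one_mem_wt⟩
  | mul hv hx ih => obtain ⟨m, hm⟩ := ih; exact ⟨_, ι_mul_mem_wt _ hm⟩

theorem expo_mem_deg {κ : GSym V →ₗ[ℝ] W} (hκ : κ 1 = 0)
    (hdeg : ∀ d, ∀ x ∈ deg V d, κ x ∈ W.deg d) (d : ℤ) : ∀ x ∈ deg V d, expo κ x ∈ deg W d := by
  have h1 : ∀ l d, ∀ x ∈ deg V d, expTerm κ l x ∈ deg W d := by
    intro l
    induction l with
    | zero =>
      intro d x hx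
      by_cases hd : d = 0
      · subst hd; simpa [expTerm] using Submodule.smul_mem _ _ one_mem_deg
      · simp [expTerm, counit_of_mem_deg hx hd]
    | succ l ih =>
      intro d x hx
      rw [expTerm, LinearMap.smul_apply]
      have := conv_mem_deg (e := 0) (by simpa using hdeg) ih d x hx
      rw [add_zero] at this
      exact Submodule.smul_mem _ _ this
  have : deg V d ≤ (deg W d).comap (expo κ) := Submodule.span_le.2 fun x hx => by
    obtain ⟨m, hm⟩ := hx.exists_mem_wt
    rw [SetLike.mem_coe, Submodule.mem_comap, expo_of_mem hκ le_rfl hm, LinearMap.sum_apply]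
    exact Submodule.sum_mem _ fun l _ => h1 l d x (Submodule.subset_span hx)
  exact this

theorem isCoalgHom_expo {κ : GSym V →ₗ[ℝ] W} (hκ : κ 1 = 0)
    (hdeg : ∀ d, ∀ x ∈ deg V d, κ x ∈ W.deg d) : IsCoalgHom (expo κ) where
  map_deg := expo_mem_deg hκ hdeg
  map_one := expo_one hκ
  counit := counit_expo hκ
  comul x := by
    have hdeg' : ∀ d, ∀ x ∈ deg V d, κ x ∈ W.deg (d + 0) := by simpa using hdeg
    have hE := expo_mem_deg hκ hdeg
    have hN : ∀ y : GSym W, TensorProduct.map (euler W) LinearMap.id (GSym.comul W y) +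
        TensorProduct.map LinearMap.id (euler W) (GSym.comul W y) =
          GSym.comul W (euler W y) := fun y => by
      have h := isCoalgHom_id.isCoder_conv (κ := pr W) (e := 0)
        (fun d x hx => by simpa using pr_mem_deg hx) y
      have h0 : (LinearMap.id : GSym W →ₗ[ℝ] GSym W) ∘ₗ (sgn W 0).toLinearMap =
        LinearMap.id := by ext x; simp [sgn_zero]
      rw [h0] at h
      exact h.symm
    have h0 : expo κ ∘ₗ (sgn V 0).toLinearMap = expo κ := by ext x; simp [sgn_zero]
    have he : euler W ∘ₗ expo κ = conv κ (expo κ) := LinearMap.ext (euler_expo hκ)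
    -- Both composites solve the Euler equation for the total weight on S(W) ⊗ S(W) with
    -- coefficients `convOp κ`, so uniqueness applies to their difference.
    have key : GSym.comul W ∘ₗ expo κ - TensorProduct.map (expo κ) (expo κ) ∘ₗ GSym.comul V = 0 := by
      refine eq_zero_of_euler (TensorProduct.map (euler W) LinearMap.id +
        TensorProduct.map LinearMap.id (euler W)) (convOp κ) (by simp [convOp, hκ]) _
        (fun x => ?_) fun x hx => tensor_eq_zero_of_euler hx ?_
      · have h1 := convOp_comul₃ hdeg' hE x
        rw [LinearMap.sub_apply, map_sub, LinearMap.comp_apply, LinearMap.add_apply, hN,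
          LinearMap.comp_apply, LinearMap.add_apply, TensorProduct.map_map, TensorProduct.map_map,
          euler_expo hκ, LinearMap.id_comp, he, comul_conv_apply]
        rw [h0, comul₃, LinearMap.comp_apply, TensorProduct.map_map] at h1
        rw [← h1, tmap_sub_right, map_sub]
        rfl
      · have hc : (counit W).toLinearMap ∘ₗ expo κ = (counit V).toLinearMap :=
          LinearMap.ext (counit_expo hκ)
        rw [LinearMap.sub_apply, map_sub, LinearMap.comp_apply, LinearMap.comp_apply,
          TensorProduct.map_map, hc, sub_eq_zero]
        apply (TensorProduct.lid ℝ ℝ).injective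
        have h1 : ∀ t : ℝ ⊗[ℝ] ℝ, TensorProduct.lid ℝ ℝ t = LinearMap.mul' ℝ ℝ t := fun t => by
          induction t using TensorProduct.induction_on with
          | zero => simp
          | add a b ha hb => simp only [map_add, ha, hb]
          | tmul a b => simp
        rw [h1, h1, counit_counit_comul, counit_counit_comul, counit_expo hκ]
    exact sub_eq_zero.1 (LinearMap.congr_fun key x)

end GSym

/-! ### Components and products of graded vector spaces -/

namespace GVect

/-- The projection onto the component of degree `m`. -/
def compo (V : GVect.{u}) (m : ℤ) : V →ₗ[ℝ] V :=
  V.piecewise fun k => if k = m then LinearMap.id else 0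

theorem compo_of_mem (V : GVect.{u}) (m : ℤ) {k : ℤ} {x : V} (hx : x ∈ V.deg k) :
    V.compo m x = if k = m then x else 0 := by
  rw [compo, V.piecewise_of_mem _ hx]; split_ifs <;> rfl

theorem compo_mem (V : GVect.{u}) (m : ℤ) (x : V) : V.compo m x ∈ V.deg m := by
  induction x using DirectSum.Decomposition.inductionOn V.deg with
  | zero => simp
  | @homogeneous k y =>
    rw [V.compo_of_mem m y.2]
    split_ifs with h
    · subst h; exact y.2
    · exact zero_mem _
  | add a b ha hb => rw [map_add]; exact add_mem ha hb

theorem IsHomog.compo_apply {V : GVect.{u}} {W : GVect.{v}} {p : ℤ} {f : V →ₗ[ℝ] W}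
    (hf : IsHomog p f) (m : ℤ) (x : V) : W.compo (m + p) (f x) = f (V.compo m x) := by
  refine LinearMap.congr_fun (f := W.compo (m + p) ∘ₗ f) (g := f ∘ₗ V.compo m)
    (V.hom_ext fun k x hx => ?_) x
  rw [LinearMap.comp_apply, LinearMap.comp_apply, V.compo_of_mem m hx, W.compo_of_mem _ (hf k x hx)]
  by_cases h : k = m <;> simp [h]

/-- f(x) equals its own component of degree n, which is f of the component of x. Used to read
degrees in 𝔫 off from 𝔤̂. -/
theorem IsHomog.mem_of_apply_mem {V : GVect.{u}} {W : GVect.{v}} {f : V →ₗ[ℝ] W}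
    (hf : IsHomog 0 f) (hinj : Function.Injective f) {n : ℤ} {x : V} (hx : f x ∈ W.deg n) :
    x ∈ V.deg n := by
  have h := hf.compo_apply n x
  rw [add_zero, W.compo_of_mem n hx, if_pos rfl] at h
  rw [hinj h]
  exact V.compo_mem n x

/-- The direct sum of two graded vector spaces. -/
def prod (A : GVect.{u}) (B : GVect.{v}) : GVect.{max u v} where
  carrier := A × B
  deg n := (A.deg n).prod (B.deg n)
  dec := DirectSum.IsInternal.chooseDecomposition _ <| by
    rw [DirectSum.isInternal_submodule_iff_iSupIndep_and_iSup_eq_top]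
    have hA := (DirectSum.isInternal_submodule_iff_iSupIndep_and_iSup_eq_top A.deg).1
      (DirectSum.Decomposition.isInternal A.deg)
    have hB := (DirectSum.isInternal_submodule_iff_iSupIndep_and_iSup_eq_top B.deg).1
      (DirectSum.Decomposition.isInternal B.deg)
    refine ⟨fun n => ?_, ?_⟩
    · rw [Submodule.disjoint_def]
      rintro ⟨a, b⟩ ⟨ha, hb⟩ h
      have hle : (⨆ m, ⨆ (_ : m ≠ n), (A.deg m).prod (B.deg m)) ≤
          (⨆ m, ⨆ (_ : m ≠ n), A.deg m).prod (⨆ m, ⨆ (_ : m ≠ n), B.deg m) :=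
        iSup₂_le fun m hm => Submodule.prod_mono (le_iSup₂_of_le m hm le_rfl)
          (le_iSup₂_of_le m hm le_rfl)
      obtain ⟨h1, h2⟩ := hle h
      exact Prod.ext (Submodule.disjoint_def.1 (hA.1 n) a ha h1)
        (Submodule.disjoint_def.1 (hB.1 n) b hb h2)
    · rw [eq_top_iff]
      rintro ⟨a, b⟩ -
      have h1 : (⊤ : Submodule ℝ A) ≤ (⨆ m, (A.deg m).prod (B.deg m)).comap
          (LinearMap.inl ℝ A B) := by
        rw [← hA.2]
        exact iSup_le fun m x hx => Submodule.mem_iSup_of_mem m ⟨hx, zero_mem _⟩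
      have h2 : (⊤ : Submodule ℝ B) ≤ (⨆ m, (A.deg m).prod (B.deg m)).comap
          (LinearMap.inr ℝ A B) := by
        rw [← hB.2]
        exact iSup_le fun m x hx => Submodule.mem_iSup_of_mem m ⟨zero_mem _, hx⟩
      have h3 : (a, b) = LinearMap.inl ℝ A B a + LinearMap.inr ℝ A B b := by simp
      rw [h3]
      exact add_mem (h1 Submodule.mem_top) (h2 Submodule.mem_top)

section prod

variable (A : GVect.{u}) (B : GVect.{v}) (m : ℤ)

/-- The first projection of `(A ⊕ B)[m]`. -/
def fst : (A.prod B).shift m →ₗ[ℝ] A.shift m := LinearMap.fst ℝ A B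

/-- The second projection of `(A ⊕ B)[m]`. -/
def snd : (A.prod B).shift m →ₗ[ℝ] B.shift m := LinearMap.snd ℝ A B

variable {A B m}

/-- The map to `(A ⊕ B)[m]` with given components. -/
def pair {M : Type w} [AddCommGroup M] [Module ℝ M] (f : M →ₗ[ℝ] A.shift m)
    (g : M →ₗ[ℝ] B.shift m) : M →ₗ[ℝ] (A.prod B).shift m :=
  LinearMap.prod (M₂ := A) (M₃ := B) f g

@[simp] theorem fst_pair {M : Type w} [AddCommGroup M] [Module ℝ M] (f : M →ₗ[ℝ] A.shift m)
    (g : M →ₗ[ℝ] B.shift m) (x : M) : fst A B m (pair f g x) = f x := rfl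

@[simp] theorem snd_pair {M : Type w} [AddCommGroup M] [Module ℝ M] (f : M →ₗ[ℝ] A.shift m)
    (g : M →ₗ[ℝ] B.shift m) (x : M) : snd A B m (pair f g x) = g x := rfl

theorem prod_ext {x y : (A.prod B).shift m} (h1 : fst A B m x = fst A B m y)
    (h2 : snd A B m x = snd A B m y) : x = y := Prod.ext h1 h2

theorem mem_deg_prod {n : ℤ} {x : (A.prod B).shift m} :
    x ∈ ((A.prod B).shift m).deg n ↔
      fst A B m x ∈ (A.shift m).deg n ∧ snd A B m x ∈ (B.shift m).deg n := Iff.rfl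

theorem isHomog_fst : IsHomog 0 (fst A B m) := fun n x hx => by
  simpa using (mem_deg_prod.1 hx).1

theorem isHomog_pair {V : GVect.{w}} {f : V →ₗ[ℝ] A.shift m} {g : V →ₗ[ℝ] B.shift m}
    (hf : IsHomog 0 f) (hg : IsHomog 0 g) : IsHomog 0 (pair f g) := fun n x hx =>
  mem_deg_prod.2 ⟨hf n x hx, hg n x hx⟩

theorem isHomog_id (V : GVect.{u}) : IsHomog 0 (LinearMap.id : V →ₗ[ℝ] V) := fun n x hx => by
  simpa using hx

theorem isHomog_zero (V : GVect.{u}) (W : GVect.{v}) : IsHomog 0 (0 : V →ₗ[ℝ] W) :=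
  fun n x _ => by simp

end prod

end GVect

/-! ### Coalgebra morphisms that commute with multiplication by a generator. -/

namespace GSym

open FreeSwap

theorem map_zero_apply {V : GVect.{u}} {W : GVect.{v}} {φ : V →ₗ[ℝ] W} (h : GVect.IsHomog 0 φ)
    (hφ : ∀ v, φ v = 0) (x : GSym V) : map φ h x = counit V x • 1 := by
  induction x using FreeSwap.induction with
  | one => simp
  | mul n v hv x hx => simp [hφ]
  | add x y hx hy => simp [hx, hy, add_smul]
  | smul r x hx => simp [hx, smul_smul]

/-- As functions of y, both sides are coderivations of degree m along F, so comparing corestrictions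
suffices. -/
theorem IsCoalgHom.apply_ι_mul {V : GVect.{u}} {W : GVect.{v}} {F : GSym V →ₗ[ℝ] GSym W}
    (hF : IsCoalgHom F) {m : ℤ} {v : V} {w : W} (hv : v ∈ V.deg m) (hw : w ∈ W.deg m)
    (h : ∀ y, pr W (F (ι 1 V v * y)) = GSym.counit V y • w) (y : GSym V) :
    F (ι 1 V v * y) = ι 1 W w * F y := by
  refine LinearMap.congr_fun (f := F ∘ₗ LinearMap.mulLeft ℝ (ι 1 V v))
    (g := LinearMap.mulLeft ℝ (ι 1 W w) ∘ₗ F) (IsCoder.eq (e := m) (F := F)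
      (fun x => ?_) (fun x => ?_) hF fun y => ?_) y
  · rw [LinearMap.comp_apply, LinearMap.mulLeft_apply, hF.comul, comul_ι_mul]
    generalize GSym.comul V x = t
    induction t using TensorProduct.induction_on with
    | zero => simp
    | add a b ha hb => simp only [map_add, ha, hb]; abel
    | tmul a b => simp [comulOp_tmul V hv]
  · rw [LinearMap.comp_apply, LinearMap.mulLeft_apply, comul_ι_mul, hF.comul]
    generalize GSym.comul V x = t
    induction t using TensorProduct.induction_on with
    | zero => simp
    | add a b ha hb => simp only [map_add, ha, hb]; abel
    | tmul a b => simp [comulOp_tmul W hw, hF.sgn_apply]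
  · simp [h, pr_ι_mul, hF.counit]

theorem IsCoalgHom.apply_mul_ι {V : GVect.{u}} {W : GVect.{v}} {F : GSym V →ₗ[ℝ] GSym W}
    (hF : IsCoalgHom F) {m : ℤ} {v : V} {w : W} (hv : v ∈ V.deg m) (hw : w ∈ W.deg m)
    (h : ∀ y, pr W (F (ι 1 V v * y)) = GSym.counit V y • w) (y : GSym V) :
    F (y * ι 1 V v) = F y * ι 1 W w := by
  rw [mul_ι hv, hF.apply_ι_mul hv hw h, mul_ι hw, hF.sgn_apply]

end GSym

/-! ### Constructing `L∞`-algebras and morphisms -/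

namespace LInfty

variable (L : LInfty.{u})

theorem pr_d (x : GSym L.sh) : GSym.pr L.sh (L.d x) = L.lam x := GSym.pr_coder L.lam x

theorem d_d (x : GSym L.sh) : L.d (L.d x) = 0 := LinearMap.congr_fun L.sq_zero x

theorem lam_d (x : GSym L.sh) : L.lam (L.d x) = 0 := by rw [← L.pr_d, L.d_d, map_zero]

theorem d_mem_deg (k : ℤ) (x : GSym L.sh) (hx : x ∈ GSym.deg L.sh k) :
    L.d x ∈ GSym.deg L.sh (k + 1) := GSym.coder_mem_deg L.lam_deg k x hx

theorem d_one : L.d 1 = 0 := GSym.conv_one L.lam_one _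

theorem counit_d (x : GSym L.sh) : GSym.counit L.sh (L.d x) = 0 := GSym.counit_conv _ _ x

theorem comul_d (x : GSym L.sh) : GSym.comul L.sh (L.d x) =
    TensorProduct.map L.d LinearMap.id (GSym.comul L.sh x) +
      TensorProduct.map (GSym.sgn L.sh 1).toLinearMap L.d (GSym.comul L.sh x) :=
  GSym.isCoder_coder L.lam_deg x

end LInfty

theorem LInftyHom.isCoalgHom {g h : LInfty.{u}} (F : LInftyHom g h) : GSym.IsCoalgHom F.toLin where
  map_deg := F.map_deg
  map_one := F.map_one
  counit := F.counit
  comul x := (LinearMap.congr_fun F.comul x).symm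

theorem LInftyHom.apply_d {g h : LInfty.{u}} (F : LInftyHom g h) (x : GSym g.sh) :
    F.toLin (g.d x) = h.d (F.toLin x) := LinearMap.congr_fun F.comm x

/-- The `L∞`-morphism defined by a coalgebra morphism. -/
def GSym.IsCoalgHom.toHom {g h : LInfty.{u}} {F : GSym g.sh →ₗ[ℝ] GSym h.sh}
    (hF : GSym.IsCoalgHom F) (hc : ∀ x, GSym.pr h.sh (F (g.d x)) = h.lam (F x)) :
    LInftyHom g h where
  toLin := F
  map_deg := hF.map_deg
  map_one := hF.map_one
  counit := hF.counit
  comul := LinearMap.ext fun x => (hF.comul x).symm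
  comm := hF.comm_coder g.lam_deg h.lam_deg hc

/-- The composition of `L∞`-morphisms. -/
def LInftyHom.comp {g h k : LInfty.{u}} (G : LInftyHom h k) (F : LInftyHom g h) :
    LInftyHom g k :=
  (G.isCoalgHom.comp F.isCoalgHom).toHom fun x => by
    rw [LinearMap.comp_apply, LinearMap.comp_apply, F.apply_d, G.apply_d, k.pr_d]

namespace LInfty

variable (h : LInfty.{u}) (K : GVect.{u})

/-- The map `S(𝔥[1] ⊕ K[1]) → 𝔥[1] ⊕ K[1]` with components `λ ∘ S(pr)` and `ν`. -/
def twistLam (ν : GSym ((h.g.prod K).shift 1) →ₗ[ℝ] K.shift 1) :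
    GSym ((h.g.prod K).shift 1) →ₗ[ℝ] (h.g.prod K).shift 1 :=
  GVect.pair (h.lam ∘ₗ (GSym.map (GVect.fst h.g K 1) GVect.isHomog_fst).toLinearMap) ν

variable {h K} {ν : GSym ((h.g.prod K).shift 1) →ₗ[ℝ] K.shift 1}

theorem twistLam_mem_deg
    (hdeg : ∀ d, ∀ x ∈ GSym.deg ((h.g.prod K).shift 1) d, ν x ∈ (K.shift 1).deg (d + 1))
    (d : ℤ) (x) (hx : x ∈ GSym.deg ((h.g.prod K).shift 1) d) :
    h.twistLam K ν x ∈ ((h.g.prod K).shift 1).deg (d + 1) :=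
  GVect.mem_deg_prod.2 ⟨h.lam_deg d _ (GSym.map_mem_deg _ _ hx), hdeg d x hx⟩

/-- The first component of the bracket factors through S(pr), so the projection is a morphism for
every ν. The condition d² = 0 on 𝔥 ⊕ K thus only concerns ν. -/
theorem map_fst_coder
    (hdeg : ∀ d, ∀ x ∈ GSym.deg ((h.g.prod K).shift 1) d, ν x ∈ (K.shift 1).deg (d + 1)) (x) :
    GSym.map (GVect.fst h.g K 1) GVect.isHomog_fst (GSym.coder (h.twistLam K ν) x) =
      h.d (GSym.map (GVect.fst h.g K 1) GVect.isHomog_fst x) :=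
  LinearMap.congr_fun ((GSym.isCoalgHom_map (GVect.fst h.g K 1) GVect.isHomog_fst).comm_coder
    (twistLam_mem_deg hdeg) h.lam_deg fun x => by
      rw [AlgHom.toLinearMap_apply, GSym.pr_map, GSym.pr_coder]; rfl) x

/-- The `L∞`-algebra `𝔥 ⊕ K` whose bracket has components `λ ∘ S(pr)` and `ν`. -/
abbrev twist (h : LInfty.{u}) (K : GVect.{u}) (hK : ∀ n > 0, K.deg n = ⊥)
    (ν : GSym ((h.g.prod K).shift 1) →ₗ[ℝ] K.shift 1)
    (hdeg : ∀ d, ∀ x ∈ GSym.deg ((h.g.prod K).shift 1) d, ν x ∈ (K.shift 1).deg (d + 1))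
    (hone : ν 1 = 0) (hsq : ∀ x, ν (GSym.coder (h.twistLam K ν) x) = 0) : LInfty.{u} where
  g := h.g.prod K
  nonpos n hn := by
    change (h.g.deg n).prod (K.deg n) = ⊥
    rw [h.nonpos n hn, hK n hn, Submodule.prod_bot]
  lam := h.twistLam K ν
  lam_deg := twistLam_mem_deg hdeg
  lam_one := GVect.prod_ext (by simp [twistLam, h.lam_one]) (by simp [twistLam, hone])
  sq_zero := GSym.coder_comp_coder_eq_zero (twistLam_mem_deg hdeg) fun x =>
    GVect.prod_ext
      (by
        simp only [twistLam, GVect.fst_pair, LinearMap.comp_apply, AlgHom.toLinearMap_apply,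
          map_zero]
        exact (congrArg h.lam (map_fst_coder hdeg x)).trans (h.lam_d _))
      (by simp only [twistLam, GVect.snd_pair, map_zero]; exact hsq x)

end LInfty

namespace Extension

variable {n g h : LInfty.{u}} (E : Extension n g)

/-! ### Lifts of morphisms -/

theorem π_ι (v : n.sh) : E.π.lin (E.ι.lin v) = 0 := E.exact.apply_apply_eq_zero v

theorem mem_deg_of_ι {m : ℤ} {v : n.sh} (hv : E.ι.lin v ∈ E.mid.sh.deg m) : v ∈ n.sh.deg m :=
  E.ι.homog.mem_of_apply_mem E.inj hv

theorem ι_mem_deg {m : ℤ} {v : n.sh} (hv : v ∈ n.sh.deg m) : E.ι.lin v ∈ E.mid.sh.deg m := by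
  simpa using E.ι.homog m v hv

/-- The retraction `𝔤̂[1] → 𝔫[1]` defined by a section. -/
def Splitting.ret {E : Extension n g} (s : E.Splitting) : E.mid.sh →ₗ[ℝ] n.sh :=
  E.kerEquiv.toLinearMap ∘ₗ (LinearMap.id - s.lin ∘ₗ E.π.lin).codRestrict _ fun x => by
    simp [s.sec]

theorem Splitting.ι_ret {E : Extension n g} (s : E.Splitting) (x : E.mid.sh) :
    E.ι.lin (s.ret x) = x - s.lin (E.π.lin x) := by
  simp [ret, E.ι_kerEquiv]

/-- A coalgebra morphism `S(𝔥[1]) → S(𝔤̂[1])` which covers the `L∞`-morphism `T`. -/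
structure IsLift (T : LInftyHom h g) (F : GSym h.sh →ₗ[ℝ] GSym E.mid.sh) : Prop where
  isCoalgHom : GSym.IsCoalgHom F
  symMap_π : ∀ x, E.π.symMap (F x) = T.toLin x

/-! ### Extending a lift over a direct sum 𝔥 ⊕ K, for the pullback extension and for the cylinder.
-/

section extendLift

variable {E} {K : GVect.{u}}

/-- The corestriction of the extension of `F` to `S(𝔥[1] ⊕ K[1])` by a map `c : K[1] → 𝔫[1]`. -/
def extendCorestr (E : Extension n g) (F : GSym h.sh →ₗ[ℝ] GSym E.mid.sh)
    (c : K.shift 1 →ₗ[ℝ] n.sh) : GSym ((h.g.prod K).shift 1) →ₗ[ℝ] E.mid.sh :=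
  GSym.pr E.mid.sh ∘ₗ F ∘ₗ (GSym.map (GVect.fst h.g K 1) GVect.isHomog_fst).toLinearMap +
    E.ι.lin ∘ₗ c ∘ₗ GVect.snd h.g K 1 ∘ₗ GSym.pr _

/-- The extension of `F` to `S(𝔥[1] ⊕ K[1])` by a map `c : K[1] → 𝔫[1]`. -/
def extendLift (E : Extension n g) (F : GSym h.sh →ₗ[ℝ] GSym E.mid.sh)
    (c : K.shift 1 →ₗ[ℝ] n.sh) : GSym ((h.g.prod K).shift 1) →ₗ[ℝ] GSym E.mid.sh :=
  GSym.expo (extendCorestr E F c)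

variable {T : LInftyHom h g} {F : GSym h.sh →ₗ[ℝ] GSym E.mid.sh} (hF : E.IsLift T F)
  {c : K.shift 1 →ₗ[ℝ] n.sh} (hc : GVect.IsHomog 0 c)

theorem extendCorestr_one (hF : E.IsLift T F) (c : K.shift 1 →ₗ[ℝ] n.sh) :
    extendCorestr E F c 1 = 0 := by
  simp [extendCorestr, GSym.pr_one, hF.isCoalgHom.map_one]

theorem isCoalgHom_extendLift (hF : E.IsLift T F) (hc : GVect.IsHomog 0 c) :
    GSym.IsCoalgHom (extendLift E F c) :=
  GSym.isCoalgHom_expo (extendCorestr_one hF c) fun d x hx => by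
    refine add_mem (GSym.pr_mem_deg (hF.isCoalgHom.map_deg _ _ (GSym.map_mem_deg _ _ hx)))
      (E.ι_mem_deg ?_)
    have := hc d _ ((GVect.mem_deg_prod.1 (GSym.pr_mem_deg hx)).2)
    rwa [add_zero] at this

theorem pr_extendLift (hF : E.IsLift T F) (x : GSym ((h.g.prod K).shift 1)) :
    GSym.pr E.mid.sh (extendLift E F c x) =
      GSym.pr E.mid.sh (F (GSym.map (GVect.fst h.g K 1) GVect.isHomog_fst x)) +
        E.ι.lin (c (GVect.snd h.g K 1 (GSym.pr _ x))) :=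
  GSym.pr_expo (extendCorestr_one hF c) x

theorem symMap_extendLift (hF : E.IsLift T F) (hc : GVect.IsHomog 0 c)
    (x : GSym ((h.g.prod K).shift 1)) :
    E.π.symMap (extendLift E F c x) =
      T.toLin (GSym.map (GVect.fst h.g K 1) GVect.isHomog_fst x) := by
  refine LinearMap.congr_fun (GSym.IsCoalgHom.ext
    ((GSym.isCoalgHom_map E.π.lin E.π.homog).comp (isCoalgHom_extendLift hF hc))
    (T.isCoalgHom.comp (GSym.isCoalgHom_map (GVect.fst h.g K 1) GVect.isHomog_fst))
    fun x => ?_) x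
  simp only [LinearMap.comp_apply, AlgHom.toLinearMap_apply]
  rw [GSym.pr_map, pr_extendLift hF, map_add, E.π_ι, add_zero, ← GSym.pr_map E.π.lin E.π.homog,
    ← hF.symMap_π]
  rfl

end extendLift

theorem Splitting.isLift {E : Extension n g} (s : E.Splitting) (T : LInftyHom h g) :
    E.IsLift T ((GSym.map s.lin s.homog).toLinearMap ∘ₗ T.toLin) where
  isCoalgHom := (GSym.isCoalgHom_map s.lin s.homog).comp T.isCoalgHom
  symMap_π x := by
    have h1 : GVect.IsHomog 0 (E.π.lin ∘ₗ s.lin) := fun m x hx => by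
      simpa [s.sec] using hx
    rw [LinearMap.comp_apply, AlgHom.toLinearMap_apply, StrictHom.symMap,
      GSym.map_comp_apply _ _ _ _ h1, GSym.map_eq_self _ (by simp [s.sec])]

/-! ### The pullback extension -/

section pullback

variable {E} (s : E.Splitting) (T : LInftyHom h g)

/-- The coalgebra morphism `(S(s) ∘ T ∘ S(pr)) ∨ S(ι ∘ pr)`. -/
def Splitting.pullHom : GSym ((h.g.prod n.g).shift 1) →ₗ[ℝ] GSym E.mid.sh :=
  extendLift E (K := n.g) ((GSym.map s.lin s.homog).toLinearMap ∘ₗ T.toLin) LinearMap.id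

theorem Splitting.isCoalgHom_pullHom : GSym.IsCoalgHom (s.pullHom T) :=
  isCoalgHom_extendLift (s.isLift T) (GVect.isHomog_id _)

theorem Splitting.symMap_pullHom (x) : E.π.symMap (s.pullHom T x) =
    T.toLin (GSym.map (GVect.fst h.g n.g 1) GVect.isHomog_fst x) :=
  symMap_extendLift (s.isLift T) (GVect.isHomog_id _) x

theorem Splitting.pr_pullHom (x) : GSym.pr E.mid.sh (s.pullHom T x) =
    s.lin (GSym.pr g.sh (T.toLin (GSym.map (GVect.fst h.g n.g 1) GVect.isHomog_fst x))) +
      E.ι.lin (GVect.snd h.g n.g 1 (GSym.pr _ x)) := by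
  rw [pullHom, pr_extendLift (s.isLift T), LinearMap.comp_apply, AlgHom.toLinearMap_apply,
    GSym.pr_map]
  rfl

/-- The `𝔫[1]`-component of the bracket of the pullback extension. -/
def Splitting.pullNu : GSym ((h.g.prod n.g).shift 1) →ₗ[ℝ] n.sh :=
  s.ret ∘ₗ E.mid.lam ∘ₗ s.pullHom T

theorem Splitting.ι_pullNu (x) : E.ι.lin (s.pullNu T x) = E.mid.lam (s.pullHom T x) -
    s.lin (g.lam (T.toLin (GSym.map (GVect.fst h.g n.g 1) GVect.isHomog_fst x))) := by
  rw [pullNu, LinearMap.comp_apply, LinearMap.comp_apply, s.ι_ret, ← s.symMap_pullHom,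
    ← E.π.comm]
  rfl

theorem Splitting.pullNu_mem_deg (d : ℤ) (x) (hx : x ∈ GSym.deg ((h.g.prod n.g).shift 1) d) :
    s.pullNu T x ∈ n.sh.deg (d + 1) := by
  refine E.mem_deg_of_ι ?_
  rw [s.ι_pullNu]
  refine sub_mem (E.mid.lam_deg d _ ((s.isCoalgHom_pullHom T).map_deg d x hx)) ?_
  simpa using s.homog _ _ (g.lam_deg d _ (T.map_deg d _ (GSym.map_mem_deg _ _ hx)))

theorem Splitting.pullNu_one : s.pullNu T 1 = 0 := by
  refine E.inj ?_
  rw [s.ι_pullNu, (s.isCoalgHom_pullHom T).map_one, map_one (GSym.map _ _), T.map_one,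
    g.lam_one, E.mid.lam_one]
  simp

/-- The reason for the choice of `pullNu`. On corestrictions, the s-components match because T
commutes with the codifferentials, and `pullNu` is exactly what λ̂T• has beyond its s-component. -/
theorem Splitting.pullHom_coder (x) :
    s.pullHom T (GSym.coder (h.twistLam n.g (s.pullNu T)) x) = E.mid.d (s.pullHom T x) := by
  refine LinearMap.congr_fun ((s.isCoalgHom_pullHom T).comm_coder
    (LInfty.twistLam_mem_deg (s.pullNu_mem_deg T)) E.mid.lam_deg fun x => ?_) x
  have h1 := LInfty.map_fst_coder (s.pullNu_mem_deg T) x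
  rw [s.pr_pullHom, h1, T.apply_d, g.pr_d, GSym.pr_coder, LInfty.twistLam, GVect.snd_pair,
    s.ι_pullNu]
  abel

/-- The `L∞`-algebra `𝔥 ×_𝔤 𝔤̂`. -/
def Splitting.pullMid : LInfty.{u} :=
  h.twist n.g n.nonpos (s.pullNu T) (s.pullNu_mem_deg T) (s.pullNu_one T) fun x => by
    -- T• converts the remaining condition into λ̂d̂ = 0, so no identity between individual brackets
    -- has to be expanded.
    change s.ret (E.mid.lam (s.pullHom T _)) = 0
    rw [s.pullHom_coder, E.mid.lam_d, map_zero]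

theorem Splitting.isHomog_inr :
    GVect.IsHomog 0 (GVect.pair (A := h.g) (B := n.g) (m := 1) (0 : n.sh →ₗ[ℝ] h.sh)
      LinearMap.id) :=
  GVect.isHomog_pair (GVect.isHomog_zero _ _) (GVect.isHomog_id _)

theorem Splitting.map_fst_inr (x : GSym n.sh) :
    GSym.map (GVect.fst h.g n.g 1) GVect.isHomog_fst (GSym.map _ isHomog_inr x) =
      GSym.counit n.sh x • 1 := by
  have h1 : GVect.IsHomog 0 (GVect.fst h.g n.g 1 ∘ₗ GVect.pair (A := h.g) (B := n.g) (m := 1)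
    (0 : n.sh →ₗ[ℝ] h.sh) LinearMap.id) := GVect.isHomog_zero _ _
  rw [GSym.map_comp_apply _ _ _ _ h1, GSym.map_zero_apply h1 fun _ => rfl]

theorem Splitting.pullHom_inr (x : GSym n.sh) :
    s.pullHom T (GSym.map _ isHomog_inr x) = E.ι.symMap x := by
  refine LinearMap.congr_fun (GSym.IsCoalgHom.ext ((s.isCoalgHom_pullHom T).comp
    (GSym.isCoalgHom_map _ isHomog_inr)) (GSym.isCoalgHom_map E.ι.lin E.ι.homog) fun x => ?_) x
  rw [LinearMap.comp_apply, AlgHom.toLinearMap_apply, s.pr_pullHom, map_fst_inr, map_smul,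
    T.map_one, map_smul, GSym.pr_one, AlgHom.toLinearMap_apply, GSym.pr_map, GSym.pr_map]
  simp

/-- S(pr) kills every product with an element of 𝔫, so only the weight one part of v ∨ y remains.
Via `apply_mul_ι` this gives the normalisation of T•. -/
theorem Splitting.pr_pullHom_inr_mul (v : n.sh) (y : GSym ((h.g.prod n.g).shift 1)) :
    GSym.pr E.mid.sh (s.pullHom T (FreeSwap.ι 1 ((h.g.prod n.g).shift 1)
      (GVect.pair (0 : n.sh →ₗ[ℝ] h.sh) LinearMap.id v) * y)) =
      GSym.counit _ y • E.ι.lin v := by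
  rw [s.pr_pullHom, map_mul, GSym.map_ι, GSym.pr_ι_mul, GVect.fst_pair, map_smul,
    GVect.snd_pair]
  simp

/-- The extension `0 → 𝔫 → 𝔥 ×_𝔤 𝔤̂ → 𝔥 → 0`. -/
def Splitting.pullExt : Extension n h where
  mid := s.pullMid T
  ι :=
    { lin := GVect.pair (0 : n.sh →ₗ[ℝ] h.sh) LinearMap.id
      homog := isHomog_inr
      comm := fun x => by
        refine GVect.prod_ext ?_ (E.inj ?_)
        · change h.lam (GSym.map (GVect.fst h.g n.g 1) GVect.isHomog_fst
            (GSym.map _ isHomog_inr x)) = 0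
          rw [map_fst_inr, map_smul, h.lam_one, smul_zero]
        · change E.ι.lin (s.pullNu T (GSym.map _ isHomog_inr x)) = E.ι.lin (n.lam x)
          rw [s.ι_pullNu, map_fst_inr, map_smul, T.map_one, map_smul, g.lam_one, s.pullHom_inr,
            smul_zero, map_zero, sub_zero, ← E.ι.comm]
          rfl }
  π :=
    { lin := GVect.fst h.g n.g 1
      homog := GVect.isHomog_fst
      comm := fun _ => rfl }
  inj _ _ hxy := congrArg (GVect.snd h.g n.g 1) hxy
  exact x := ⟨fun hx => ⟨GVect.snd h.g n.g 1 x, GVect.prod_ext hx.symm rfl⟩, by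
    rintro ⟨y, rfl⟩; rfl⟩
  surj x := ⟨GVect.pair LinearMap.id 0 x, rfl⟩

/-- The pullback extension defined by a section. -/
def Splitting.pullbackExtension : PullbackExtension E T where
  ext := s.pullExt T
  hom := (s.isCoalgHom_pullHom T).toHom (g := s.pullMid T) fun x => by
    have := s.pullHom_coder T x
    exact (congrArg _ this).trans (E.mid.pr_d _)
  comm_π := LinearMap.ext fun x => s.symMap_pullHom T x
  comm_ι := LinearMap.ext fun x => s.pullHom_inr T x
  hom_mul_ι y v := by
    induction v using DirectSum.Decomposition.inductionOn n.sh.deg with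
    | zero => simp
    | add a b ha hb => simp only [map_add, mul_add, ha, hb]
    | @homogeneous m v =>
      have hv := (s.pullExt T).ι_mem_deg v.2
      refine (s.isCoalgHom_pullHom T).apply_mul_ι hv (E.ι_mem_deg v.2) (fun y => ?_) y
      exact s.pr_pullHom_inr_mul T v y

end pullback

end Extension

/-! ### Contractions of graded complexes -/

namespace GVect

/-- An acyclic graded complex of vector spaces is contractible. -/
theorem exists_contraction (C : GVect.{u}) {δ : C →ₗ[ℝ] C} (hδ : IsHomog 1 δ)
    (hsq : ∀ x, δ (δ x) = 0) (hex : ∀ x, δ x = 0 → ∃ y, δ y = x) :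
    ∃ c : C →ₗ[ℝ] C, IsHomog (-1) c ∧ ∀ x, δ (c x) + c (δ x) = x := by
  obtain ⟨r', hr'⟩ := δ.rangeRestrict.exists_rightInverse_of_surjective δ.range_rangeRestrict
  obtain ⟨r₀, hr₀⟩ := LinearMap.exists_extend r'
  have h0 : ∀ x, δ (r₀ (δ x)) = δ x := fun x => by
    have h1 := LinearMap.congr_fun hr₀ (δ.rangeRestrict x)
    have h2 := LinearMap.congr_fun hr' (δ.rangeRestrict x)
    have h3 : r₀ (δ x) = r' (δ.rangeRestrict x) := h1
    rw [h3]
    exact congrArg Subtype.val h2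
  -- The degree -1 part of r₀ still satisfies δrδ = δ, because δ is homogeneous.
  let r : C →ₗ[ℝ] C := C.piecewise fun m => C.compo (m - 1) ∘ₗ r₀
  have hr : IsHomog (-1) r := fun m x hx => by
    rw [C.piecewise_of_mem _ hx]
    exact C.compo_mem _ _
  have h1 : ∀ x, δ (r (δ x)) = δ x := fun x => by
    refine LinearMap.congr_fun (f := δ ∘ₗ r ∘ₗ δ) (C.hom_ext fun m x hx => ?_) x
    simp only [LinearMap.comp_apply, r]
    rw [C.piecewise_of_mem _ (hδ m x hx), LinearMap.comp_apply, add_sub_cancel_right,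
      ← hδ.compo_apply, h0, C.compo_of_mem _ (hδ m x hx), if_pos rfl]
  -- With this c one has δc + cδ = δr(x - rδx) + rδx. By exactness x - rδx is in the image of δ,
  -- where δr is the identity.
  refine ⟨r - r ∘ₗ r ∘ₗ δ, fun m x hx => sub_mem (hr m x hx) ?_, fun x => ?_⟩
  · have := hr _ _ (hr _ _ (hδ m x hx))
    rwa [show m + 1 + -1 + -1 = m + -1 by ring] at this
  · obtain ⟨y, hy⟩ := hex (x - r (δ x)) (by rw [map_sub, h1, sub_self])
    have h2 : δ (r (x - r (δ x))) = x - r (δ x) := by rw [← hy, h1]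
    simp only [LinearMap.sub_apply, LinearMap.comp_apply, hsq, map_zero, sub_zero]
    rw [← map_sub r, h2]
    abel

/-- A quasi-isomorphism of graded complexes of vector spaces is a homotopy equivalence. -/
theorem exists_homotopyInverse {A B : GVect.{u}} {δA : A →ₗ[ℝ] A} {δB : B →ₗ[ℝ] B}
    {f : A →ₗ[ℝ] B} (hA : IsHomog 1 δA) (hB : IsHomog 1 δB) (hf : IsHomog 0 f)
    (hA2 : ∀ x, δA (δA x) = 0) (hB2 : ∀ x, δB (δB x) = 0) (hfδ : ∀ x, f (δA x) = δB (f x))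
    (hsurj : ∀ y, δB y = 0 → ∃ x z, δA x = 0 ∧ y = f x + δB z)
    (hinj : ∀ x, δA x = 0 → ∀ z, f x = δB z → ∃ y, x = δA y) :
    ∃ (j : B →ₗ[ℝ] A) (a : A →ₗ[ℝ] A) (b : B →ₗ[ℝ] B), IsHomog 0 j ∧ IsHomog (-1) a ∧
      IsHomog (-1) b ∧ (∀ y, j (δB y) = δA (j y)) ∧
      (∀ x, j (f x) = x + (δA (a x) + a (δA x))) ∧
      (∀ y, f (j y) = y + (δB (b y) + b (δB y))) := by
  let C : GVect.{u} := B.prod (A.shift 1)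
  -- The differential of the mapping cone B ⊕ A[1], which is acyclic because f is a
  -- quasi-isomorphism. The entries of a contraction are the homotopy inverse B → A and, on the
  -- diagonal, the two homotopies, the one on B with a minus sign.
  let δ : B × A →ₗ[ℝ] B × A :=
    (δB ∘ₗ LinearMap.fst ℝ B A + f ∘ₗ LinearMap.snd ℝ B A).prod (-(δA ∘ₗ LinearMap.snd ℝ B A))
  have hδ : ∀ x, δ x = (δB x.1 + f x.2, -δA x.2) := fun x => rfl
  have hsq : ∀ x, δ (δ x) = 0 := fun x => by simp [hδ, hA2, hB2, hfδ]
  have hex : ∀ x, δ x = 0 → ∃ y, δ y = x := by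
    rintro ⟨y, x⟩ hx
    rw [hδ] at hx
    obtain ⟨h1, h2⟩ := Prod.mk.inj hx
    simp only [neg_eq_zero] at h1 h2
    obtain ⟨w, rfl⟩ := hinj x h2 (-y) (by
      rw [map_neg]; exact (neg_eq_of_add_eq_zero_right h1).symm)
    obtain ⟨x', z, h3, h4⟩ := hsurj (y + f w) (by rw [map_add, ← hfδ, h1])
    refine ⟨(z, x' - w), ?_⟩
    rw [hδ]
    simp only [map_sub, h3, Prod.mk.injEq, zero_sub, neg_neg, and_true]
    rw [← add_sub_assoc, add_comm (δB z), ← h4, add_sub_cancel_right]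
  have hδ1 : ∀ m, ∀ x : B × A, x.1 ∈ B.deg m → x.2 ∈ A.deg (m + 1) →
      δ x ∈ (B.deg (m + 1)).prod (A.deg (m + 1 + 1)) := fun m x h1 h2 =>
    ⟨add_mem (hB _ _ h1) (by have := hf _ _ h2; rwa [add_zero] at this), neg_mem (hA _ _ h2)⟩
  obtain ⟨c', hc, hc'⟩ : ∃ c : B × A →ₗ[ℝ] B × A,
      (∀ m, ∀ x : B × A, x.1 ∈ B.deg m → x.2 ∈ A.deg (m + 1) →
        (c x).1 ∈ B.deg (m + -1) ∧ (c x).2 ∈ A.deg (m + -1 + 1)) ∧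
      ∀ x, δ (c x) + c (δ x) = x := by
    obtain ⟨c, hc, hcδ⟩ := exists_contraction C (δ := δ) (fun m x hx => hδ1 m x hx.1 hx.2) hsq hex
    exact ⟨c, fun m x h1 h2 => hc m x ⟨h1, h2⟩, hcδ⟩
  refine ⟨LinearMap.snd ℝ B A ∘ₗ c' ∘ₗ LinearMap.inl ℝ B A,
    LinearMap.snd ℝ B A ∘ₗ c' ∘ₗ LinearMap.inr ℝ B A,
    -(LinearMap.fst ℝ B A ∘ₗ c' ∘ₗ LinearMap.inl ℝ B A), fun m y hy => ?_, fun m x hx => ?_,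
    fun m y hy => ?_, fun y => ?_, fun x => ?_, fun y => ?_⟩
  · have := (hc m (y, 0) hy (zero_mem _)).2
    rwa [neg_add_cancel_right, ← add_zero m] at this
  · have := (hc (m - 1) (0, x) (zero_mem _) (by rwa [sub_add_cancel])).2
    rwa [neg_add_cancel_right, sub_eq_add_neg] at this
  · exact neg_mem (hc m (y, 0) hy (zero_mem _)).1
  · have h1 := congrArg Prod.snd (hc' (y, 0))
    simp only [hδ, map_zero, add_zero, Prod.snd_add, neg_zero] at h1
    exact (neg_add_eq_zero.1 h1).symm
  · have h1 := congrArg Prod.snd (hc' (0, x))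
    have h2 : δ (0, x) = (f x, 0) - (0, δA x) := by rw [hδ]; simp
    rw [h2, map_sub] at h1
    simp only [hδ, Prod.snd_add, Prod.snd_sub] at h1
    simp only [LinearMap.comp_apply, LinearMap.inl_apply, LinearMap.inr_apply,
      LinearMap.snd_apply]
    rw [neg_add_eq_iff_eq_add, sub_eq_iff_eq_add] at h1
    rw [h1]
    abel
  · have h1 := congrArg Prod.fst (hc' (y, 0))
    simp only [hδ, map_zero, add_zero, Prod.fst_add, neg_zero] at h1
    simp only [LinearMap.comp_apply, LinearMap.inl_apply, LinearMap.neg_apply,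
      LinearMap.fst_apply, LinearMap.snd_apply, map_neg]
    rw [← neg_add, ← sub_eq_add_neg, eq_sub_iff_add_eq]
    conv_rhs => rw [← h1]
    abel

theorem sgn_apply_of_isHomog {V : GVect.{u}} {W : GVect.{v}} {e : ℤ} {f : V →ₗ[ℝ] W}
    (hf : IsHomog e f) (q : ℤ) (x : V) :
    W.sgn q (f x) = (-1 : ℝ) ^ (q * e) • f (V.sgn q x) := by
  refine LinearMap.congr_fun (f := W.sgn q ∘ₗ f) (g := (-1 : ℝ) ^ (q * e) • f ∘ₗ V.sgn q)
    (V.hom_ext fun d x hx => ?_) x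
  simp only [LinearMap.comp_apply, V.sgn_of_mem _ hx, map_smul,
    LinearMap.smul_apply, smul_smul, W.sgn_of_mem q (hf d x hx)]
  rw [← zpow_add₀ (by norm_num)]
  congr 2; ring

theorem sgn_one_sgn_one (V : GVect.{u}) (x : V) : V.sgn 1 (V.sgn 1 x) = x := by
  refine LinearMap.congr_fun (f := V.sgn 1 ∘ₗ V.sgn 1) (g := LinearMap.id)
    (V.hom_ext fun d x hx => ?_) x
  simp [V.sgn_of_mem _ hx, smul_smul, ← mul_zpow]

end GVect

/-! ### Homotopies on symmetric algebras -/

namespace GSym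

open FreeSwap

variable {V : GVect.{u}}

/-- The derivation of `S(V)` extending a linear map `δ` of degree one. -/
abbrev linCoder (δ : V →ₗ[ℝ] V) : GSym V →ₗ[ℝ] GSym V := coder (δ ∘ₗ pr V)

theorem linCoder_ι_mul {δ : V →ₗ[ℝ] V} (hδ : GVect.IsHomog 1 δ) (v : V) (x : GSym V) :
    linCoder δ (ι 1 V v * x) = ι 1 V (δ v) * x + ι 1 V (V.sgn 1 v) * linCoder δ x := by
  induction v using DirectSum.Decomposition.inductionOn V.deg with
  | zero => simp
  | add a b ha hb => simp only [map_add, add_mul, ha, hb]; abel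
  | @homogeneous n v =>
    obtain ⟨v, hv⟩ := v
    simp only [coder, LinearMap.comp_apply, comul_ι_mul]
    conv_rhs => enter [1]; rw [← lid_map_counit_comul x]
    generalize comul V x = t
    refine LinearMap.congr_fun (f := LinearMap.mul' ℝ (GSym V) ∘ₗ
      TensorProduct.map (ι 1 V ∘ₗ δ ∘ₗ pr V) LinearMap.id ∘ₗ comulOp V v)
      (g := LinearMap.mulLeft ℝ (ι 1 V (δ v)) ∘ₗ (TensorProduct.lid ℝ (GSym V)).toLinearMap ∘ₗ
        TensorProduct.map (counit V).toLinearMap LinearMap.id +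
        LinearMap.mulLeft ℝ (ι 1 V (V.sgn 1 v)) ∘ₗ LinearMap.mul' ℝ (GSym V) ∘ₗ
          TensorProduct.map (ι 1 V ∘ₗ δ ∘ₗ pr V) LinearMap.id)
      (tensor_hom_ext fun p q a ha b hb => ?_) t
    simp only [LinearMap.comp_apply, comulOp_tmul V hv, map_add, TensorProduct.map_tmul,
      LinearMap.mul'_apply, pr_ι_mul, LinearMap.id_apply, map_smul, LinearMap.add_apply,
      LinearEquiv.coe_coe, TensorProduct.lid_tmul, AlgHom.toLinearMap_apply,
      LinearMap.mulLeft_apply, sgn_of_mem V n ha, smul_mul_assoc, V.sgn_of_mem 1 hv]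
    congr 1
    rw [← mul_assoc (ι 1 V v), ι_mul_ι 1 V hv (hδ p _ (pr_mem_deg ha)), smul_mul_assoc,
      smul_smul, mul_assoc]
    congr 1
    simp only [neg_one_zpow_eq_ite, Int.even_mul, Int.even_add]
    by_cases hp : Even p <;> by_cases hn : Even n <;> simp [*]

theorem pr_linCoder (δ : V →ₗ[ℝ] V) (x : GSym V) : pr V (linCoder δ x) = δ (pr V x) :=
  pr_coder _ x

theorem linCoder_mem_wt (δ : V →ₗ[ℝ] V) {n : ℕ} {x : GSym V} (hx : x ∈ wt 1 V n) :
    linCoder δ x ∈ wt 1 V n := by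
  refine apply_comul_mem_of_wt (LinearMap.mul' ℝ (GSym V) ∘ₗ
    TensorProduct.map (ι 1 V ∘ₗ δ ∘ₗ pr V) LinearMap.id) _ hx fun i j hij a ha b hb => ?_
  simp only [LinearMap.comp_apply, TensorProduct.map_tmul, LinearMap.mul'_apply,
    LinearMap.id_apply]
  by_cases hi : i = 1
  · subst hi
    rw [← hij, add_comm]
    exact ι_mul_mem_wt _ hb
  · simp [pr_of_mem ha hi]

theorem linCoder_deg {δ : V →ₗ[ℝ] V} (hδ : GVect.IsHomog 1 δ) (d : ℤ) (x : GSym V)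
    (hx : x ∈ deg V d) : (δ ∘ₗ pr V) x ∈ V.deg (d + 1) := hδ _ _ (pr_mem_deg hx)

theorem map_linCoder {W : GVect.{u}} {δ : V →ₗ[ℝ] V} {δ' : W →ₗ[ℝ] W} (hδ : GVect.IsHomog 1 δ)
    (hδ' : GVect.IsHomog 1 δ') {φ : V →ₗ[ℝ] W} (hφ : GVect.IsHomog 0 φ)
    (h : ∀ v, φ (δ v) = δ' (φ v)) (x : GSym V) :
    map φ hφ (linCoder δ x) = linCoder δ' (map φ hφ x) :=
  LinearMap.congr_fun ((isCoalgHom_map φ hφ).comm_coder (linCoder_deg hδ) (linCoder_deg hδ')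
    fun x => by simp [pr_map, pr_coder, h]) x

/-- The homotopy on elements of weight `n` induced by a homotopy `η` from the identity to `φ`. -/
def symHtpy (φ : V →ₗ[ℝ] V) (hφ : GVect.IsHomog 0 φ) (η : V →ₗ[ℝ] V) :
    ℕ → (GSym V →ₗ[ℝ] GSym V)
  | 0 => 0
  | n + 1 => ((n : ℝ) + 1)⁻¹ • LinearMap.mul' ℝ (GSym V) ∘ₗ
      (TensorProduct.map (ι 1 V ∘ₗ η ∘ₗ pr V) (map φ hφ).toLinearMap +
        TensorProduct.map (ι 1 V ∘ₗ pr V ∘ₗ (sgn V 1).toLinearMap) (symHtpy φ hφ η n)) ∘ₗ comul V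

section symHtpy

variable {φ : V →ₗ[ℝ] V} (hφ : GVect.IsHomog 0 φ) {η : V →ₗ[ℝ] V}

theorem symHtpy_mem_deg (hη : GVect.IsHomog (-1) η) (n : ℕ) (d : ℤ) (x : GSym V)
    (hx : x ∈ deg V d) : symHtpy φ hφ η n x ∈ deg V (d - 1) := by
  induction n generalizing d x with
  | zero => exact zero_mem _
  | succ n ih =>
    refine Submodule.smul_mem _ _ (apply_comul_mem (LinearMap.mul' ℝ (GSym V) ∘ₗ
      (TensorProduct.map (ι 1 V ∘ₗ η ∘ₗ pr V) (map φ hφ).toLinearMap +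
        TensorProduct.map (ι 1 V ∘ₗ pr V ∘ₗ (sgn V 1).toLinearMap) (symHtpy φ hφ η n))) _ hx
      fun p q hpq a ha b hb => ?_)
    simp only [LinearMap.comp_apply, LinearMap.add_apply, TensorProduct.map_tmul, map_add,
      LinearMap.mul'_apply]
    refine add_mem ?_ ?_
    · rw [← hpq, show p + q - 1 = p + -1 + q by ring]
      exact ι_mul_mem_deg (hη _ _ (pr_mem_deg ha)) (map_mem_deg φ hφ hb)
    · rw [← hpq, show p + q - 1 = p + (q - 1) by ring]
      exact ι_mul_mem_deg (pr_mem_deg (sgn_mem_deg 1 ha)) (ih q b hb)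

theorem symHtpy_mem_wt (n : ℕ) {m : ℕ} {x : GSym V} (hx : x ∈ wt 1 V m) :
    symHtpy φ hφ η n x ∈ wt 1 V m := by
  induction n generalizing m x with
  | zero => exact zero_mem _
  | succ n ih =>
    refine Submodule.smul_mem _ _ (apply_comul_mem_of_wt (LinearMap.mul' ℝ (GSym V) ∘ₗ
      (TensorProduct.map (ι 1 V ∘ₗ η ∘ₗ pr V) (map φ hφ).toLinearMap +
        TensorProduct.map (ι 1 V ∘ₗ pr V ∘ₗ (sgn V 1).toLinearMap) (symHtpy φ hφ η n))) _ hx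
      fun i j hij a ha b hb => ?_)
    simp only [LinearMap.comp_apply, LinearMap.add_apply, TensorProduct.map_tmul, map_add,
      LinearMap.mul'_apply, AlgHom.toLinearMap_apply]
    by_cases hi : i = 1
    · subst hi
      rw [← hij, add_comm 1 j]
      exact add_mem (ι_mul_mem_wt _ (map_mem_wt φ hφ hb)) (ι_mul_mem_wt _ (ih hb))
    · simp [pr_of_mem ha hi, pr_sgn]

/-- For tensor powers, η⊗φ^n + 1⊗H_n is a homotopy from the identity to φ^(n+1). The Euler identity
recovers an element of weight n + 1 from the (1, n) part of its coproduct after division by n + 1,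
which explains the factor in `symHtpy`. -/
theorem map_eq_add_symHtpy {δ : V →ₗ[ℝ] V} (hδ : GVect.IsHomog 1 δ) (hη : GVect.IsHomog (-1) η)
    (hφδ : ∀ v, φ (δ v) = δ (φ v)) (h : ∀ v, φ v = v + (δ (η v) + η (δ v))) {n : ℕ} {x : GSym V}
    (hx : x ∈ wt 1 V n) :
    map φ hφ x = x + (linCoder δ (symHtpy φ hφ η n x) + symHtpy φ hφ η n (linCoder δ x)) := by
  induction n generalizing x with
  | zero =>
    obtain ⟨r, rfl⟩ := mem_wt_zero hx
    simp [symHtpy]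
  | succ n ih =>
    have hn : ((n : ℝ) + 1) ≠ 0 := by positivity
    let B : GSym V ⊗[ℝ] GSym V →ₗ[ℝ] GSym V := LinearMap.mul' ℝ (GSym V) ∘ₗ
      (TensorProduct.map (ι 1 V ∘ₗ η ∘ₗ pr V) (map φ hφ).toLinearMap +
        TensorProduct.map (ι 1 V ∘ₗ pr V ∘ₗ (sgn V 1).toLinearMap) (symHtpy φ hφ η n))
    have hB : ∀ y, symHtpy φ hφ η (n + 1) y = ((n : ℝ) + 1)⁻¹ • B (comul V y) := fun y => rfl
    have h1 : ((n : ℝ) + 1) • map φ hφ x = conv (φ ∘ₗ pr V) (map φ hφ).toLinearMap x := by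
      have e1 := euler_of_mem (map_mem_wt φ hφ hx)
      have e2 := (isCoalgHom_map φ hφ).euler_apply x
      have e3 : pr V ∘ₗ (map φ hφ).toLinearMap = φ ∘ₗ pr V := LinearMap.ext (pr_map φ hφ)
      rw [AlgHom.toLinearMap_apply, e1, e3] at e2
      exact_mod_cast e2
    have h2 : ((n : ℝ) + 1) • x = conv (pr V) LinearMap.id x := by
      have e1 := euler_of_mem hx
      push_cast at e1
      exact e1.symm
    have hd := isCoder_coder (linCoder_deg hδ) x
    refine (smul_right_injective (GSym V) hn) ?_
    simp only [smul_add, hB, map_smul]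
    rw [smul_smul, smul_smul, mul_inv_cancel₀ hn, one_smul, one_smul, h1, h2, hd]
    refine apply_comul_congr (LinearMap.mul' ℝ (GSym V) ∘ₗ TensorProduct.map (ι 1 V ∘ₗ φ ∘ₗ pr V)
      (map φ hφ).toLinearMap) (LinearMap.mul' ℝ (GSym V) ∘ₗ TensorProduct.map (ι 1 V ∘ₗ pr V)
      LinearMap.id + (linCoder δ ∘ₗ B + B ∘ₗ (TensorProduct.map (linCoder δ) LinearMap.id +
        TensorProduct.map (LinearMap.id ∘ₗ (sgn V 1).toLinearMap) (linCoder δ)))) hx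
      fun i j hij a ha b hb => ?_
    have hm := map_linCoder hδ hδ hφ hφδ b
    have s1 : ∀ v, V.sgn 1 (δ v) = -δ (V.sgn 1 v) := fun v => by
      simpa using GVect.sgn_apply_of_isHomog hδ 1 v
    have s2 : ∀ v, V.sgn 1 (η v) = -η (V.sgn 1 v) := fun v => by
      simpa using GVect.sgn_apply_of_isHomog hη 1 v
    simp only [LinearMap.comp_apply, LinearMap.add_apply, TensorProduct.map_tmul, map_add,
      LinearMap.mul'_apply, B, AlgHom.toLinearMap_apply, LinearMap.id_apply,
      linCoder_ι_mul hδ, pr_sgn, pr_linCoder, s1, s2, V.sgn_one_sgn_one, hm, map_neg, neg_mul]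
    by_cases hi : i = 1
    · have hb' := ih (x := b) (by rwa [show j = n by omega] at hb)
      rw [h (pr V a)]
      conv_rhs => enter [1]; rw [show b = map φ hφ b - (linCoder δ (symHtpy φ hφ η n b) +
        symHtpy φ hφ η n (linCoder δ b)) by rw [eq_sub_iff_add_eq]; exact hb'.symm]
      simp only [map_add, add_mul, mul_sub, mul_add]
      abel
    · simp [pr_of_mem ha hi]

end symHtpy

end GSym

/-! ### Cochains and the weight filtration -/

namespace GSym

open FreeSwap

variable {V : GVect.{u}} {W : GVect.{v}}

theorem comul_ι (v : V) : comul V (ι 1 V v) = ι 1 V v ⊗ₜ 1 + 1 ⊗ₜ ι 1 V v := by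
  induction v using DirectSum.Decomposition.inductionOn V.deg with
  | zero => simp
  | add a b ha hb =>
    simp only [map_add, ha, hb, TensorProduct.add_tmul, TensorProduct.tmul_add]; abel
  | homogeneous v => rw [← mul_one (ι 1 V _), comul_ι_mul, comul_one, comulOp_tmul V v.2, map_one]

theorem coder_ι {lam : GSym V →ₗ[ℝ] V} (h : lam 1 = 0) (v : V) :
    coder lam (ι 1 V v) = ι 1 V (lam (ι 1 V v)) := by
  simp [coder, comul_ι, h]

theorem IsCoalgHom.apply_ι {F : GSym V →ₗ[ℝ] GSym W} (hF : IsCoalgHom F) (v : V) :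
    F (ι 1 V v) = ι 1 W (pr W (F (ι 1 V v))) := by
  rw [← sub_eq_zero]
  refine eq_zero_of_euler_eq_zero ?_ (by simp [hF.counit])
  rw [map_sub, hF.euler_apply, euler_of_mem (ι_mem_wt _)]
  simp [conv, comul_ι, hF.map_one, pr_one]

theorem wproj_succ_ι_mul (m : ℕ) (v : V) (x : GSym V) :
    wproj 1 V (m + 1) (ι 1 V v * x) = ι 1 V v * wproj 1 V m x := by
  refine LinearMap.congr_fun (f := wproj 1 V (m + 1) ∘ₗ LinearMap.mulLeft ℝ (ι 1 V v))
    (g := LinearMap.mulLeft ℝ (ι 1 V v) ∘ₗ wproj 1 V m) (hom_ext_wt fun n x hx => ?_) x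
  rw [LinearMap.comp_apply, LinearMap.comp_apply, LinearMap.mulLeft_apply,
    LinearMap.mulLeft_apply, wproj_of_mem (ι_mul_mem_wt v hx), wproj_of_mem hx]
  by_cases h : n = m <;> simp [h]

/-- The linear part of a coalgebra morphism is its leading part for the weight filtration. -/
theorem IsCoalgHom.wproj_apply {F : GSym V →ₗ[ℝ] GSym W} (hF : IsCoalgHom F) {φ : V →ₗ[ℝ] W}
    (hφ : GVect.IsHomog 0 φ) (h : ∀ v, pr W (F (ι 1 V v)) = φ v) {n m : ℕ} (hnm : n ≤ m)
    {x : GSym V} (hx : x ∈ wt 1 V n) : wproj 1 W m (F x) = wproj 1 W m (map φ hφ x) := by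
  induction n using Nat.strong_induction_on generalizing m x with
  | _ n ih =>
  rcases Nat.eq_zero_or_pos m with rfl | hm
  · obtain rfl : n = 0 := by omega
    obtain ⟨r, rfl⟩ := mem_wt_zero hx
    simp [hF.map_one]
  obtain ⟨m, rfl⟩ : ∃ k, m = k + 1 := ⟨m - 1, by omega⟩
  have hm' : ((m + 1 : ℕ) : ℝ) ≠ 0 := by positivity
  refine smul_right_injective (GSym W) hm' ?_
  have e3 : pr W ∘ₗ (map φ hφ).toLinearMap = φ ∘ₗ pr V := LinearMap.ext (pr_map φ hφ)
  have e4 := (isCoalgHom_map φ hφ).euler_apply x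
  simp only [← wproj_euler]
  rw [e3, AlgHom.toLinearMap_apply] at e4
  rw [hF.euler_apply, e4]
  refine apply_comul_congr (wproj 1 W (m + 1) ∘ₗ LinearMap.mul' ℝ (GSym W) ∘ₗ
    TensorProduct.map (ι 1 W ∘ₗ pr W ∘ₗ F) F) (wproj 1 W (m + 1) ∘ₗ LinearMap.mul' ℝ (GSym W) ∘ₗ
    TensorProduct.map (ι 1 W ∘ₗ φ ∘ₗ pr V) (map φ hφ).toLinearMap) hx fun i j hij a ha b hb => ?_
  simp only [LinearMap.comp_apply, TensorProduct.map_tmul, LinearMap.mul'_apply,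
    wproj_succ_ι_mul, AlgHom.toLinearMap_apply]
  -- Terms with i = 0 vanish as pr 1 = 0, and i = 1 gives the linear part. For i ≥ 2 the factor b
  -- has weight below m, so by induction F b has no component of weight m.
  rcases Nat.eq_zero_or_pos i with rfl | hi
  · obtain ⟨r, rfl⟩ := mem_wt_zero ha
    simp [hF.map_one, pr_one]
  · rw [ih j (by omega) (by omega : j ≤ m) hb]
    by_cases hi1 : i = 1
    · subst hi1
      conv_lhs => rw [← ι_pr_of_mem ha, h]
    · rw [wproj_of_mem (map_mem_wt φ hφ hb), if_neg (by omega), mul_zero, mul_zero]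

/-- `α` vanishes on the elements of weight less than `n`. -/
def Van {M : Type w} [AddCommGroup M] [Module ℝ M] (n : ℕ) (α : GSym V →ₗ[ℝ] M) : Prop :=
  ∀ m < n, ∀ x ∈ wt 1 V m, α x = 0

section Van

variable {M : Type w} [AddCommGroup M] [Module ℝ M] {n : ℕ} {α β : GSym V →ₗ[ℝ] M}

theorem Van.mono {m : ℕ} (hα : Van n α) (h : m ≤ n) : Van m α :=
  fun i hi x hx => hα i (by omega) x hx

theorem Van.sub (hα : Van n α) (hβ : Van n β) : Van n (α - β) := fun i hi x hx => by
  rw [LinearMap.sub_apply, hα i hi x hx, hβ i hi x hx, sub_zero]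

theorem Van.succ (hα : Van n α) (h : ∀ x ∈ wt 1 V n, α x = 0) : Van (n + 1) α :=
  fun i hi x hx => by
    rcases Nat.lt_succ_iff_lt_or_eq.1 hi with hi | rfl
    · exact hα i hi x hx
    · exact h x hx

theorem van_comp_wproj (n : ℕ) (α : GSym V →ₗ[ℝ] M) : Van n (α ∘ₗ wproj 1 V n) :=
  fun i hi x hx => by rw [LinearMap.comp_apply, wproj_of_mem hx, if_neg hi.ne, map_zero]

theorem comp_wproj_apply (α : GSym V →ₗ[ℝ] M) {x : GSym V} (hx : x ∈ wt 1 V n) :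
    (α ∘ₗ wproj 1 V n) x = α x := by
  rw [LinearMap.comp_apply, wproj_of_mem hx, if_pos rfl]

theorem eq_zero_of_van (h : ∀ n, Van n α) : α = 0 :=
  hom_ext_wt fun n x hx => h (n + 1) n (by omega) x hx

theorem Van.apply_eq_zero (hα : Van n α) {x : GSym V} (hx : ∀ m ≥ n, wproj 1 V m x = 0) :
    α x = 0 := by
  obtain ⟨k, hk⟩ := exists_sum_wproj x
  rw [hk k le_rfl, map_sum]
  refine Finset.sum_eq_zero fun i _ => ?_
  rcases lt_or_ge i n with hi | hi
  · exact hα i hi _ (wproj_mem i x)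
  · rw [hx i hi, map_zero]

/-- By `wproj_apply`, F(x) and S(φ)(x) differ only in weights below n, where α vanishes. -/
theorem IsCoalgHom.van_apply {F : GSym W →ₗ[ℝ] GSym V} (hF : IsCoalgHom F) {φ : W →ₗ[ℝ] V}
    (hφ : GVect.IsHomog 0 φ) (h : ∀ v, pr V (F (ι 1 W v)) = φ v) (hα : Van n α)
    {x : GSym W} (hx : x ∈ wt 1 W n) : α (F x) = α (map φ hφ x) := by
  rw [← sub_eq_zero, ← map_sub]
  refine hα.apply_eq_zero fun m hm => ?_
  rw [map_sub, hF.wproj_apply hφ h hm hx, sub_self]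

theorem IsCoalgHom.van_comp {F : GSym W →ₗ[ℝ] GSym V} (hF : IsCoalgHom F) {φ : W →ₗ[ℝ] V}
    (hφ : GVect.IsHomog 0 φ) (h : ∀ v, pr V (F (ι 1 W v)) = φ v) (hα : Van n α) :
    Van n (α ∘ₗ F) := fun i hi x hx => by
  rw [LinearMap.comp_apply, hF.van_apply hφ h (hα.mono hi.le) hx]
  exact hα i hi _ (map_mem_wt φ hφ hx)

end Van

end GSym

/-! ### Unary brackets and linear parts. -/

namespace LInfty

open FreeSwap

variable (L : LInfty.{u})

theorem d_ι (x : L.sh) : L.d (ι 1 L.sh x) = ι 1 L.sh (L.lam₁ x) := GSym.coder_ι L.lam_one x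

theorem isHomog_lam₁ : GVect.IsHomog 1 L.lam₁ := fun n x hx => L.lam_deg n _ (GSym.ι_mem_deg hx)

theorem lam₁_lam₁ (x : L.sh) : L.lam₁ (L.lam₁ x) = 0 := by
  have := L.lam_d (ι 1 L.sh x)
  rwa [L.d_ι] at this

theorem d_sgn (q : ℤ) (x : GSym L.sh) :
    L.d (GSym.sgn L.sh q x) = (-1 : ℝ) ^ q • GSym.sgn L.sh q (L.d x) :=
  GSym.coder_sgn L.lam_deg q x

end LInfty

namespace LInftyHom

open FreeSwap

variable {h g : LInfty.{u}} (T : LInftyHom h g)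

theorem isHomog_linPart : GVect.IsHomog 0 T.linPart := fun n x hx => by
  rw [add_zero]; exact GSym.pr_mem_deg (T.map_deg n _ (GSym.ι_mem_deg hx))

theorem apply_ι (x : h.sh) : T.toLin (ι 1 h.sh x) = ι 1 g.sh (T.linPart x) :=
  T.isCoalgHom.apply_ι x

theorem linPart_lam₁ (x : h.sh) : T.linPart (h.lam₁ x) = g.lam₁ (T.linPart x) := by
  have h1 := T.apply_d (ι 1 h.sh x)
  rw [h.d_ι, T.apply_ι, T.apply_ι, g.d_ι] at h1
  simpa using congrArg (GSym.pr g.sh) h1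

end LInftyHom

/-! ### The square of the differential on cochains. -/

namespace Ruth

open FreeSwap GSym

variable {g h : LInfty.{u}} {V : GVect.{v}} (ρ : Ruth g V)

theorem D_apply (q : ℤ) (α : GSym g.sh →ₗ[ℝ] V) (x : GSym g.sh) : ρ.D q α x =
    ρ.act (TensorProduct.map (sgn g.sh q).toLinearMap α (comul g.sh x)) -
      (-1 : ℝ) ^ q • α (g.d x) := rfl

/-- The defining identity of ρ evaluated on (id ⊗ α)Δ(x), after coassociativity. This is the only
place where that identity enters D² = 0. -/
theorem act_act (q : ℤ) (α : GSym g.sh →ₗ[ℝ] V) (x : GSym g.sh) :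
    ρ.act (TensorProduct.map (sgn g.sh (q + 1)).toLinearMap
      (ρ.act ∘ₗ TensorProduct.map (sgn g.sh q).toLinearMap α ∘ₗ comul g.sh) (comul g.sh x)) =
    -ρ.act (TensorProduct.map (g.d ∘ₗ (sgn g.sh q).toLinearMap) α (comul g.sh x)) := by
  have h1 := LinearMap.congr_fun ρ.equivariance
    (TensorProduct.map (sgn g.sh q).toLinearMap α (comul g.sh x))
  have h2 : ∀ t, TensorProduct.assoc ℝ (GSym g.sh) (GSym g.sh) V
      (TensorProduct.map (comul g.sh) LinearMap.id
        (TensorProduct.map (sgn g.sh q).toLinearMap α t)) =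
      TensorProduct.map (sgn g.sh q).toLinearMap (TensorProduct.map (sgn g.sh q).toLinearMap α)
        (TensorProduct.assoc ℝ (GSym g.sh) (GSym g.sh) (GSym g.sh)
          (TensorProduct.map (comul g.sh) LinearMap.id t)) := by
    intro t
    induction t using TensorProduct.induction_on with
    | zero => simp
    | add a b ha hb => simp only [map_add, ha, hb]
    | tmul a b =>
      simp only [TensorProduct.map_tmul, AlgHom.toLinearMap_apply, comul_sgn, LinearMap.id_apply]
      generalize comul g.sh a = s
      induction s using TensorProduct.induction_on with
      | zero => simp
      | add a b ha hb => simp only [map_add, TensorProduct.add_tmul, ha, hb]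
      | tmul a b => simp
  simp only [LinearMap.add_apply, LinearMap.comp_apply, LinearEquiv.coe_coe,
    LinearMap.zero_apply] at h1
  rw [h2, comul_coassoc, TensorProduct.map_map, TensorProduct.map_map, TensorProduct.map_map,
    add_comm] at h1
  rw [eq_neg_iff_add_eq_zero, ← h1]
  congr 4
  ext x
  simp [sgn_sgn, add_comm]

theorem D_D {q q' : ℤ} (hq : q' = q + 1) (α : GSym g.sh →ₗ[ℝ] V) : ρ.D q' (ρ.D q α) = 0 := by
  subst hq
  ext x
  have h1 := ρ.act_act q α x
  have h2 : ρ.D q α = ρ.act ∘ₗ TensorProduct.map (sgn g.sh q).toLinearMap α ∘ₗ comul g.sh -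
    (-1 : ℝ) ^ q • α ∘ₗ g.d := rfl
  have h3 : (sgn g.sh q).toLinearMap ∘ₗ g.d =
      (-1 : ℝ) ^ q • g.d ∘ₗ (sgn g.sh q).toLinearMap := by
    ext x
    simp [g.d_sgn, smul_smul, ← mul_zpow]
  have h4 : (sgn g.sh q).toLinearMap ∘ₗ (sgn g.sh 1).toLinearMap =
      (sgn g.sh (q + 1)).toLinearMap := by
    ext x; simp [sgn_sgn]
  rw [D_apply, h2, tmap_sub_right, map_sub, h1]
  simp only [LinearMap.sub_apply, LinearMap.comp_apply, LinearMap.smul_apply, g.d_d, map_zero,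
    smul_zero, sub_zero, g.comul_d, map_add, TensorProduct.map_map, h3, h4, LinearMap.comp_id,
    TensorProduct.map_smul_left, TensorProduct.map_smul_right, map_smul, smul_add, smul_smul]
  have he : (-1 : ℝ) ^ q * (-1) ^ q = 1 := by rw [← mul_zpow]; simp
  rw [zpow_add₀ (by norm_num), zpow_one, mul_neg_one, neg_mul, he, LinearMap.zero_apply]
  module

end Ruth

/-! ### Invariance of cohomology under quasi-isomorphisms -/

namespace Ruth

open FreeSwap GSym

variable {g h : LInfty.{u}} {V : GVect.{v}} (ρ : Ruth g V)

theorem D_mem_cochains {q q' : ℤ} (hq : q' = q + 1) {α : GSym g.sh →ₗ[ℝ] V}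
    (hα : α ∈ cochains g V q) : ρ.D q α ∈ cochains g V q' := by
  subst hq
  intro d x hx
  refine sub_mem (apply_comul_mem (ρ.act ∘ₗ TensorProduct.map (sgn g.sh q).toLinearMap α) _ hx
    fun i j hij a ha b hb => ?_) (Submodule.smul_mem _ _ ?_)
  · have := ρ.act_deg _ _ _ (sgn_mem_deg q ha) _ (hα _ _ hb)
    rwa [show i + (j + q) + 1 = d + (q + 1) by omega] at this
  · have := hα _ _ (g.d_mem_deg d x hx)
    rwa [show d + 1 + q = d + (q + 1) by omega] at this

/-- The differential on the leading part of a cochain for the weight filtration. -/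
theorem D_apply_of_van (q : ℤ) {α : GSym g.sh →ₗ[ℝ] V} {n : ℕ} (hα : Van n α) {x : GSym g.sh}
    (hx : x ∈ wt 1 g.sh n) :
    ρ.D q α x = ρ.act (1 ⊗ₜ α x) - (-1 : ℝ) ^ q • α (linCoder g.lam₁ x) := by
  have h1 : ρ.act (TensorProduct.map (sgn g.sh q).toLinearMap α (comul g.sh x)) =
      ρ.act (1 ⊗ₜ α x) := by
    conv_rhs => rw [← lid_map_counit_comul x]
    refine apply_comul_congr (ρ.act ∘ₗ TensorProduct.map (sgn g.sh q).toLinearMap α)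
      (ρ.act ∘ₗ TensorProduct.mk ℝ (GSym g.sh) V 1 ∘ₗ α ∘ₗ
        (TensorProduct.lid ℝ (GSym g.sh)).toLinearMap ∘ₗ
        TensorProduct.map (counit g.sh).toLinearMap LinearMap.id) hx fun i j hij a ha b hb => ?_
    simp only [LinearMap.comp_apply, TensorProduct.map_tmul, LinearEquiv.coe_coe,
      TensorProduct.lid_tmul, AlgHom.toLinearMap_apply, LinearMap.id_apply, TensorProduct.mk_apply]
    -- If the left factor has positive weight, α is evaluated below weight n.
    rcases Nat.eq_zero_or_pos i with rfl | hi
    · obtain ⟨r, rfl⟩ := mem_wt_zero ha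
      simp [TensorProduct.smul_tmul]
    · rw [hα j (by omega) b hb, counit_of_mem ha hi.ne']
      simp
  have h2 : α (g.d x) = α (linCoder g.lam₁ x) := by
    refine apply_comul_congr (α ∘ₗ LinearMap.mul' ℝ (GSym g.sh) ∘ₗ
        TensorProduct.map (ι 1 g.sh ∘ₗ g.lam) LinearMap.id)
      (α ∘ₗ LinearMap.mul' ℝ (GSym g.sh) ∘ₗ
        TensorProduct.map (ι 1 g.sh ∘ₗ g.lam₁ ∘ₗ pr g.sh) LinearMap.id) hx
      fun i j hij a ha b hb => ?_
    simp only [LinearMap.comp_apply, TensorProduct.map_tmul, LinearMap.mul'_apply,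
      LinearMap.id_apply]
    -- A bracket of i elements lowers the weight by i - 1, so i ≥ 2 lands where α vanishes; i = 0
    -- drops out by λ(1) = 0.
    rcases lt_trichotomy i 1 with hi | rfl | hi
    · obtain rfl : i = 0 := by omega
      obtain ⟨r, rfl⟩ := mem_wt_zero ha
      simp [g.lam_one, pr_one]
    · conv_lhs => rw [← ι_pr_of_mem ha]
      rfl
    · rw [hα (j + 1) (by omega) _ (ι_mul_mem_wt _ hb), pr_of_mem ha hi.ne']
      simp
  rw [D_apply, h1, h2]

theorem van_D (q : ℤ) {α : GSym g.sh →ₗ[ℝ] V} {n : ℕ} (hα : Van n α) : Van n (ρ.D q α) :=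
  fun m hm x hx => by
    rw [ρ.D_apply_of_van q (hα.mono hm.le) hx, hα m hm x hx,
      hα m hm _ (linCoder_mem_wt g.lam₁ hx)]
    simp

end Ruth

/-! ### Homotopy inverses on symmetric powers and the removal of leading terms. -/

namespace LInftyHom

open FreeSwap GSym

variable {h g : LInfty.{u}}

/-- A homotopy inverse of the linear part of an `L∞`-morphism. -/
structure HomotopyInverse (T : LInftyHom h g) where
  inv : g.sh →ₗ[ℝ] h.sh
  src : h.sh →ₗ[ℝ] h.sh
  tgt : g.sh →ₗ[ℝ] g.sh
  inv_homog : GVect.IsHomog 0 inv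
  src_homog : GVect.IsHomog (-1) src
  tgt_homog : GVect.IsHomog (-1) tgt
  inv_lam₁ : ∀ y, inv (g.lam₁ y) = h.lam₁ (inv y)
  inv_linPart : ∀ x, inv (T.linPart x) = x + (h.lam₁ (src x) + src (h.lam₁ x))
  linPart_inv : ∀ y, T.linPart (inv y) = y + (g.lam₁ (tgt y) + tgt (g.lam₁ y))

theorem IsQuasiIso.nonempty_homotopyInverse {T : LInftyHom h g} (hT : T.IsQuasiIso) :
    Nonempty T.HomotopyInverse := by
  obtain ⟨j, a, b, hj, ha, hb, h1, h2, h3⟩ := GVect.exists_homotopyInverse h.isHomog_lam₁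
    g.isHomog_lam₁ T.isHomog_linPart h.lam₁_lam₁ g.lam₁_lam₁ T.linPart_lam₁ hT.1 hT.2
  exact ⟨⟨j, a, b, hj, ha, hb, h1, h2, h3⟩⟩

namespace HomotopyInverse

variable {T : LInftyHom h g}

/-- The algebra map induced by the linear part. -/
def symLin (T : LInftyHom h g) : GSym h.sh →ₐ[ℝ] GSym g.sh := map T.linPart T.isHomog_linPart

variable (I : T.HomotopyInverse)

/-- The algebra map induced by the homotopy inverse. -/
def symInv : GSym g.sh →ₐ[ℝ] GSym h.sh := map I.inv I.inv_homog

theorem linPart_inv_homog : GVect.IsHomog 0 (T.linPart ∘ₗ I.inv) := fun n x hx => by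
  simpa using T.isHomog_linPart _ _ (I.inv_homog n x hx)

theorem inv_linPart_homog : GVect.IsHomog 0 (I.inv ∘ₗ T.linPart) := fun n x hx => by
  simpa using I.inv_homog _ _ (T.isHomog_linPart n x hx)

/-- The induced homotopy on `S(𝔤[1])`. -/
def symTgt (n : ℕ) : GSym g.sh →ₗ[ℝ] GSym g.sh :=
  symHtpy (T.linPart ∘ₗ I.inv) I.linPart_inv_homog I.tgt n

/-- The induced homotopy on `S(𝔥[1])`. -/
def symSrc (n : ℕ) : GSym h.sh →ₗ[ℝ] GSym h.sh :=
  symHtpy (I.inv ∘ₗ T.linPart) I.inv_linPart_homog I.src n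

theorem symLin_symInv {n : ℕ} {y : GSym g.sh} (hy : y ∈ wt 1 g.sh n) :
    symLin T (I.symInv y) =
      y + (linCoder g.lam₁ (I.symTgt n y) + I.symTgt n (linCoder g.lam₁ y)) := by
  rw [symLin, symInv, map_comp_apply]
  exact map_eq_add_symHtpy I.linPart_inv_homog g.isHomog_lam₁ I.tgt_homog
    (fun v => by simp [I.inv_lam₁, T.linPart_lam₁]) (fun v => I.linPart_inv v) hy

theorem symInv_symLin {n : ℕ} {x : GSym h.sh} (hx : x ∈ wt 1 h.sh n) :
    I.symInv (symLin T x) =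
      x + (linCoder h.lam₁ (I.symSrc n x) + I.symSrc n (linCoder h.lam₁ x)) := by
  rw [symLin, symInv, map_comp_apply]
  exact map_eq_add_symHtpy I.inv_linPart_homog h.isHomog_lam₁ I.src_homog
    (fun v => by simp [I.inv_lam₁, T.linPart_lam₁]) (fun v => I.inv_linPart v) hx

theorem symLin_linCoder (x : GSym h.sh) :
    symLin T (linCoder h.lam₁ x) = linCoder g.lam₁ (symLin T x) :=
  map_linCoder h.isHomog_lam₁ g.isHomog_lam₁ _ T.linPart_lam₁ x

theorem symInv_linCoder (y : GSym g.sh) :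
    I.symInv (linCoder g.lam₁ y) = linCoder h.lam₁ (I.symInv y) :=
  map_linCoder g.isHomog_lam₁ h.isHomog_lam₁ _ I.inv_lam₁ y

/-- In leading weight n, the mapping cone of T^* is the cone of a homotopy equivalence, hence
contractible. A closed pair (α, β) starting in weight n is therefore a boundary up to weight n + 1.
The three integers keep the degrees p + 1, p, p - 1 free of arithmetic in types. -/
theorem exists_step {V : GVect.{v}} (ρ : Ruth g V) (I : T.HomotopyInverse) {p p' p'' : ℤ} (hp : p' = p + 1) (hp' : p = p'' + 1) {n : ℕ}
    {α : GSym g.sh →ₗ[ℝ] V} {β : GSym h.sh →ₗ[ℝ] V} (hα : α ∈ Ruth.cochains g V p')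
    (hβ : β ∈ Ruth.cochains h V p) (hαn : Van n α) (hβn : Van n β) (hDα : ρ.D p' α = 0)
    (hDβ : α ∘ₗ T.toLin = (ρ.pullback T).D p β) :
    ∃ α' ∈ Ruth.cochains g V p, ∃ β' ∈ Ruth.cochains h V p'', Van n α' ∧ Van n β' ∧
      Van (n + 1) (α - ρ.D p α') ∧
      Van (n + 1) (β - (α' ∘ₗ T.toLin - (ρ.pullback T).D p'' β')) := by
  set e : ℝ := (-1) ^ p with he
  have hee : e * e = 1 := by rw [he, ← mul_zpow]; simp
  have hp1 : (-1 : ℝ) ^ p' = -e := by rw [hp, zpow_add₀ (by norm_num)]; simp [he]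
  have hp2 : (-1 : ℝ) ^ p'' = -e := by
    rw [show p'' = p - 1 by omega, zpow_sub₀ (by norm_num)]; simp [he, div_neg]
  have hτ : ∀ v, (ρ.pullback T).act (1 ⊗ₜ v) = ρ.act (1 ⊗ₜ v) := fun v => by
    simp [Ruth.pullback, T.map_one]
  have F1 : ∀ y ∈ wt 1 g.sh n, ρ.act (1 ⊗ₜ α y) = -(e • α (linCoder g.lam₁ y)) := fun y hy => by
    have := ρ.D_apply_of_van p' hαn hy
    rw [hDα, LinearMap.zero_apply, hp1, eq_comm, sub_eq_zero] at this
    rw [this, neg_smul]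
  have F2 : ∀ x ∈ wt 1 h.sh n, α (symLin T x) =
      ρ.act (1 ⊗ₜ β x) - e • β (linCoder h.lam₁ x) := fun x hx => by
    have := (ρ.pullback T).D_apply_of_van p hβn hx
    rwa [← hDβ, LinearMap.comp_apply, T.isCoalgHom.van_apply T.isHomog_linPart (fun _ => rfl) hαn hx,
      hτ] at this
  have mS : ∀ x ∈ wt 1 h.sh n, symLin T x ∈ wt 1 g.sh n := fun x hx => map_mem_wt _ _ hx
  have mJ : ∀ y ∈ wt 1 g.sh n, I.symInv y ∈ wt 1 h.sh n := fun x hx => map_mem_wt _ _ hx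
  have mH : ∀ y ∈ wt 1 g.sh n, I.symTgt n y ∈ wt 1 g.sh n := fun x hx => symHtpy_mem_wt _ n hx
  have mH' : ∀ y ∈ wt 1 h.sh n, I.symSrc n y ∈ wt 1 h.sh n := fun x hx => symHtpy_mem_wt _ n hx
  have md : ∀ y ∈ wt 1 g.sh n, linCoder g.lam₁ y ∈ wt 1 g.sh n := fun x hx => linCoder_mem_wt _ hx
  have md' : ∀ y ∈ wt 1 h.sh n, linCoder h.lam₁ y ∈ wt 1 h.sh n := fun x hx => linCoder_mem_wt _ hx
  -- β transported by the homotopy inverse, corrected by the homotopy on S(𝔤[1]) so that its leading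
  -- differential is α (`F3`).
  let a₀ : GSym g.sh →ₗ[ℝ] V := β ∘ₗ I.symInv.toLinearMap + e • α ∘ₗ I.symTgt n
  -- The error left in the second component is a cocycle in leading weight (`F4`), but need not
  -- vanish.
  let b₁ : GSym h.sh →ₗ[ℝ] V := β - a₀ ∘ₗ (symLin T).toLinearMap
  have ea₀ : ∀ y, a₀ y = β (I.symInv y) + e • α (I.symTgt n y) := fun y => rfl
  have eb₁ : ∀ x, b₁ x = β x - a₀ (symLin T x) := fun x => rfl
  have F3 : ∀ y ∈ wt 1 g.sh n, ρ.act (1 ⊗ₜ a₀ y) - e • a₀ (linCoder g.lam₁ y) = α y := by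
    intro y hy
    have h1 := F2 _ (mJ y hy)
    have h2 := F1 _ (mH y hy)
    have h3 := congrArg α (I.symLin_symInv hy)
    rw [map_add, map_add, h1] at h3
    rw [ea₀, ea₀, TensorProduct.tmul_add, map_add, TensorProduct.tmul_smul, map_smul, h2, smul_add,
      smul_neg, smul_smul, smul_smul, hee, one_smul, one_smul, I.symInv_linCoder]
    rw [sub_eq_iff_eq_add] at h3
    rw [h3]
    abel
  have F4 : ∀ x ∈ wt 1 h.sh n, ρ.act (1 ⊗ₜ b₁ x) = e • b₁ (linCoder h.lam₁ x) := by
    intro x hx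
    have h1 := F3 _ (mS x hx)
    rw [F2 x hx, sub_eq_sub_iff_add_eq_add] at h1
    rw [eb₁, eb₁, TensorProduct.tmul_sub, map_sub, symLin_linCoder, smul_sub,
      sub_eq_sub_iff_add_eq_add, ← h1]
    abel
  -- The added term is closed in leading weight, so `F3` persists. Pulled back to S(𝔥[1]) it equals
  -- b₁ up to the boundary of β₁, by the other homotopy.
  let α₁ : GSym g.sh →ₗ[ℝ] V := a₀ + b₁ ∘ₗ I.symInv.toLinearMap
  let β₁ : GSym h.sh →ₗ[ℝ] V := e • b₁ ∘ₗ I.symSrc n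
  have eα₁ : ∀ y, α₁ y = a₀ y + b₁ (I.symInv y) := fun y => rfl
  have eβ₁ : ∀ x, β₁ x = e • b₁ (I.symSrc n x) := fun x => rfl
  have F5 : ∀ y ∈ wt 1 g.sh n, ρ.act (1 ⊗ₜ α₁ y) - e • α₁ (linCoder g.lam₁ y) = α y := by
    intro y hy
    rw [← F3 y hy, eα₁, eα₁, TensorProduct.tmul_add, map_add, F4 _ (mJ y hy), I.symInv_linCoder,
      smul_add]
    abel
  have F6 : ∀ x ∈ wt 1 h.sh n,
      α₁ (symLin T x) - (ρ.act (1 ⊗ₜ β₁ x) + e • β₁ (linCoder h.lam₁ x)) = β x := by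
    intro x hx
    rw [eα₁, eβ₁, eβ₁, I.symInv_symLin hx, TensorProduct.tmul_smul, map_smul, F4 _ (mH' x hx),
      smul_smul, smul_smul, hee, one_smul, one_smul, map_add, map_add, eb₁ x]
    abel
  have dJ : ∀ d, ∀ y ∈ deg g.sh d, I.symInv y ∈ deg h.sh d := fun d y hy => map_mem_deg _ _ hy
  have dH : ∀ d, ∀ y ∈ deg g.sh d, I.symTgt n y ∈ deg g.sh (d - 1) := fun d y hy =>
    symHtpy_mem_deg (hφ := I.linPart_inv_homog) I.tgt_homog n d y hy
  have dH' : ∀ d, ∀ y ∈ deg h.sh d, I.symSrc n y ∈ deg h.sh (d - 1) := fun d y hy =>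
    symHtpy_mem_deg (hφ := I.inv_linPart_homog) I.src_homog n d y hy
  have da₀ : ∀ d, ∀ y ∈ deg g.sh d, a₀ y ∈ V.deg (d + p) := fun d y hy => by
    refine add_mem (hβ _ _ (dJ d y hy)) (Submodule.smul_mem _ _ ?_)
    have := hα _ _ (dH d y hy)
    rwa [show d - 1 + p' = d + p by omega] at this
  have db₁ : ∀ d, ∀ x ∈ deg h.sh d, b₁ x ∈ V.deg (d + p) := fun d x hx =>
    sub_mem (hβ _ _ hx) (da₀ _ _ (map_mem_deg _ _ hx))
  refine ⟨α₁ ∘ₗ wproj 1 g.sh n, fun d y hy => ?_, β₁ ∘ₗ wproj 1 h.sh n, fun d x hx => ?_,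
    van_comp_wproj n _, van_comp_wproj n _, ?_, ?_⟩
  · have hy' := wproj_mem_deg n hy
    exact add_mem (da₀ _ _ hy') (db₁ _ _ (dJ _ _ hy'))
  · refine Submodule.smul_mem _ _ ?_
    have := db₁ _ _ (dH' _ _ (wproj_mem_deg n hx))
    rwa [show d - 1 + p = d + p'' by omega] at this
  · refine (hαn.sub (ρ.van_D p (van_comp_wproj n _))).succ fun y hy => ?_
    rw [LinearMap.sub_apply, ρ.D_apply_of_van p (van_comp_wproj n _) hy, comp_wproj_apply _ hy,
      comp_wproj_apply _ (md y hy), F5 y hy, sub_self]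
  · refine (hβn.sub ((T.isCoalgHom.van_comp T.isHomog_linPart (fun _ => rfl)
      (van_comp_wproj n _)).sub ((ρ.pullback T).van_D p'' (van_comp_wproj n _)))).succ
      fun x hx => ?_
    rw [LinearMap.sub_apply, LinearMap.sub_apply, LinearMap.comp_apply,
      T.isCoalgHom.van_apply T.isHomog_linPart (fun _ => rfl) (van_comp_wproj n _) hx,
      (ρ.pullback T).D_apply_of_van p'' (van_comp_wproj n _) hx, comp_wproj_apply _ hx,
      comp_wproj_apply _ (md' x hx), hτ, hp2, neg_smul, sub_neg_eq_add]
    have := comp_wproj_apply α₁ (mS x hx)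
    rw [symLin] at this
    rw [this, ← symLin, F6 x hx, sub_self]

end HomotopyInverse

end LInftyHom

/-! ### Convergence for the weight filtration and bijectivity of T^*. -/

namespace Ruth

open FreeSwap GSym

variable {g h : LInfty.{u}} {V : GVect.{v}}

/-- Infinite sums of cochains that converge for the weight filtration. -/
theorem exists_limit {p : ℤ} (A : ℕ → GSym g.sh →ₗ[ℝ] V) (hA : ∀ n, A n ∈ cochains g V p)
    (hv : ∀ n, Van n (A n)) :
    ∃ B ∈ cochains g V p, ∀ m, Van m (B - ∑ i ∈ Finset.range m, A i) := by
  refine ⟨glue fun n => ∑ i ∈ Finset.range (n + 1), A i, fun d x hx => ?_, fun m i hi x hx => ?_⟩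
  · induction hx using Submodule.span_induction with
    | mem x hx =>
      obtain ⟨m, hm⟩ := hx.exists_mem_wt
      rw [glue_of_mem _ hm]
      exact sum_mem (S := cochains g V p) (fun i _ => hA i) d x (Submodule.subset_span hx)
    | zero => rw [map_zero]; exact zero_mem _
    | add x y _ _ hx hy => rw [map_add]; exact add_mem hx hy
    | smul r x _ hx => rw [map_smul]; exact Submodule.smul_mem _ _ hx
  -- On weight i only the terms A 0, ..., A i can be nonzero, so the partial sum up to i agrees with
  -- all longer ones.
  · rw [LinearMap.sub_apply, glue_of_mem _ hx, ← Finset.sum_range_add_sum_Ico A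
      (show i + 1 ≤ m by omega), LinearMap.add_apply, sub_add_cancel_left, LinearMap.sum_apply,
      Finset.sum_eq_zero, neg_zero]
    intro j hj
    exact hv j i (by have := (Finset.mem_Ico.1 hj).1; omega) x hx

/-- Acyclicity of the mapping cone of T^*, by iterating `exists_step` and summing the corrections.
One statement yields both injectivity and surjectivity of T^* in cohomology. -/
theorem exists_primitive {T : LInftyHom h g} (hT : T.IsQuasiIso) (ρ : Ruth g V) {p p' p'' : ℤ}
    (hp : p' = p + 1) (hp' : p = p'' + 1) {α : GSym g.sh →ₗ[ℝ] V} {β : GSym h.sh →ₗ[ℝ] V}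
    (hα : α ∈ cochains g V p') (hβ : β ∈ cochains h V p) (hDα : ρ.D p' α = 0)
    (hDβ : α ∘ₗ T.toLin = (ρ.pullback T).D p β) :
    ∃ α' ∈ cochains g V p, ∃ β' ∈ cochains h V p'', ρ.D p α' = α ∧
      α' ∘ₗ T.toLin - (ρ.pullback T).D p'' β' = β := by
  obtain ⟨I⟩ := hT.nonempty_homotopyInverse
  set τ := ρ.pullback T with hτ
  have hpull : ∀ q α, (ρ.D q α) ∘ₗ T.toLin = τ.D q (α ∘ₗ T.toLin) :=
    fun q α => (RuthHom.canonical T ρ).pull_D q α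
  let Good : ℕ → (GSym g.sh →ₗ[ℝ] V) → (GSym h.sh →ₗ[ℝ] V) → Prop := fun n α β =>
    α ∈ cochains g V p' ∧ β ∈ cochains h V p ∧ Van n α ∧ Van n β ∧ ρ.D p' α = 0 ∧
      α ∘ₗ T.toLin = τ.D p β
  have step : ∀ n α β, Good n α β → ∃ α' β', α' ∈ cochains g V p ∧ β' ∈ cochains h V p'' ∧
      Van n α' ∧ Van n β' ∧ Good (n + 1) (α - ρ.D p α')
        (β - (α' ∘ₗ T.toLin - τ.D p'' β')) := by
    rintro n α β ⟨h1, h2, h3, h4, h5, h6⟩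
    obtain ⟨α', hα', β', hβ', h7, h8, h9, h10⟩ := I.exists_step ρ hp hp' h1 h2 h3 h4 h5 h6
    refine ⟨α', β', hα', hβ', h7, h8, sub_mem h1 (ρ.D_mem_cochains hp hα'), sub_mem h2 (sub_mem
      ((RuthHom.canonical T ρ).pull_mem_cochains hα') (τ.D_mem_cochains hp' hβ')), h9, h10, ?_, ?_⟩
    · rw [map_sub, h5, ρ.D_D hp, sub_zero]
    · rw [LinearMap.sub_comp, h6, hpull, map_sub, map_sub, τ.D_D hp', sub_zero]
  choose! A B hA hB hAv hBv hG using step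
  -- The remainder after n corrections, which starts in weight n. By `e1` and `e2` it is (α, β)
  -- minus the boundary of a partial sum, so the limit has no remainder in any weight.
  let S : ℕ → (GSym g.sh →ₗ[ℝ] V) × (GSym h.sh →ₗ[ℝ] V) := fun n => Nat.rec (α, β)
    (fun n s => (s.1 - ρ.D p (A n s.1 s.2), s.2 - (A n s.1 s.2 ∘ₗ T.toLin - τ.D p'' (B n s.1 s.2)))) n
  have hS : ∀ n, Good n (S n).1 (S n).2 := fun n => by
    induction n with
    | zero => exact ⟨hα, hβ, fun m hm => absurd hm m.not_lt_zero,
        fun m hm => absurd hm m.not_lt_zero, hDα, hDβ⟩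
    | succ n ih => exact hG n _ _ ih
  let a : ℕ → GSym g.sh →ₗ[ℝ] V := fun n => A n (S n).1 (S n).2
  let b : ℕ → GSym h.sh →ₗ[ℝ] V := fun n => B n (S n).1 (S n).2
  have e1 : ∀ n, (S n).1 = α - ρ.D p (∑ i ∈ Finset.range n, a i) := fun n => by
    induction n with
    | zero => simp [S]
    | succ n ih =>
      change (S n).1 - ρ.D p (a n) = _
      rw [ih, Finset.sum_range_succ, map_add, sub_sub]
  have e2 : ∀ n, (S n).2 = β - ((∑ i ∈ Finset.range n, a i) ∘ₗ T.toLin -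
      τ.D p'' (∑ i ∈ Finset.range n, b i)) := fun n => by
    induction n with
    | zero => simp [S]
    | succ n ih =>
      change (S n).2 - (a n ∘ₗ T.toLin - τ.D p'' (b n)) = _
      rw [ih, Finset.sum_range_succ, Finset.sum_range_succ, map_add, LinearMap.add_comp]
      abel
  obtain ⟨α', hα', hαv⟩ := exists_limit a (fun n => hA n _ _ (hS n)) fun n => hAv n _ _ (hS n)
  obtain ⟨β', hβ', hβv⟩ := exists_limit b (fun n => hB n _ _ (hS n)) fun n => hBv n _ _ (hS n)
  refine ⟨α', hα', β', hβ', ?_, ?_⟩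
  · rw [eq_comm, ← sub_eq_zero]
    refine eq_zero_of_van fun m => ?_
    have := (hS m).2.2.1.sub (ρ.van_D p (hαv m))
    rwa [e1, map_sub, sub_sub_sub_cancel_right] at this
  · rw [eq_comm, ← sub_eq_zero]
    refine eq_zero_of_van fun m => ?_
    have := (hS m).2.2.2.1.sub ((T.isCoalgHom.van_comp T.isHomog_linPart (fun _ => rfl)
      (hαv m)).sub (τ.van_D p'' (hβv m)))
    rw [e2, LinearMap.sub_comp, map_sub] at this
    convert this using 1
    abel

end Ruth

theorem RuthHom.canonical_pullH_bijective {g h : LInfty.{u}} {V : GVect.{v}} {T : LInftyHom h g}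
    (hT : T.IsQuasiIso) (ρ : Ruth g V) (q : ℤ) :
    Function.Bijective ((RuthHom.canonical T ρ).pullH q) := by
  constructor
  · rw [← LinearMap.ker_eq_bot, LinearMap.ker_eq_bot']
    intro c hc
    obtain ⟨⟨α, hα⟩, rfl⟩ := Submodule.Quotient.mk_surjective _ c
    have hc' := (Submodule.Quotient.mk_eq_zero _).1 hc
    obtain ⟨β, hβ, hαβ⟩ := hc'
    -- α together with a primitive β of T^*α is a closed pair of the cone.
    obtain ⟨α', hα', _, _, h1, _⟩ := Ruth.exists_primitive hT ρ (p := q - 1) (p'' := q - 1 - 1)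
      (by omega) (by omega) hα.1 hβ hα.2 hαβ.symm
    exact (Submodule.Quotient.mk_eq_zero _).2 ⟨α', hα', h1⟩
  · intro c
    obtain ⟨⟨β, hβ⟩, rfl⟩ := Submodule.Quotient.mk_surjective _ c
    -- For a cocycle β the pair (0, β) is closed; a primitive of it is a cocycle α' with T^*α' - β
    -- exact.
    obtain ⟨α', hα', β', hβ', h1, h2⟩ := Ruth.exists_primitive hT ρ (p := q) (p'' := q - 1)
      rfl (by omega) (zero_mem _) hβ.1 (map_zero _)
      (by rw [LinearMap.zero_comp]; exact (LinearMap.mem_ker.1 hβ.2).symm)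
    refine ⟨Submodule.Quotient.mk ⟨α', hα', h1⟩, (Submodule.Quotient.eq _).2 ⟨β', hβ', ?_⟩⟩
    change _ = α' ∘ₗ T.toLin - β
    rw [← h2, sub_sub_cancel]

/-! ### Derivations of the exterior algebra -/

namespace GExt

open FreeSwap

variable {N : GVect.{u}}

/-- Left multiplication by `v` on pairs consisting of an element and its universal derivative. -/
def leibOp (N : GVect.{u}) : N →ₗ[ℝ] Module.End ℝ (GExt N × (N ⊗[ℝ] GExt N)) :=
  N.piecewise fun n =>
    { toFun := fun v =>
        LinearMap.prod (LinearMap.mulLeft ℝ (ι (-1) N v) ∘ₗ LinearMap.fst ℝ _ _)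
          (TensorProduct.mk ℝ N (GExt N) v ∘ₗ LinearMap.fst ℝ _ _ -
            TensorProduct.map (N.sgn n) (LinearMap.mulLeft ℝ (ι (-1) N v)) ∘ₗ
              LinearMap.snd ℝ _ _)
      map_add' := fun v w => by
        refine LinearMap.ext fun x => Prod.ext ?_ ?_
        · simp [add_mul]
        · have : LinearMap.mulLeft ℝ (ι (-1) N v + ι (-1) N w) =
            LinearMap.mulLeft ℝ (ι (-1) N v) + LinearMap.mulLeft ℝ (ι (-1) N w) := by
            ext; simp [add_mul]
          simp [this, TensorProduct.map_add_right]
          abel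
      map_smul' := fun r v => by
        refine LinearMap.ext fun x => Prod.ext ?_ ?_
        · simp
        · have : LinearMap.mulLeft ℝ (r • ι (-1) N v) = r • LinearMap.mulLeft ℝ (ι (-1) N v) := by
            ext; simp
          simp [TensorProduct.smul_tmul', this, TensorProduct.map_smul_right, smul_sub] }

theorem leibOp_apply {n : ℤ} {v : N} (hv : v ∈ N.deg n) (x : GExt N × (N ⊗[ℝ] GExt N)) :
    leibOp N v x = (ι (-1) N v * x.1, v ⊗ₜ x.1 -
      TensorProduct.map (N.sgn n) (LinearMap.mulLeft ℝ (ι (-1) N v)) x.2) := by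
  simp [leibOp, N.piecewise_of_mem _ hv]

/-- The representation of `∧N` on `∧N ⊕ (N ⊗ ∧N)` that encodes the universal derivation. -/
def leibAct (N : GVect.{u}) : GExt N →ₐ[ℝ] Module.End ℝ (GExt N × (N ⊗[ℝ] GExt N)) :=
  lift (-1) N (leibOp N) fun p q v hv w hw => by
    have h := ι_mul_ι (-1) N hv hw
    have e : (-1 : ℝ) ^ (p * q) * (-1 : ℝ) ^ (p * q) = 1 := by
      rw [← mul_zpow]; simp
    refine LinearMap.ext fun ⟨x, t⟩ => ?_
    simp only [Module.End.mul_apply, LinearMap.smul_apply, leibOp_apply hv, leibOp_apply hw,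
      Prod.smul_mk, Prod.mk.injEq, map_sub, TensorProduct.map_tmul, N.sgn_of_mem p hw,
      N.sgn_of_mem q hv, LinearMap.mulLeft_apply, ← mul_assoc, h, smul_mul_assoc, true_and]
    have h2 : TensorProduct.map (N.sgn p) (LinearMap.mulLeft ℝ (ι (-1) N v))
        (TensorProduct.map (N.sgn q) (LinearMap.mulLeft ℝ (ι (-1) N w)) t) =
        (-1 * (-1 : ℝ) ^ (p * q)) • TensorProduct.map (N.sgn q) (LinearMap.mulLeft ℝ (ι (-1) N w))
        (TensorProduct.map (N.sgn p) (LinearMap.mulLeft ℝ (ι (-1) N v)) t) := by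
      have h3 : N.sgn p ∘ₗ N.sgn q = N.sgn q ∘ₗ N.sgn p := N.hom_ext fun n x hx => by
        simp [N.sgn_of_mem _ hx, smul_smul, mul_comm]
      have h4 : LinearMap.mulLeft ℝ (ι (-1) N v) ∘ₗ LinearMap.mulLeft ℝ (ι (-1) N w) =
          (-1 * (-1 : ℝ) ^ (p * q)) • LinearMap.mulLeft ℝ (ι (-1) N w) ∘ₗ
            LinearMap.mulLeft ℝ (ι (-1) N v) := by
        ext x; simp [← mul_assoc, h]
      rw [TensorProduct.map_map, TensorProduct.map_map, h3, h4, TensorProduct.map_smul_right,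
        LinearMap.smul_apply]
    rw [h2, mul_comm q p]
    simp only [← TensorProduct.smul_tmul', smul_sub, smul_smul, mul_assoc,
      e]
    module

theorem leibAct_fst (y : GExt N) (x : GExt N × (N ⊗[ℝ] GExt N)) :
    (leibAct N y x).1 = y * x.1 := by
  induction y using FreeSwap.induction with
  | one => simp
  | mul n v hv y hy => simp [leibAct, lift_ι, leibOp_apply hv, mul_assoc, ← hy]
  | add a b ha hb => simp [ha, hb, add_mul]
  | smul r a ha => simp [ha]

/-- The universal derivation `v₁ ∧ ⋯ ∧ v_k ↦ ∑ ± vᵢ ⊗ (v₁ ∧ ⋯ ∧ v_k without vᵢ)`. -/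
def leib (N : GVect.{u}) : GExt N →ₗ[ℝ] N ⊗[ℝ] GExt N :=
  LinearMap.snd ℝ _ _ ∘ₗ LinearMap.applyₗ (1, 0) ∘ₗ (leibAct N).toLinearMap

theorem leib_one : leib N 1 = 0 := by simp [leib]

/-- The presentation of ∧N only produces algebra maps, so the derivation is read off from the action
`leibAct` on ∧N ⊕ (N ⊗ ∧N). Moving a factor w in front of v costs -(-1)^(|v||w|), whence the minus
sign and the sign operator. -/
theorem leib_ι_mul {n : ℤ} {v : N} (hv : v ∈ N.deg n) (x : GExt N) :
    leib N (ι (-1) N v * x) = v ⊗ₜ x -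
      TensorProduct.map (N.sgn n) (LinearMap.mulLeft ℝ (ι (-1) N v)) (leib N x) := by
  have h : leibAct N (ι (-1) N v) = leibOp N v := by simp [leibAct, lift_ι]
  simp [leib, h, leibOp_apply hv, leibAct_fst]

section act

variable {A : Type w} [AddCommGroup A] [Module ℝ A] (a : A ⊗[ℝ] N →ₗ[ℝ] N)

/-- Contraction with the first factor of `N ⊗ ∧N`. -/
def actOn : A ⊗[ℝ] (N ⊗[ℝ] GExt N) →ₗ[ℝ] GExt N :=
  LinearMap.mul' ℝ (GExt N) ∘ₗ TensorProduct.map (ι (-1) N ∘ₗ a) LinearMap.id ∘ₗ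
    (TensorProduct.assoc ℝ A N (GExt N)).symm.toLinearMap

/-- The extension of `a : A ⊗ N → N` to `∧N` as a derivation. -/
def act : A ⊗[ℝ] GExt N →ₗ[ℝ] GExt N := actOn a ∘ₗ TensorProduct.map LinearMap.id (leib N)

theorem actOn_tmul (x : A) (v : N) (y : GExt N) :
    actOn a (x ⊗ₜ (v ⊗ₜ y)) = ι (-1) N (a (x ⊗ₜ v)) * y := by simp [actOn]

theorem act_one (x : A) : act a (x ⊗ₜ 1) = 0 := by simp [act, leib_one]

variable {a} {d : ℤ} {x : A}

/-- The element a(x ⊗ w) has degree d + |w| + 1. Moving it back behind v undoes the exterior sign of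
`leib` up to the Koszul sign of an operator of degree d + 1. -/
theorem actOn_map (ha : ∀ e, ∀ v ∈ N.deg e, a (x ⊗ₜ v) ∈ N.deg (d + e + 1)) {p : ℤ} {v : N}
    (hv : v ∈ N.deg p) (t : N ⊗[ℝ] GExt N) :
    actOn a (x ⊗ₜ TensorProduct.map (N.sgn p) (LinearMap.mulLeft ℝ (ι (-1) N v)) t) =
      -((-1 : ℝ) ^ ((d + 1) * p) • (ι (-1) N v * actOn a (x ⊗ₜ t))) := by
  induction t using TensorProduct.induction_on with
  | zero => simp
  | add s t hs ht =>
    simp only [map_add, TensorProduct.tmul_add, hs, ht, mul_add, smul_add, neg_add]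
  | tmul w y =>
    induction w using DirectSum.Decomposition.inductionOn N.deg with
    | zero => simp
    | add s t hs ht =>
      simp only [map_add, TensorProduct.tmul_add, TensorProduct.add_tmul, hs, ht, mul_add,
        smul_add, neg_add]
    | @homogeneous q w =>
      obtain ⟨w, hw⟩ := w
      simp only [TensorProduct.map_tmul, N.sgn_of_mem p hw, LinearMap.mulLeft_apply, actOn_tmul,
        TensorProduct.tmul_smul, map_smul, smul_mul_assoc, ← mul_assoc,
        ι_mul_ι (-1) N hv (ha q w hw), smul_smul, ← neg_smul]
      congr 1
      simp only [neg_one_zpow_eq_ite, Int.even_mul, Int.even_add]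
      by_cases Even p <;> by_cases Even q <;> by_cases Even d <;> simp [*]

theorem act_ι_mul (ha : ∀ e, ∀ v ∈ N.deg e, a (x ⊗ₜ v) ∈ N.deg (d + e + 1)) {p : ℤ} {v : N}
    (hv : v ∈ N.deg p) (y : GExt N) :
    act a (x ⊗ₜ (ι (-1) N v * y)) = ι (-1) N (a (x ⊗ₜ v)) * y +
      (-1 : ℝ) ^ ((d + 1) * p) • (ι (-1) N v * act a (x ⊗ₜ y)) := by
  simp only [act, LinearMap.comp_apply, TensorProduct.map_tmul, LinearMap.id_apply,
    leib_ι_mul hv, TensorProduct.tmul_sub, map_sub, actOn_map ha hv, actOn_tmul, sub_neg_eq_add]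

/-- Links the explicit sum in the definition of invariance to a globally defined linear map, which
can also be applied to values of cochain products. -/
theorem act_wedge (ha : ∀ e, ∀ v ∈ N.deg e, a (x ⊗ₜ v) ∈ N.deg (d + e + 1)) {k : ℕ}
    {e : Fin k → ℤ} {v : Fin k → N} (hv : ∀ i, v i ∈ N.deg (e i)) :
    act a (x ⊗ₜ (wedge v : GExt N)) = powAct a d x e v := by
  induction k with
  | zero => simp [wedge, powAct, act_one]
  | succ k ih =>
    have ih' := ih (e := fun i => e i.succ) (v := fun i => v i.succ) fun i => hv i.succ
    have hw : (wedge v : GExt N) = ι (-1) N (v 0) * (wedge fun i => v i.succ : Pow k N) := by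
      simp [wedge, List.ofFn_succ]
    rw [hw, act_ι_mul ha (hv 0), ih', powAct, powAct, Fin.sum_univ_succ]
    simp only [Submodule.coe_add, Submodule.coe_sum, Submodule.coe_smul]
    rw [Finset.mul_sum, Finset.smul_sum]
    congr 1
    · simp [wedge, List.ofFn_succ]
    · refine Finset.sum_congr rfl fun i _ => ?_
      have h1 : ∑ j with j < i.succ, e j = e 0 + ∑ j with j < i, e j.succ := by
        simp [Finset.sum_filter, Fin.sum_univ_succ]
      rw [h1, mul_smul_comm, smul_smul, ← zpow_add₀ (by norm_num), ← mul_add]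
      congr 1
      simp [wedge, List.ofFn_succ, Function.update_apply, Fin.succ_inj, (Fin.succ_ne_zero i).symm]

end act

/-- The span of the products `v₁ ∧ ⋯ ∧ v_k` of homogeneous elements with
`|v₁| + ⋯ + |v_k| = d`. -/
def wdeg (N : GVect.{u}) (k : ℕ) (d : ℤ) : Submodule ℝ (GExt N) :=
  Submodule.span ℝ {x | ∃ (e : Fin k → ℤ) (v : Fin k → N), (∀ i, v i ∈ N.deg (e i)) ∧
    ∑ i, e i = d ∧ x = wedge v}

theorem one_mem_wdeg : (1 : GExt N) ∈ wdeg N 0 0 :=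
  Submodule.subset_span ⟨fun _ => 0, fun _ => 0, by simp, by simp, by simp [wedge]⟩

theorem ι_mul_mem_wdeg {p d : ℤ} {k : ℕ} {v : N} (hv : v ∈ N.deg p) {x : GExt N}
    (hx : x ∈ wdeg N k d) : ι (-1) N v * x ∈ wdeg N (k + 1) (p + d) := by
  have : wdeg N k d ≤ (wdeg N (k + 1) (p + d)).comap (LinearMap.mulLeft ℝ (ι (-1) N v)) := by
    refine Submodule.span_le.2 ?_
    rintro _ ⟨e, w, hw, rfl, rfl⟩
    refine Submodule.subset_span ⟨Fin.cons p e, Fin.cons v w, fun i => ?_, ?_, ?_⟩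
    · cases i using Fin.cases <;> simp [hv, hw]
    · simp [Fin.sum_univ_succ]
    · simp [wedge, List.ofFn_succ]
  exact this hx

theorem cupPow_mem_wdeg {U : GVect.{v}} {K : GSym U →ₗ[ℝ] N}
    (hK : ∀ d, ∀ x ∈ GSym.deg U d, K x ∈ N.deg (d + 1)) (k : ℕ) {d : ℤ} {x : GSym U}
    (hx : x ∈ GSym.deg U d) : cupPow K k x ∈ wdeg N k (d + k) := by
  induction k generalizing d x with
  | zero =>
    simp only [cupPow, LinearMap.comp_apply, AlgHom.toLinearMap_apply, Algebra.linearMap_apply,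
      Algebra.algebraMap_eq_smul_one, Nat.cast_zero, add_zero]
    by_cases hd : d = 0
    · subst hd
      exact Submodule.smul_mem _ _ one_mem_wdeg
    · rw [GSym.counit_of_mem_deg hx hd, zero_smul]
      exact zero_mem _
  | succ k ih =>
    refine GSym.apply_comul_mem (LinearMap.mul' ℝ (GExt N) ∘ₗ
      TensorProduct.map (ι (-1) N ∘ₗ K ∘ₗ (GSym.sgn U k).toLinearMap) (cupPow K k)) _ hx
      fun i j hij a ha b hb => ?_
    simp only [LinearMap.comp_apply, TensorProduct.map_tmul, LinearMap.mul'_apply]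
    have := ι_mul_mem_wdeg (hK _ _ (GSym.sgn_mem_deg k ha)) (ih hb)
    rwa [show i + 1 + (j + (k : ℤ)) = d + (k + 1 : ℕ) by push_cast; omega] at this

/-- Precomposition with a coalgebra morphism commutes with cochain products. -/
theorem cupPow_comp {U : GVect.{v}} {U' : GVect.{w}} (K : GSym U →ₗ[ℝ] N)
    {G : GSym U' →ₗ[ℝ] GSym U} (hG : GSym.IsCoalgHom G) (k : ℕ) (x : GSym U') :
    cupPow (K ∘ₗ G) k x = cupPow K k (G x) := by
  induction k generalizing x with
  | zero => simp [cupPow, hG.counit]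
  | succ k ih =>
    have ih' : cupPow (K ∘ₗ G) k = cupPow K k ∘ₗ G := LinearMap.ext ih
    have hs : (K ∘ₗ G) ∘ₗ (GSym.sgn U' k).toLinearMap = (K ∘ₗ (GSym.sgn U k).toLinearMap) ∘ₗ G :=
      LinearMap.ext fun x => by simp [hG.sgn_apply]
    rw [cupPow, cupPow, LinearMap.comp_apply, LinearMap.comp_apply, LinearMap.comp_apply,
      LinearMap.comp_apply, ih', hs, hG.comul, TensorProduct.map_map]
    rfl

end GExt

/-! ### The curvature of a lift -/

namespace Extension

open GSym

variable {n g h : LInfty.{u}} (E : Extension n g)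

theorem ι_ad (t : GSym E.mid.sh ⊗[ℝ] n.sh) : E.ι.lin (E.ad t) = E.adMid t := by
  simp [ad, ι_kerEquiv]

theorem adMid_tmul (x : GSym E.mid.sh) (v : n.sh) :
    E.adMid (x ⊗ₜ v) = E.mid.lam (x * FreeSwap.ι 1 E.mid.sh (E.ι.lin v)) := by
  simp [adMid]

theorem ad_mem_deg {d e : ℤ} {x : GSym E.mid.sh} (hx : x ∈ deg E.mid.sh d) {v : n.sh}
    (hv : v ∈ n.sh.deg e) : E.ad (x ⊗ₜ v) ∈ n.sh.deg (d + e + 1) :=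
  E.mem_deg_of_ι <| by
    rw [ι_ad, adMid_tmul]
    exact E.mid.lam_deg _ _ (mul_mem_deg hx (GSym.ι_mem_deg (E.ι_mem_deg hv)))

/-- `K` is the curvature of the map `F`: `ι ∘ K = λ̂ ∘ F - pr ∘ F ∘ d`. -/
def IsCurv (F : GSym h.sh →ₗ[ℝ] GSym E.mid.sh) (K : GSym h.sh →ₗ[ℝ] n.sh) : Prop :=
  ∀ x, E.ι.lin (K x) = E.mid.lam (F x) - pr E.mid.sh (F (h.d x))

variable {E} {T : LInftyHom h g} {F : GSym h.sh →ₗ[ℝ] GSym E.mid.sh} {K K' : GSym h.sh →ₗ[ℝ] n.sh}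

theorem IsCurv.unique (hK : E.IsCurv F K) (hK' : E.IsCurv F K') : K = K' :=
  LinearMap.ext fun x => E.inj <| by rw [hK, hK']

theorem IsLift.exists_curv (hF : E.IsLift T F) : ∃ K, E.IsCurv F K := by
  have hker : ∀ x, (E.mid.lam ∘ₗ F - pr E.mid.sh ∘ₗ F ∘ₗ h.d) x ∈ LinearMap.ker E.π.lin := by
    intro x
    have h1 : E.π.lin (E.mid.lam (F x)) = g.lam (T.toLin x) := by
      rw [← E.π.comm, ← hF.symMap_π]; rfl
    have h2 : E.π.lin (pr E.mid.sh (F (h.d x))) = g.lam (T.toLin x) := by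
      rw [← pr_map E.π.lin E.π.homog, ← g.pr_d, ← T.apply_d, ← hF.symMap_π]; rfl
    simp [h1, h2]
  exact ⟨E.kerEquiv.toLinearMap ∘ₗ LinearMap.codRestrict _ _ hker, fun x => by
    simp [E.ι_kerEquiv]⟩

theorem IsCurv.mem_deg (hK : E.IsCurv F K) (hF : E.IsLift T F) (d : ℤ) (x : GSym h.sh)
    (hx : x ∈ deg h.sh d) : K x ∈ n.sh.deg (d + 1) :=
  E.mem_deg_of_ι <| by
    rw [hK]
    exact sub_mem (E.mid.lam_deg _ _ (hF.isCoalgHom.map_deg _ _ hx))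
      (pr_mem_deg (hF.isCoalgHom.map_deg _ _ (h.d_mem_deg _ _ hx)))

theorem IsCurv.comp {h' : LInfty.{u}} (hK : E.IsCurv F K) (G : LInftyHom h' h) :
    E.IsCurv (F ∘ₗ G.toLin) (K ∘ₗ G.toLin) := fun x => by
  simp [hK _, G.apply_d]

/-- A lift fails to commute with the codifferentials by its curvature. -/
theorem IsCurv.d_apply (hK : E.IsCurv F K) (hF : E.IsLift T F) (x : GSym h.sh) :
    E.mid.d (F x) = F (h.d x) + conv (E.ι.lin ∘ₗ K) F x := by
  have h1 : E.mid.d ∘ₗ F - F ∘ₗ h.d = conv (E.ι.lin ∘ₗ K) F := by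
    -- Both sides are coderivations of degree one along F, and the definition of the curvature
    -- equates their corestrictions.
    refine (((isCoder_coder E.mid.lam_deg).comp_right hF.isCoalgHom).sub
      (IsCoder.comp_left hF.isCoalgHom (isCoder_coder h.lam_deg))).eq
      (hF.isCoalgHom.isCoder_conv fun d x hx => E.ι_mem_deg (hK.mem_deg hF d x hx))
      hF.isCoalgHom fun x => ?_
    rw [pr_conv _ hF.isCoalgHom.counit, LinearMap.comp_apply, hK, LinearMap.sub_apply, map_sub,
      LinearMap.comp_apply, LinearMap.comp_apply]
    congr 1
    exact E.mid.pr_d _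
  rw [← h1, LinearMap.sub_apply, LinearMap.comp_apply, LinearMap.comp_apply, add_sub_cancel]

/-- The Bianchi identity. -/
theorem IsCurv.bianchi (hK : E.IsCurv F K) (hF : E.IsLift T F) (x : GSym h.sh) :
    E.ad (TensorProduct.map (F ∘ₗ (sgn h.sh 1).toLinearMap) K (comul h.sh x)) = -K (h.d x) := by
  apply E.inj
  -- This is λ̂d̂F = 0. What remains is cocommutativity, which turns ιK(x₁) ∨ F(x₂) into the
  -- argument of the adjoint action.
  have h1 : E.mid.lam (F (h.d x)) + E.mid.lam (conv (E.ι.lin ∘ₗ K) F x) = 0 := by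
    rw [← map_add, ← hK.d_apply hF, E.mid.lam_d]
  rw [map_neg, hK, h.d_d, map_zero, map_zero, sub_zero, eq_neg_of_add_eq_zero_left h1, neg_neg,
    ι_ad, conv, LinearMap.comp_apply, LinearMap.comp_apply, ← braid_comul]
  conv_lhs => rw [braid_comul]
  refine LinearMap.congr_fun (f := E.adMid ∘ₗ
    TensorProduct.map (F ∘ₗ (sgn h.sh 1).toLinearMap) K) (g := E.mid.lam ∘ₗ
      LinearMap.mul' ℝ (GSym E.mid.sh) ∘ₗ
        TensorProduct.map (FreeSwap.ι 1 E.mid.sh ∘ₗ E.ι.lin ∘ₗ K) F ∘ₗ braid h.sh)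
    (tensor_hom_ext fun p q a ha b hb => ?_) (comul h.sh x)
  simp only [LinearMap.comp_apply, TensorProduct.map_tmul, braid_tmul ha hb, map_smul,
    LinearMap.mul'_apply, adMid_tmul, AlgHom.toLinearMap_apply, sgn_of_mem _ _ ha,
    mul_ι (E.ι_mem_deg (hK.mem_deg hF q b hb)),
    sgn_of_mem _ _ (hF.isCoalgHom.map_deg p a ha), mul_smul_comm, smul_smul]
  congr 1
  simp only [neg_one_zpow_eq_ite, Int.even_mul, Int.even_add]
  by_cases Even p <;> by_cases Even q <;> simp [*]

/-- The Bianchi identity applied to each factor of K^k: the action is a derivation of ∧𝔫[1], and d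
is a coderivation, so the resulting terms reassemble to K^k d. -/
theorem IsCurv.act_cupPow (hK : E.IsCurv F K) (hF : E.IsLift T F) (k : ℕ) (x : GSym h.sh) :
    GExt.act E.ad (TensorProduct.map (F ∘ₗ (sgn h.sh k).toLinearMap) (GExt.cupPow K k)
      (comul h.sh x)) = (-1 : ℝ) ^ (k : ℤ) • GExt.cupPow K k (h.d x) := by
  induction k generalizing x with
  | zero =>
    have h1 : GExt.cupPow K 0 (h.d x) = 0 := by simp [GExt.cupPow, h.counit_d]
    rw [h1, smul_zero]
    generalize comul h.sh x = t
    induction t using TensorProduct.induction_on with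
    | zero => simp
    | add a b ha hb => simp only [map_add, ha, hb, add_zero]
    | tmul a b =>
      simp [GExt.cupPow, Algebra.algebraMap_eq_smul_one, GExt.act_one]
  | succ k ih =>
    let c := GExt.cupPow K k
    -- A₁ acts on the first factor K, A₂ on the remaining K^k. For A₂ the acting argument has to
    -- pass that of K, which is harmless on the iterated coproduct.
    let A₁ : GSym h.sh ⊗[ℝ] (GSym h.sh ⊗[ℝ] GSym h.sh) →ₗ[ℝ] GExt n.sh :=
      LinearMap.mul' ℝ (GExt n.sh) ∘ₗ TensorProduct.map (FreeSwap.ι (-1) n.sh ∘ₗ E.ad ∘ₗ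
        TensorProduct.map (F ∘ₗ (sgn h.sh 1).toLinearMap) K ∘ₗ
        TensorProduct.map (sgn h.sh k).toLinearMap (sgn h.sh k).toLinearMap) c ∘ₗ
        (TensorProduct.assoc ℝ _ _ _).symm.toLinearMap
    let A₂ : GSym h.sh ⊗[ℝ] (GSym h.sh ⊗[ℝ] GSym h.sh) →ₗ[ℝ] GExt n.sh :=
      LinearMap.mul' ℝ (GExt n.sh) ∘ₗ TensorProduct.map
        (FreeSwap.ι (-1) n.sh ∘ₗ K ∘ₗ (sgn h.sh k).toLinearMap ∘ₗ (sgn h.sh 1).toLinearMap)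
        (GExt.act E.ad ∘ₗ TensorProduct.map (F ∘ₗ (sgn h.sh k).toLinearMap) c)
    have hA : GExt.act E.ad ∘ₗ TensorProduct.map (F ∘ₗ (sgn h.sh (k + 1 : ℕ)).toLinearMap)
        (LinearMap.mul' ℝ (GExt n.sh) ∘ₗ TensorProduct.map
          (FreeSwap.ι (-1) n.sh ∘ₗ K ∘ₗ (sgn h.sh k).toLinearMap) c) =
        A₁ - A₂ ∘ₗ braid₁₂ h.sh := by
      refine tensor_hom_ext₃ fun i j l a ha b hb y hy => ?_
      simp only [A₁, A₂, LinearMap.comp_apply, LinearMap.sub_apply, braid₁₂_tmul ha hb,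
        TensorProduct.map_tmul, LinearMap.mul'_apply, AlgHom.toLinearMap_apply, LinearEquiv.coe_coe,
        TensorProduct.assoc_symm_tmul, sgn_of_mem _ _ ha, sgn_of_mem _ _ hb, map_smul,
        ← TensorProduct.smul_tmul', TensorProduct.tmul_smul, smul_smul,
        GExt.act_ι_mul (fun e v hv => E.ad_mem_deg (hF.isCoalgHom.map_deg i a ha) hv)
          (hK.mem_deg hF j b hb), smul_add]
      rw [sub_eq_add_neg, ← neg_smul]
      congr 2
      · simp only [neg_one_zpow_eq_ite, Int.even_mul, Int.even_add, Nat.cast_add, Nat.cast_one]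
        by_cases Even i <;> by_cases Even j <;> by_cases Even (k : ℤ) <;> simp [*]
      · simp only [neg_one_zpow_eq_ite, Int.even_mul, Int.even_add, Nat.cast_add, Nat.cast_one]
        by_cases Even i <;> by_cases Even j <;> by_cases Even (k : ℤ) <;> simp [*]
    have h1 : A₁ (comul₃ h.sh x) = -LinearMap.mul' ℝ (GExt n.sh) (TensorProduct.map
        (FreeSwap.ι (-1) n.sh ∘ₗ K ∘ₗ h.d ∘ₗ (sgn h.sh k).toLinearMap) c (comul h.sh x)) := by
      have h2 : E.ad ∘ₗ TensorProduct.map (F ∘ₗ (sgn h.sh 1).toLinearMap) K ∘ₗ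
          TensorProduct.map (sgn h.sh k).toLinearMap (sgn h.sh k).toLinearMap ∘ₗ comul h.sh =
          -(K ∘ₗ h.d ∘ₗ (sgn h.sh k).toLinearMap) := LinearMap.ext fun y => by
        simp only [LinearMap.comp_apply, ← comul_sgn, hK.bianchi hF, LinearMap.neg_apply,
          AlgHom.toLinearMap_apply]
      simp only [A₁, LinearMap.comp_apply, comul₃_eq, LinearEquiv.coe_coe,
        LinearEquiv.symm_apply_apply, TensorProduct.map_map, LinearMap.comp_assoc, h2,
        LinearMap.comp_neg, LinearMap.comp_id]
      generalize comul h.sh x = t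
      induction t using TensorProduct.induction_on with
      | zero => simp
      | add a b ha hb => simp only [map_add, ha, hb, neg_add]
      | tmul a b => simp
    have h3 : A₂ (comul₃ h.sh x) = (-1 : ℝ) ^ (k : ℤ) • LinearMap.mul' ℝ (GExt n.sh)
        (TensorProduct.map (FreeSwap.ι (-1) n.sh ∘ₗ K ∘ₗ (sgn h.sh k).toLinearMap ∘ₗ
          (sgn h.sh 1).toLinearMap) (c ∘ₗ h.d) (comul h.sh x)) := by
      have h2 : (GExt.act E.ad ∘ₗ TensorProduct.map (F ∘ₗ (sgn h.sh k).toLinearMap) c) ∘ₗ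
          comul h.sh = (-1 : ℝ) ^ (k : ℤ) • c ∘ₗ h.d := LinearMap.ext ih
      simp only [A₂, comul₃, LinearMap.comp_apply, TensorProduct.map_map, h2, LinearMap.comp_id,
        TensorProduct.map_smul_right, LinearMap.smul_apply, map_smul]
    have h4 : (sgn h.sh k).toLinearMap ∘ₗ h.d =
        (-1 : ℝ) ^ (k : ℤ) • h.d ∘ₗ (sgn h.sh k).toLinearMap := LinearMap.ext fun y => by
      simp [h.d_sgn, smul_smul, ← mul_pow]
    have h5 := LinearMap.congr_fun hA (comul₃ h.sh x)
    rw [LinearMap.sub_apply, LinearMap.comp_apply A₂, braid₁₂_comul₃, h1, h3, comul₃,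
      LinearMap.comp_apply, LinearMap.comp_apply, TensorProduct.map_map, LinearMap.comp_id] at h5
    have h7 : GExt.cupPow K (k + 1) = (LinearMap.mul' ℝ (GExt n.sh) ∘ₗ TensorProduct.map
        (FreeSwap.ι (-1) n.sh ∘ₗ K ∘ₗ (sgn h.sh k).toLinearMap) c) ∘ₗ comul h.sh := rfl
    rw [h7, h5, LinearMap.comp_apply, LinearMap.comp_apply, h.comul_d, map_add, map_add, TensorProduct.map_map, TensorProduct.map_map, LinearMap.comp_id,
      LinearMap.comp_assoc, LinearMap.comp_assoc, LinearMap.comp_assoc, LinearMap.comp_assoc, h4]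
    simp only [LinearMap.comp_smul, TensorProduct.map_smul_left, LinearMap.smul_apply, map_smul,
      smul_add, smul_smul, Nat.cast_add, Nat.cast_one]
    have h6 : (-1 : ℝ) ^ (k : ℤ) * (-1) ^ (k : ℤ) = 1 := by rw [← mul_zpow]; simp
    rw [zpow_add₀ (by norm_num), zpow_one, mul_neg_one, neg_mul, h6]
    module

end Extension

/-! ### The Chern-Weil-Lecomte cocycles -/

namespace Extension

open GSym

variable {n g h : LInfty.{u}} {E : Extension n g} {V : GVect.{v}} {W : GVect.{w}}

/-- The cochain `f ∘ (K ∧ ⋯ ∧ K)`. -/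
def cwMap (K : GSym h.sh →ₗ[ℝ] n.sh) {k : ℕ} (f : GExt.Pow k n.sh →ₗ[ℝ] V) : GSym h.sh →ₗ[ℝ] V :=
  f ∘ₗ (GExt.cupPow K k).codRestrict _ (GExt.cupPow_mem K k)

theorem cwMap_comp {h' : LInfty.{u}} (K : GSym h.sh →ₗ[ℝ] n.sh) {k : ℕ}
    (f : GExt.Pow k n.sh →ₗ[ℝ] V) (G : LInftyHom h' h) :
    cwMap (K ∘ₗ G.toLin) f = cwMap K f ∘ₗ G.toLin := by
  ext x
  exact congrArg f (Subtype.ext (GExt.cupPow_comp K G.isCoalgHom k x))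

variable {ρ : Ruth g V} {k : ℕ} {p : ℤ} {f : GExt.Pow k n.sh →ₗ[ℝ] V} {f' : GExt n.sh →ₗ[ℝ] V}

theorem mem_deg_of_mem_Inv (hf : f ∈ E.Inv ρ k p)
    (hf' : f' ∘ₗ Submodule.subtype _ = f) {d : ℤ} {y : GExt n.sh} (hy : y ∈ GExt.wdeg n.sh k d) :
    f' y ∈ V.deg (d + p) := by
  have : GExt.wdeg n.sh k d ≤ (V.deg (d + p)).comap f' := by
    refine Submodule.span_le.2 ?_
    rintro _ ⟨e, v, hv, rfl, rfl⟩
    have := hf.1 e v hv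
    rwa [← hf'] at this
  exact this hy

/-- Invariance is given on products and extends by linearity to their span. An extension f' of f to
all of ∧𝔫[1] avoids carrying membership proofs. -/
theorem apply_act_of_mem_Inv (hf : f ∈ E.Inv ρ k p)
    (hf' : f' ∘ₗ Submodule.subtype _ = f) {i : ℤ} {x : GSym E.mid.sh} (hx : x ∈ deg E.mid.sh i)
    {d : ℤ} {y : GExt n.sh} (hy : y ∈ GExt.wdeg n.sh k d) :
    f' (GExt.act E.ad (x ⊗ₜ y)) =
      (-1 : ℝ) ^ (p * (i + 1)) • ρ.act (E.π.symMap x ⊗ₜ f' y) := by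
  induction hy using Submodule.span_induction with
  | zero => simp
  | add a b _ _ ha hb => simp only [TensorProduct.tmul_add, map_add, ha, hb, smul_add]
  | smul r a _ ha => simp only [TensorProduct.tmul_smul, map_smul, ha]; rw [smul_comm]
  | mem y hy =>
    obtain ⟨e, v, hv, rfl, rfl⟩ := hy
    have := hf.2 i x hx e v hv
    rw [← hf'] at this
    rw [GExt.act_wedge (fun e v hv => E.ad_mem_deg hx hv) hv]
    exact this

/-- Invariance pulls the action through f, and `act_cupPow` turns the result into f K^k d with sign
(-1)^(k+p), which cancels the second half of D. -/
theorem IsCurv.cwMap_mem_cocycles {τ : Ruth h W} (Φ : RuthHom τ ρ)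
    {F : GSym h.sh →ₗ[ℝ] GSym E.mid.sh} {K : GSym h.sh →ₗ[ℝ] n.sh} (hK : E.IsCurv F K)
    (hF : E.IsLift Φ.T F) (hf : f ∈ E.Inv ρ k p) :
    Φ.t ∘ₗ cwMap K f ∈ τ.cocycles (k + p) := by
  obtain ⟨f', hf'⟩ := LinearMap.exists_extend f
  have hm : Φ.t ∘ₗ cwMap K f = Φ.t ∘ₗ f' ∘ₗ GExt.cupPow K k := by rw [← hf']; rfl
  have hKd : ∀ d, ∀ x ∈ deg h.sh d, GExt.cupPow K k x ∈ GExt.wdeg n.sh k (d + k) :=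
    fun d x hx => GExt.cupPow_mem_wdeg (hK.mem_deg hF) k hx
  rw [hm]
  refine ⟨fun d x hx => ?_, LinearMap.ext fun x => ?_⟩
  · have := Φ.homog _ _ (mem_deg_of_mem_Inv hf hf' (hKd d x hx))
    rwa [add_zero, add_assoc] at this
  have h1 : τ.act ∘ₗ TensorProduct.map (sgn h.sh (k + p)).toLinearMap
      (Φ.t ∘ₗ f' ∘ₗ GExt.cupPow K k) = (-1 : ℝ) ^ p • Φ.t ∘ₗ f' ∘ₗ GExt.act E.ad ∘ₗ
        TensorProduct.map (F ∘ₗ (sgn h.sh k).toLinearMap) (GExt.cupPow K k) := by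
    refine tensor_hom_ext fun i j a ha b hb => ?_
    have h2 := LinearMap.congr_fun Φ.comm (a ⊗ₜ f' (GExt.cupPow K k b))
    simp only [LinearMap.comp_apply, TensorProduct.map_tmul, LinearMap.id_apply] at h2
    simp only [LinearMap.comp_apply, TensorProduct.map_tmul, LinearMap.smul_apply,
      AlgHom.toLinearMap_apply, sgn_of_mem _ _ ha, map_smul, ← TensorProduct.smul_tmul',
      apply_act_of_mem_Inv hf hf' (hF.isCoalgHom.map_deg i a ha) (hKd j b hb), hF.symMap_π, ← h2,
      smul_smul]
    congr 1
    simp only [neg_one_zpow_eq_ite, Int.even_mul, Int.even_add]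
    by_cases Even p <;> by_cases Even i <;> by_cases Even (k : ℤ) <;> simp [*]
  have h3 := LinearMap.congr_fun h1 (comul h.sh x)
  simp only [LinearMap.comp_apply, LinearMap.smul_apply, hK.act_cupPow hF, map_smul,
    smul_smul] at h3
  rw [Ruth.D_apply, h3, LinearMap.zero_apply, zpow_add₀ (by norm_num), mul_comm]
  exact sub_self _

end Extension

/-! ### The cylinder of a lift -/

namespace GVect

/-- The identity of `N`, as a degree one map `N[2] → N[1]`. -/
def unshift (N : GVect.{u}) : (N.shift 1).shift 1 →ₗ[ℝ] N.shift 1 :=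
  (LinearMap.id : N.carrier →ₗ[ℝ] N.carrier)

/-- The identity of `N`, as a degree minus one map `N[1] → N[2]`. -/
def reshift (N : GVect.{u}) : N.shift 1 →ₗ[ℝ] (N.shift 1).shift 1 :=
  (LinearMap.id : N.carrier →ₗ[ℝ] N.carrier)

theorem reshift_unshift (N : GVect.{u}) (x : (N.shift 1).shift 1) :
    N.reshift (N.unshift x) = x := rfl

theorem isHomog_unshift (N : GVect.{u}) : IsHomog 1 N.unshift := fun _ _ hx => hx

theorem reshift_mem (N : GVect.{u}) {m : ℤ} {x : N.shift 1} (hx : x ∈ (N.shift 1).deg (m + 1)) :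
    N.reshift x ∈ ((N.shift 1).shift 1).deg m := hx

/-- The contractible complex `N ⊕ N[1]`. -/
abbrev cone (N : GVect.{u}) : GVect.{u} := N.prod (N.shift 1)

/-- The differential `(a, b) ↦ (b, 0)` of the contractible complex. -/
def coneD (N : GVect.{u}) : N.cone.shift 1 →ₗ[ℝ] N.cone.shift 1 :=
  pair (A := N) (B := N.shift 1) (N.unshift ∘ₗ snd N (N.shift 1) 1) 0

theorem coneD_coneD (N : GVect.{u}) (x : N.cone.shift 1) : N.coneD (N.coneD x) = 0 :=
  prod_ext (by simp [coneD]) (by simp [coneD])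

theorem isHomog_coneD (N : GVect.{u}) : IsHomog 1 N.coneD := fun m x hx =>
  mem_deg_prod.2 ⟨N.isHomog_unshift _ _ (mem_deg_prod.1 hx).2, zero_mem _⟩

theorem coneD_eq_zero_iff (N : GVect.{u}) {x : N.cone.shift 1} (hx : N.coneD x = 0) :
    ∃ y, x = N.coneD y := by
  have h : N.unshift (snd N (N.shift 1) 1 x) = 0 := by
    simpa [coneD] using congrArg (fst N (N.shift 1) 1) hx
  refine ⟨pair (A := N) (B := N.shift 1) 0 N.reshift (fst N (N.shift 1) 1 x), prod_ext ?_ ?_⟩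
  · simp [coneD]; rfl
  · rw [← N.reshift_unshift (snd N (N.shift 1) 1 x), h]
    simp [coneD]

end GVect

namespace LInfty

open GSym

variable (h : LInfty.{u}) (N : GVect.{u})

/-- The product of `𝔥` with the contractible complex `N ⊕ N[1]`. -/
abbrev cylinder (hN : ∀ m > 0, N.deg m = ⊥) : LInfty.{u} :=
  h.twist N.cone
    (fun m hm => by
      change (N.deg m).prod (N.deg (m + 1)) = ⊥
      rw [hN m hm, hN (m + 1) (by omega), Submodule.prod_bot])
    (N.coneD ∘ₗ GVect.snd h.g N.cone 1 ∘ₗ pr _)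
    (fun d x hx => N.isHomog_coneD _ _ (GVect.mem_deg_prod.1 (pr_mem_deg hx)).2)
    (by simp [pr_one])
    (fun x => by
      simp only [LinearMap.comp_apply, pr_coder, twistLam, GVect.snd_pair, N.coneD_coneD])

variable (hN : ∀ m > 0, N.deg m = ⊥)

theorem fst_lam_cylinder (x : GSym (h.cylinder N hN).sh) :
    GVect.fst h.g N.cone 1 ((h.cylinder N hN).lam x) =
      h.lam (map (GVect.fst h.g N.cone 1) GVect.isHomog_fst x) := rfl

theorem snd_lam_cylinder (x : GSym (h.cylinder N hN).sh) :
    GVect.snd h.g N.cone 1 ((h.cylinder N hN).lam x) =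
      N.coneD (GVect.snd h.g N.cone 1 (pr (h.cylinder N hN).sh x)) := rfl

/-- The projection of the cylinder. -/
def cylinderFst : StrictHom (h.cylinder N hN) h where
  lin := GVect.fst h.g N.cone 1
  homog := GVect.isHomog_fst
  comm x := (h.fst_lam_cylinder N hN x).symm

/-- The unary bracket is a direct sum of that of 𝔥 and the exact differential of the cone. -/
theorem isQuasiIso_cylinderFst : (h.cylinderFst N hN).toHom.IsQuasiIso := by
  have h1 : ∀ x, (h.cylinderFst N hN).toHom.linPart x = GVect.fst h.g N.cone 1 x := fun x => by
    change pr h.sh (map (GVect.fst h.g N.cone 1) GVect.isHomog_fst (FreeSwap.ι 1 _ x)) = _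
    rw [map_ι, pr_ι]
  have h2 : ∀ x, GVect.fst h.g N.cone 1 ((h.cylinder N hN).lam₁ x) =
      h.lam₁ (GVect.fst h.g N.cone 1 x) := fun x => by
    rw [lam₁, LinearMap.comp_apply, fst_lam_cylinder]
    exact congrArg h.lam (map_ι _ _ _)
  have h3 : ∀ x, GVect.snd h.g N.cone 1 ((h.cylinder N hN).lam₁ x) =
      N.coneD (GVect.snd h.g N.cone 1 x) := fun x => by
    rw [lam₁, LinearMap.comp_apply, snd_lam_cylinder, pr_ι]
  refine ⟨fun y hy => ⟨GVect.pair (A := h.g) (B := N.cone) LinearMap.id 0 y, 0,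
    GVect.prod_ext ?_ ?_, ?_⟩, fun x hx z hz => ?_⟩
  · rw [h2, GVect.fst_pair, map_zero]; exact hy
  · rw [h3, GVect.snd_pair, map_zero, LinearMap.zero_apply, map_zero]
  · rw [h1, GVect.fst_pair, map_zero, add_zero]; rfl
  · have h4 := h3 x
    rw [hx, map_zero] at h4
    obtain ⟨y, hy⟩ := N.coneD_eq_zero_iff h4.symm
    refine ⟨GVect.pair (A := h.g) (B := N.cone) (LinearMap.fst ℝ _ _) (LinearMap.snd ℝ _ _) (z, y),
      GVect.prod_ext ?_ ?_⟩
    · rw [h2, ← h1, hz, GVect.fst_pair]; rfl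
    · rw [h3, GVect.snd_pair, hy]; rfl

/-- The inclusion at the start of the cylinder. -/
def cylinderInl : StrictHom h (h.cylinder N hN) where
  lin := GVect.pair (A := h.g) (B := N.cone) LinearMap.id 0
  homog := GVect.isHomog_pair (GVect.isHomog_id _) (GVect.isHomog_zero _ _)
  comm x := by
    refine GVect.prod_ext ?_ ?_
    · rw [fst_lam_cylinder, GVect.fst_pair]
      refine congrArg h.lam ?_
      refine (map_comp_apply _ _ _ _ (GVect.isHomog_id _) x).trans (map_eq_self _ (fun _ => rfl) x)
    · rw [snd_lam_cylinder, GVect.snd_pair]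
      refine (congrArg (fun z => N.coneD (GVect.snd h.g N.cone 1 z)) (pr_map _ _ x)).trans ?_
      rw [GVect.snd_pair, LinearMap.zero_apply, map_zero, LinearMap.zero_apply]

end LInfty

namespace LInfty

open GSym

variable {h : LInfty.{u}} {N : GVect.{u}} (hN : ∀ m > 0, N.deg m = ⊥)

/-- The inclusion at the end of the cylinder with corestriction `(pr, φ, φ ∘ d)`. -/
theorem exists_cylinderInr {φ : GSym h.sh →ₗ[ℝ] N.shift 1}
    (hφ : ∀ d, ∀ x ∈ deg h.sh d, φ x ∈ (N.shift 1).deg d) (hφ1 : φ 1 = 0) :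
    ∃ G : LInftyHom h (h.cylinder N hN),
      (∀ x, (h.cylinderFst N hN).toHom.toLin (G.toLin x) = x) ∧
      ∀ x, GVect.fst N (N.shift 1) 1 (GVect.snd h.g N.cone 1 (pr _ (G.toLin x))) = φ x := by
  -- The last component is forced: the cone differential moves it to the first cone coordinate,
  -- where compatibility with d demands φd.
  let κ : GSym h.sh →ₗ[ℝ] (h.cylinder N hN).sh :=
    GVect.pair (A := h.g) (B := N.cone) (pr h.sh)
      (GVect.pair (A := N) (B := N.shift 1) φ (N.reshift ∘ₗ φ ∘ₗ h.d))
  have hκ1 : κ 1 = 0 := GVect.prod_ext (pr_one) (GVect.prod_ext hφ1 (by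
    change N.reshift (φ (h.d 1)) = 0
    rw [h.d_one, map_zero, map_zero]))
  have hG : IsCoalgHom (expo κ) := isCoalgHom_expo hκ1 fun d x hx =>
    GVect.mem_deg_prod.2 ⟨pr_mem_deg hx, GVect.mem_deg_prod.2
      ⟨hφ d x hx, N.reshift_mem (hφ _ _ (h.d_mem_deg d x hx))⟩⟩
  have hpr : ∀ x, pr (h.cylinder N hN).sh (expo κ x) = κ x := pr_expo hκ1
  have hfst : ∀ x, map (GVect.fst h.g N.cone 1) GVect.isHomog_fst (expo κ x) = x :=
    LinearMap.congr_fun (((isCoalgHom_map (GVect.fst h.g N.cone 1) GVect.isHomog_fst).comp hG).ext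
      isCoalgHom_id fun x => by
        rw [LinearMap.comp_apply, AlgHom.toLinearMap_apply, pr_map, hpr]; rfl)
  refine ⟨hG.toHom fun x => ?_, hfst, fun x => ?_⟩
  · rw [hpr]
    refine GVect.prod_ext ?_ (GVect.prod_ext ?_ ?_)
    · rw [fst_lam_cylinder, hfst]
      exact h.pr_d x
    · rw [snd_lam_cylinder, hpr]
      rfl
    · rw [snd_lam_cylinder, hpr]
      change N.reshift (φ (h.d (h.d x))) = 0
      rw [h.d_d, map_zero, map_zero]
  · change GVect.fst N (N.shift 1) 1 (GVect.snd h.g N.cone 1 (pr _ (expo κ x))) = φ x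
    rw [hpr]
    rfl

end LInfty

/-! ### Classes of two lifts of the same morphism. -/

namespace Ruth

variable {g h : LInfty.{u}} {V : GVect.{v}} {W : GVect.{w}}

theorem cls_of_mem (ρ : Ruth g V) {q : ℤ} {α : GSym g.sh →ₗ[ℝ] V} (hα : α ∈ ρ.cocycles q) :
    ρ.cls q α = Submodule.Quotient.mk ⟨α, hα⟩ := dif_pos hα

end Ruth

namespace RuthHom

variable {g h h' : LInfty.{u}} {V : GVect.{v}} {W : GVect.{w}} {τ : Ruth h W} {ρ : Ruth g V}

theorem pullH_cls (Φ : RuthHom τ ρ) {q : ℤ} {α : GSym g.sh →ₗ[ℝ] V} (hα : α ∈ ρ.cocycles q) :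
    Φ.pullH q (ρ.cls q α) = τ.cls q (Φ.pull α) := by
  rw [ρ.cls_of_mem hα, τ.cls_of_mem (Φ.pull_mem_cocycles hα)]
  rfl

/-- The pullback of a ruth morphism along an `L∞`-morphism. -/
def restrict (Φ : RuthHom τ ρ) (G : LInftyHom h' h) : RuthHom (τ.pullback G) ρ where
  T := Φ.T.comp G
  t := Φ.t
  homog := Φ.homog
  comm := TensorProduct.ext' fun x v => LinearMap.congr_fun Φ.comm (G.toLin x ⊗ₜ v)

/-- The ruth morphism over a right inverse of an `L∞`-morphism. -/
def ofRightInverse (τ : Ruth h W) {Q : LInftyHom h' h} {G : LInftyHom h h'}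
    (hQ : ∀ x, Q.toLin (G.toLin x) = x) : RuthHom τ (τ.pullback Q) where
  T := G
  t := LinearMap.id
  homog n x hx := by simpa using hx
  comm := TensorProduct.ext' fun x v => by simp [Ruth.pullback, hQ]

/-- Two right inverses of a quasi-isomorphism induce the same map in cohomology. -/
theorem pullH_ofRightInverse_eq (τ : Ruth h W) {Q : LInftyHom h' h} (hQ : Q.IsQuasiIso)
    {G G' : LInftyHom h h'} (hG : ∀ x, Q.toLin (G.toLin x) = x)
    (hG' : ∀ x, Q.toLin (G'.toLin x) = x) (q : ℤ) :
    (ofRightInverse τ hG).pullH q = (ofRightInverse τ hG').pullH q := by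
  -- Each right inverse G of Q gives a left inverse of the bijection Q^*, hence its inverse.
  have key : ∀ {G : LInftyHom h h'} (hG : ∀ x, Q.toLin (G.toLin x) = x) (c),
      (ofRightInverse τ hG).pullH q ((canonical Q τ).pullH q c) = c := by
    intro G hG c
    obtain ⟨⟨α, hα⟩, rfl⟩ := Submodule.Quotient.mk_surjective _ c
    rw [← τ.cls_of_mem hα, pullH_cls _ hα, pullH_cls _ ((canonical Q τ).pull_mem_cocycles hα)]
    congr 1
    ext x
    simp [pull, canonical, ofRightInverse, hG]
  refine LinearMap.ext fun c => ?_
  obtain ⟨c, rfl⟩ := (canonical_pullH_bijective hQ τ q).2 c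
  rw [key hG, key hG']

end RuthHom

namespace Extension

open GSym

variable {n g h : LInfty.{u}} {E : Extension n g} {V : GVect.{v}} {W : GVect.{w}} {ρ : Ruth g V}
  {τ : Ruth h W} {k : ℕ} {p : ℤ} {f : GExt.Pow k n.sh →ₗ[ℝ] V}

/-- The classes defined by two lifts of the same morphism agree. -/
theorem IsCurv.cls_eq (Φ : RuthHom τ ρ) {F₀ F₁ : GSym h.sh →ₗ[ℝ] GSym E.mid.sh}
    {K₀ K₁ : GSym h.sh →ₗ[ℝ] n.sh} (hK₀ : E.IsCurv F₀ K₀) (hF₀ : E.IsLift Φ.T F₀)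
    (hK₁ : E.IsCurv F₁ K₁) (hF₁ : E.IsLift Φ.T F₁) (hf : f ∈ E.Inv ρ k p) :
    τ.cls (k + p) (Φ.t ∘ₗ cwMap K₀ f) = τ.cls (k + p) (Φ.t ∘ₗ cwMap K₁ f) := by
  -- Both lifts cover the same morphism, so their corestrictions differ by a map φ with values in
  -- 𝔫[1].
  have hker : ∀ x, (pr E.mid.sh ∘ₗ F₁ - pr E.mid.sh ∘ₗ F₀) x ∈ LinearMap.ker E.π.lin := by
    intro x
    have h1 : ∀ {F : GSym h.sh →ₗ[ℝ] GSym E.mid.sh}, E.IsLift Φ.T F →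
        E.π.lin (pr E.mid.sh (F x)) = pr g.sh (Φ.T.toLin x) := fun hF => by
      rw [← pr_map E.π.lin E.π.homog, ← hF.symMap_π]; rfl
    simp [h1 hF₀, h1 hF₁]
  obtain ⟨φ, hφ⟩ : ∃ φ : GSym h.sh →ₗ[ℝ] n.sh, ∀ x,
      E.ι.lin (φ x) = pr E.mid.sh (F₁ x) - pr E.mid.sh (F₀ x) :=
    ⟨E.kerEquiv.toLinearMap ∘ₗ LinearMap.codRestrict _ _ hker, fun x => by simp [E.ι_kerEquiv]⟩
  obtain ⟨G, hG, hGφ⟩ := LInfty.exists_cylinderInr n.nonpos (φ := φ)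
    (fun d x hx => E.mem_deg_of_ι <| by
      rw [hφ]
      exact sub_mem (pr_mem_deg (hF₁.isCoalgHom.map_deg _ _ hx))
        (pr_mem_deg (hF₀.isCoalgHom.map_deg _ _ hx)))
    (E.inj <| by rw [hφ, hF₀.isCoalgHom.map_one, hF₁.isCoalgHom.map_one, sub_self, map_zero])
  let Q := (h.cylinderFst n.g n.nonpos).toHom
  let G₀ := (h.cylinderInl n.g n.nonpos).toHom
  have hG₀ : ∀ x, Q.toLin (G₀.toLin x) = x := fun x =>
    (map_comp_apply _ _ _ _ (GVect.isHomog_id _) x).trans (map_eq_self _ (fun _ => rfl) x)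
  -- The first cone coordinate is 0 along G₀ and φ along G, so the extended lift restricts to F₀ and
  -- F₁.
  let c : n.g.cone.shift 1 →ₗ[ℝ] n.sh := GVect.fst n.g (n.g.shift 1) 1
  have hc : GVect.IsHomog 0 c := GVect.isHomog_fst
  let F := extendLift E F₀ c
  have hF : E.IsLift (Φ.restrict Q).T F :=
    ⟨isCoalgHom_extendLift hF₀ hc, symMap_extendLift hF₀ hc⟩
  obtain ⟨K, hK⟩ := hF.exists_curv
  have e₀ : F ∘ₗ G₀.toLin = F₀ := (hF.isCoalgHom.comp G₀.isCoalgHom).ext hF₀.isCoalgHom fun x => by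
    rw [LinearMap.comp_apply]
    refine (pr_extendLift hF₀ (G₀.toLin x)).trans ?_
    have h1 : map (GVect.fst h.g n.g.cone 1) GVect.isHomog_fst (G₀.toLin x) = x := hG₀ x
    have h2 : GVect.snd h.g n.g.cone 1 (pr _ (G₀.toLin x)) = 0 :=
      (congrArg (GVect.snd h.g n.g.cone 1) (pr_map _ _ x)).trans rfl
    rw [h1, h2, map_zero, map_zero, add_zero]
  have e₁ : F ∘ₗ G.toLin = F₁ := (hF.isCoalgHom.comp G.isCoalgHom).ext hF₁.isCoalgHom fun x => by
    rw [LinearMap.comp_apply]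
    refine (pr_extendLift hF₀ (G.toLin x)).trans ?_
    have h1 : map (GVect.fst h.g n.g.cone 1) GVect.isHomog_fst (G.toLin x) = x := hG x
    have h2 : c (GVect.snd h.g n.g.cone 1 (pr _ (G.toLin x))) = φ x := hGφ x
    rw [h1, h2, hφ, add_sub_cancel]
  have k₀ : K ∘ₗ G₀.toLin = K₀ := by
    have := hK.comp G₀
    rw [e₀] at this
    exact this.unique hK₀
  have k₁ : K ∘ₗ G.toLin = K₁ := by
    have := hK.comp G
    rw [e₁] at this
    exact this.unique hK₁
  have hα := hK.cwMap_mem_cocycles (Φ.restrict Q) hF hf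
  have h3 := LinearMap.congr_fun (RuthHom.pullH_ofRightInverse_eq τ
    (h.isQuasiIso_cylinderFst n.g n.nonpos) hG₀ hG (k + p))
    ((τ.pullback Q).cls (k + p) ((Φ.restrict Q).t ∘ₗ cwMap K f))
  rw [RuthHom.pullH_cls _ hα, RuthHom.pullH_cls _ hα] at h3
  rw [← k₀, ← k₁, cwMap_comp, cwMap_comp]
  exact h3

end Extension

/-! ### Naturality -/

theorem GSym.sgn_sgn_self {V : GVect.{u}} (q : ℤ) (x : GSym V) : sgn V q (sgn V q x) = x := by
  refine LinearMap.congr_fun (f := (sgn V q).toLinearMap ∘ₗ (sgn V q).toLinearMap)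
    (g := LinearMap.id) (hom_ext_deg fun d x hx => ?_) x
  simp [sgn_of_mem V _ hx, smul_smul, ← mul_zpow]

/-- The identity morphism. -/
def LInftyHom.id (g : LInfty.{u}) : LInftyHom g g where
  toLin := LinearMap.id
  map_deg _ _ hx := hx
  map_one := rfl
  counit _ := rfl
  comul := by rw [TensorProduct.map_id]; rfl
  comm := rfl

/-- The identity ruth morphism. -/
def RuthHom.id {g : LInfty.{u}} {V : GVect.{v}} (ρ : Ruth g V) : RuthHom ρ ρ where
  T := LInftyHom.id g
  t := LinearMap.id
  homog n x hx := by simpa using hx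
  comm := rfl

namespace Extension

open GSym

variable {n g h : LInfty.{u}} {E : Extension n g} {V : GVect.{v}} {W : GVect.{w}}

theorem Splitting.isCurv (s : E.Splitting) :
    E.IsCurv (map s.lin s.homog).toLinearMap s.curv := fun x => by
  simp [curv, E.ι_kerEquiv, curvMid, pr_map, g.pr_d]

/-- The pulled back cochain of s is the cochain of the lift S(s)T, whose curvature is K_s T. -/
theorem Splitting.cls_cwCochain (s : E.Splitting) {ρ : Ruth g V} {τ : Ruth h W} (Φ : RuthHom τ ρ)
    {k : ℕ} {p : ℤ} {f : GExt.Pow k n.sh →ₗ[ℝ] V} (hf : f ∈ E.Inv ρ k p)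
    {F : GSym h.sh →ₗ[ℝ] GSym E.mid.sh} {K : GSym h.sh →ₗ[ℝ] n.sh} (hK : E.IsCurv F K)
    (hF : E.IsLift Φ.T F) :
    τ.cls (k + p) (Φ.pull (s.cwCochain f)) = τ.cls (k + p) (Φ.t ∘ₗ cwMap K f) := by
  have h1 := (s.isCurv.comp Φ.T).cls_eq Φ (s.isLift Φ.T) hK hF hf
  rw [cwMap_comp] at h1
  exact h1

/-- Sections are lifts of the identity. -/
theorem cwWellDefined (E : Extension n g) (ρ : Ruth g V) (k : ℕ) (p : ℤ) :
    E.CWWellDefined ρ k p := fun f s =>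
  ⟨s.isCurv.cwMap_mem_cocycles (RuthHom.id ρ) (s.isLift (LInftyHom.id g)) f.2,
    (Classical.choice E.nonempty_splitting).cls_cwCochain (RuthHom.id ρ) f.2 s.isCurv
      (s.isLift (LInftyHom.id g))⟩

end Extension

namespace PullbackExtension

open GSym

variable {n g h : LInfty.{u}} {E : Extension n g} {T : LInftyHom h g} (P : PullbackExtension E T)

theorem hom_ι_mul (v : n.sh) (y : GSym P.ext.mid.sh) :
    P.hom.toLin (FreeSwap.ι 1 P.ext.mid.sh (P.ext.ι.lin v) * y) =
      FreeSwap.ι 1 E.mid.sh (E.ι.lin v) * P.hom.toLin y := by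
  induction v using DirectSum.Decomposition.inductionOn n.sh.deg with
  | zero => simp
  | add a b ha hb => simp only [map_add, add_mul, ha, hb]
  | @homogeneous m v =>
    have h1 := P.hom_mul_ι (sgn P.ext.mid.sh m y) v
    rwa [mul_ι (P.ext.ι_mem_deg v.2), sgn_sgn_self, mul_ι (E.ι_mem_deg v.2),
      ← P.hom.isCoalgHom.sgn_apply, sgn_sgn_self] at h1

theorem pr_hom_ι_mul (v : n.sh) (y : GSym P.ext.mid.sh) :
    pr E.mid.sh (P.hom.toLin (FreeSwap.ι 1 P.ext.mid.sh (P.ext.ι.lin v) * y)) =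
      counit P.ext.mid.sh y • E.ι.lin v := by
  rw [P.hom_ι_mul, pr_ι_mul, P.hom.counit]

/-- By the normalisation, the right side is the corestriction of T• d(x ∨ v). Terms of d(x ∨ v) in
which v stays outside the bracket are v times an element without counit, and pr T• kills them. When
v is inside, the bracket lies in 𝔫 and only the term involving all of x survives. -/
theorem ad_eq (x : GSym P.ext.mid.sh) (v : n.sh) :
    P.ext.ad (x ⊗ₜ v) = E.ad (P.hom.toLin x ⊗ₜ v) := by
  apply E.inj
  rw [E.ι_ad, E.adMid_tmul, ← P.hom_mul_ι, ← E.mid.pr_d, ← P.hom.apply_d]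
  induction v using DirectSum.Decomposition.inductionOn n.sh.deg with
  | zero => simp
  | add a b ha hb => simp only [map_add, TensorProduct.tmul_add, mul_add, ha, hb]
  | @homogeneous m v =>
    obtain ⟨v, hv⟩ := v
    have hu := P.ext.ι_mem_deg hv
    simp only
    set u := P.ext.ι.lin v with hu'
    have key : ∀ t, pr E.mid.sh (P.hom.toLin (LinearMap.mul' ℝ (GSym P.ext.mid.sh)
        (TensorProduct.map (FreeSwap.ι 1 P.ext.mid.sh ∘ₗ P.ext.mid.lam) LinearMap.id
          (comulOp P.ext.mid.sh u (TensorProduct.map (sgn P.ext.mid.sh m).toLinearMap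
            (sgn P.ext.mid.sh m).toLinearMap t))))) =
        E.ι.lin (P.ext.ad (TensorProduct.rid ℝ (GSym P.ext.mid.sh)
          (TensorProduct.map LinearMap.id (counit P.ext.mid.sh).toLinearMap t) ⊗ₜ v)) := by
      intro t
      induction t using TensorProduct.induction_on with
      | zero => simp
      | add a b ha hb => simp only [map_add, TensorProduct.add_tmul, ha, hb]
      | tmul a b =>
        have h1 : P.ext.mid.lam (FreeSwap.ι 1 P.ext.mid.sh u * sgn P.ext.mid.sh m a) =
            P.ext.ι.lin (P.ext.ad (a ⊗ₜ v)) := by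
          rw [P.ext.ι_ad, P.ext.adMid_tmul, ← hu', mul_ι hu]
        simp only [TensorProduct.map_tmul, AlgHom.toLinearMap_apply, comulOp_tmul _ hu, map_add,
          LinearMap.comp_apply, LinearMap.mul'_apply, LinearMap.id_apply, h1, ← mul_assoc, mul_ι hu,
          TensorProduct.rid_tmul]
        rw [mul_assoc, hu', pr_hom_ι_mul, pr_hom_ι_mul, map_mul, counit_sgn, counit_sgn, counit_ι,
          zero_mul, zero_smul, add_zero, ← TensorProduct.smul_tmul', map_smul, map_smul]
    have h2 := key (comul P.ext.mid.sh x)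
    rw [rid_map_counit_comul, ← comul_sgn, ← comul_ι_mul, ← mul_ι hu] at h2
    exact h2.symm

variable {V : GVect.{v}} {W : GVect.{w}} {ρ : Ruth g V} {τ : Ruth h W}

/-- The lift of `T` defined by a section of the pullback extension. -/
theorem isLift (s : P.ext.Splitting) :
    E.IsLift T (P.hom.toLin ∘ₗ (map s.lin s.homog).toLinearMap) where
  isCoalgHom := P.hom.isCoalgHom.comp (isCoalgHom_map _ _)
  symMap_π x := by
    have h1 := LinearMap.congr_fun P.comm_π (map s.lin s.homog x)
    have h2 : P.ext.π.toHom.toLin (map s.lin s.homog x) = x :=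
      (s.isLift (LInftyHom.id h)).symMap_π x
    rw [LinearMap.comp_apply, LinearMap.comp_apply, h2] at h1
    exact h1

/-- T• commutes with the codifferentials, so the curvature of T•S(s) is pr T• of the defect ιK_s *
S(s). The normalisation of T• reduces this to ιK_s. -/
theorem isCurv (s : P.ext.Splitting) :
    E.IsCurv (P.hom.toLin ∘ₗ (map s.lin s.homog).toLinearMap) s.curv := fun x => by
  have h1 := s.isCurv.d_apply (s.isLift (LInftyHom.id h)) x
  have h2 := congrArg (fun z => pr E.mid.sh (P.hom.toLin z)) h1
  simp only [map_add, P.hom.apply_d, E.mid.pr_d] at h2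
  have h3 : pr E.mid.sh (P.hom.toLin (conv (P.ext.ι.lin ∘ₗ s.curv)
      (map s.lin s.homog).toLinearMap x)) = E.ι.lin (s.curv x) := by
    conv_rhs => rw [← rid_map_counit_comul x]
    rw [conv, LinearMap.comp_apply, LinearMap.comp_apply]
    generalize comul h.sh x = t
    induction t using TensorProduct.induction_on with
    | zero => simp
    | add a b ha hb => simp only [map_add, ha, hb]
    | tmul a b =>
      simp only [TensorProduct.map_tmul, LinearMap.comp_apply, LinearMap.mul'_apply, pr_hom_ι_mul,
        AlgHom.toLinearMap_apply, counit_map, TensorProduct.rid_tmul, LinearMap.id_apply, map_smul]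
  rw [← h3, LinearMap.comp_apply, LinearMap.comp_apply, eq_sub_iff_add_eq, add_comm]
  exact h2.symm

theorem comp_mem_Inv (Φ : RuthHom τ ρ) (P : PullbackExtension E Φ.T) {k : ℕ} {p : ℤ}
    {f : GExt.Pow k n.sh →ₗ[ℝ] V} (hf : f ∈ E.Inv ρ k p) : Φ.t ∘ₗ f ∈ P.ext.Inv τ k p := by
  refine ⟨fun e v hv => ?_, fun d x hx e v hv => ?_⟩
  · simpa using Φ.homog _ _ (hf.1 e v hv)
  · have h1 : GExt.powAct P.ext.ad d x e v = GExt.powAct E.ad d (P.hom.toLin x) e v := by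
      simp only [GExt.powAct, P.ad_eq]
    have h2 := LinearMap.congr_fun Φ.comm (P.ext.π.toHom.toLin x ⊗ₜ f (GExt.wedge v))
    have h3 := LinearMap.congr_fun P.comm_π x
    simp only [LinearMap.comp_apply, TensorProduct.map_tmul, LinearMap.id_apply] at h2 h3
    rw [LinearMap.comp_apply, h1, hf.2 d _ (P.hom.map_deg d x hx) e v hv, map_smul,
      LinearMap.comp_apply]
    simp only [Ruth.pullback, LinearMap.comp_apply, TensorProduct.map_tmul, LinearMap.id_apply]
    rw [h3, h2]

/-- The Chern-Weil-Lecomte map is natural. -/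
theorem pullH_cw (Φ : RuthHom τ ρ) (P : PullbackExtension E Φ.T) {k : ℕ} {p : ℤ}
    (f : E.Inv ρ k p) :
    Φ.pullH (k + p) (E.cw ρ k p f) = P.ext.cw τ k p ⟨Φ.t ∘ₗ f.1, comp_mem_Inv Φ P f.2⟩ := by
  rw [Extension.cw, Φ.pullH_cls (E.cwWellDefined ρ k p f _).1,
    Extension.Splitting.cls_cwCochain _ Φ f.2 (P.isCurv _)
      (P.isLift (Classical.choice P.ext.nonempty_splitting))]
  rfl

end PullbackExtension

end

theorem mainTheorem3 {g h n : LInfty.{u}} (E : Extension n g) {V : GVect.{v}} {W : GVect.{w}}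
    (ρ : Ruth g V) (τ : Ruth h W) (Φ : RuthHom τ ρ) :
    -- the pullback extension exists
    Nonempty (PullbackExtension E Φ.T) ∧
    -- naturality
    (∀ (P : PullbackExtension E Φ.T) (k : ℕ) (p : ℤ),
      E.CWWellDefined ρ k p ∧ P.ext.CWWellDefined τ k p ∧
      ∀ f : E.Inv ρ k p, ∃ hf : Φ.t ∘ₗ f.1 ∈ P.ext.Inv τ k p,
        Φ.pullH (k + p) (E.cw ρ k p f) = P.ext.cw τ k p ⟨Φ.t ∘ₗ f.1, hf⟩) ∧
    -- invariance under quasi-isomorphisms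
    (Φ.T.IsQuasiIso →
      (∀ q : ℤ, Function.Bijective ((RuthHom.canonical Φ.T ρ).pullH q)) ∧
      ∀ (P : PullbackExtension E Φ.T) (k : ℕ) (p : ℤ) (f : E.Inv ρ k p),
        ∃ hf : f.1 ∈ P.ext.Inv (ρ.pullback Φ.T) k p,
          (RuthHom.canonical Φ.T ρ).pullH (k + p) (E.cw ρ k p f) =
            P.ext.cw (ρ.pullback Φ.T) k p ⟨f.1, hf⟩) := by
  obtain ⟨s⟩ := E.nonempty_splitting
  exact ⟨⟨s.pullbackExtension Φ.T⟩,
    fun P k p => ⟨E.cwWellDefined ρ k p, P.ext.cwWellDefined τ k p, fun f =>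
      ⟨PullbackExtension.comp_mem_Inv Φ P f.2, PullbackExtension.pullH_cw Φ P f⟩⟩,
    -- The equality of classes is naturality for the ruth morphism with t = id.
    fun hT => ⟨RuthHom.canonical_pullH_bijective hT ρ, fun P k p f =>
      ⟨PullbackExtension.comp_mem_Inv (RuthHom.canonical Φ.T ρ) P f.2,
        PullbackExtension.pullH_cw (RuthHom.canonical Φ.T ρ) P f⟩⟩⟩
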